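/- Let $n\ge 4$ and let $(M^n,g)$ be a complete smooth Riemannian manifold without boundary, with Levi-Civita connection $D$, Riemann tensor $R$ (signed so that $R(X,Y,X,Y)$ is the sectional curvature for orthonormal $X,Y$), Ricci tensor $r$, scalar curvature $s$, traceless Ricci tensor $z=r-\frac sn g$ and Weyl tensor $\mathcal W$. Define, for local orthonormal frames $\{E_a\}$, $$\delta\mathcal W(X,Y,Z)=-\sum_a (D_{E_a}\mathcal W)(E_a,X,Y,Z),$$ $$C(X,Y,Z)=(D_Xr)(Y,Z)-(D_Yr)(X,Z)-\tfrac1{2(n-1)}\bigl(ds(X)\,g(Y,Z)-ds(Y)\,g(X,Z)\bigr)$$ (the Cotton tensor), and the Bach tensor $$B=\tfrac1{n-3}\,\delta^D\delta\mathcal W+\tfrac1{n-2}\,\mathring{\mathcal W}z,\qquad \mathring{\mathcal W}z(X,Y)=\sum_{a,b}\mathcal W(X,E_a,Y,E_b)\,z(E_a,E_b),$$ where $\delta^DT(Y,Z)=-\sum_a(D_{E_a}T)(E_a,Y,Z)$ for 3-tensors $T$ antisymmetric in the first two arguments, and $\delta^D\delta\mathcal W$ means $\delta^D$ applied to $T(X,Y,Z)=\delta\mathcal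 W(Z,X,Y)$. Let $u,h,\lambda:M\to\mathbb R$ be smooth functions such that $h$ is everywhere positive or everywhere negative and $$r+h\,Ddu=\lambda\,g ,$$ that is, $(M,g,\nabla u,h,\lambda)$ is an $h$-almost gradient Ricci soliton with potential function $u$. Assume that 1. $g$ is Bach-flat: $B=0$ on $M$; 2. every level set $u^{-1}(c)$, $c\in\mathbb R$, is compact; 3. $h$ is a function of $u$ only, with $\frac{dh}{du}>0$ on $M$: there is a function $\varphi$ with $h=\varphi\circ u$ such that, at every point of $u(M)$, $\varphi$ is differentiable relative to $u(M)$ with a positive derivative (a vacuous derivative condition where the point is isolated in $u(M)$, for instance when $u$ is constant). Then the Cotton tensor $C$ vanishes identically and $\delta\mathcal W=0$ on $M$; that is, $(M,g)$ has harmonic Weyl curvature. -/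

import Mathlib

open scoped Manifold ContDiff Bundle

noncomputable section

namespace RicciSoliton

/-! ### Tensor calculus in local coordinates

`G : Coord n → Matrix (Fin n) (Fin n) ℝ` stands for the matrix `(g_ij)` of a Riemannian metric in
local coordinates.  Tensors are given by their covariant components. -/

/-- The coordinate space `ℝⁿ`. -/
abbrev Coord (n : ℕ) : Type := EuclideanSpace ℝ (Fin n)

variable {n : ℕ}

/-- The partial derivative `∂_i f` at `y`. -/
def partialDeriv (i : Fin n) (f : Coord n → ℝ) (y : Coord n) : ℝ :=
  fderiv ℝ f y (EuclideanSpace.single i 1)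

/-- Christoffel symbols of the Levi-Civita connection:
`Γ^k_ij = ½ g^{kl} (∂_i g_jl + ∂_j g_il - ∂_l g_ij)`. -/
def christoffel (G : Coord n → Matrix (Fin n) (Fin n) ℝ) (y : Coord n) (k i j : Fin n) : ℝ :=
  (1 / 2) * ∑ l, (G y)⁻¹ k l *
    (partialDeriv i (fun z => G z j l) y + partialDeriv j (fun z => G z i l) y
      - partialDeriv l (fun z => G z i j) y)

/-- `∇_m T_ij` for a covariant 2-tensor `T`. -/
def covDeriv₂ (G : Coord n → Matrix (Fin n) (Fin n) ℝ) (T : Coord n → Fin n → Fin n → ℝ)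
    (y : Coord n) (m i j : Fin n) : ℝ :=
  partialDeriv m (fun z => T z i j) y
    - ∑ p, christoffel G y p m i * T y p j
    - ∑ p, christoffel G y p m j * T y i p

/-- `∇_m T_ijk` for a covariant 3-tensor `T`. -/
def covDeriv₃ (G : Coord n → Matrix (Fin n) (Fin n) ℝ)
    (T : Coord n → Fin n → Fin n → Fin n → ℝ) (y : Coord n) (m i j k : Fin n) : ℝ :=
  partialDeriv m (fun z => T z i j k) y
    - ∑ p, christoffel G y p m i * T y p j k
    - ∑ p, christoffel G y p m j * T y i p k
    - ∑ p, christoffel G y p m k * T y i j p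

/-- `∇_m T_ijkl` for a covariant 4-tensor `T`. -/
def covDeriv₄ (G : Coord n → Matrix (Fin n) (Fin n) ℝ)
    (T : Coord n → Fin n → Fin n → Fin n → Fin n → ℝ) (y : Coord n) (m i j k l : Fin n) : ℝ :=
  partialDeriv m (fun z => T z i j k l) y
    - ∑ p, christoffel G y p m i * T y p j k l
    - ∑ p, christoffel G y p m j * T y i p k l
    - ∑ p, christoffel G y p m k * T y i j p l
    - ∑ p, christoffel G y p m l * T y i j k p

/-- The Hessian `(Ddf)_ij = ∂_i ∂_j f - Γ^k_ij ∂_k f`. -/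
def hessian (G : Coord n → Matrix (Fin n) (Fin n) ℝ) (f : Coord n → ℝ) (y : Coord n)
    (i j : Fin n) : ℝ :=
  partialDeriv i (partialDeriv j f) y - ∑ k, christoffel G y k i j * partialDeriv k f y

/-- The component along `∂_m` of
`∇_i ∇_j ∂_k - ∇_j ∇_i ∂_k` (here `∂_i, ∂_j, ∂_k` are the coordinate vector fields). -/
def curvatureUp (G : Coord n → Matrix (Fin n) (Fin n) ℝ) (y : Coord n) (m i j k : Fin n) : ℝ :=
  partialDeriv i (fun z => christoffel G z m j k) y
    - partialDeriv j (fun z => christoffel G z m i k) y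
    + ∑ p, (christoffel G y p j k * christoffel G y m i p
      - christoffel G y p i k * christoffel G y m j p)

/-- The curvature tensor `R_ijkl = ⟨∇_i ∇_j ∂_l - ∇_j ∇_i ∂_l, ∂_k⟩`; with this sign `R_ijij` is
the (unnormalized) sectional curvature, so it is positive on round spheres. -/
def riemann (G : Coord n → Matrix (Fin n) (Fin n) ℝ) (y : Coord n) (i j k l : Fin n) : ℝ :=
  ∑ m, G y k m * curvatureUp G y m i j l

/-- The Ricci tensor `r_jl = g^{ik} R_ijkl`. -/
def ricci (G : Coord n → Matrix (Fin n) (Fin n) ℝ) (y : Coord n) (j l : Fin n) : ℝ :=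
  ∑ i, ∑ k, (G y)⁻¹ i k * riemann G y i j k l

/-- The scalar curvature `s = g^{jl} r_jl`. -/
def scalar (G : Coord n → Matrix (Fin n) (Fin n) ℝ) (y : Coord n) : ℝ :=
  ∑ j, ∑ l, (G y)⁻¹ j l * ricci G y j l

/-- The traceless Ricci tensor `z = r - (s / n) g`. -/
def tracelessRicci (G : Coord n → Matrix (Fin n) (Fin n) ℝ) (y : Coord n) (i j : Fin n) : ℝ :=
  ricci G y i j - scalar G y / n * G y i j

/-- The Weyl tensor `W_ijkl`. -/
def weyl (G : Coord n → Matrix (Fin n) (Fin n) ℝ) (y : Coord n) (i j k l : Fin n) : ℝ :=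
  riemann G y i j k l
    - 1 / ((n : ℝ) - 2) *
      (ricci G y i k * G y j l + ricci G y j l * G y i k
        - ricci G y i l * G y j k - ricci G y j k * G y i l)
    + scalar G y / (((n : ℝ) - 1) * ((n : ℝ) - 2)) * (G y i k * G y j l - G y i l * G y j k)

/-- The Cotton tensor `C = d^D r - (1 / (2(n-1))) ds ∧ g`, that is,
`C_ijk = ∇_i r_jk - ∇_j r_ik - (1 / (2(n-1))) (∂_i s g_jk - ∂_j s g_ik)`. -/
def cotton (G : Coord n → Matrix (Fin n) (Fin n) ℝ) (y : Coord n) (i j k : Fin n) : ℝ :=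
  covDeriv₂ G (ricci G) y i j k - covDeriv₂ G (ricci G) y j i k
    - 1 / (2 * ((n : ℝ) - 1)) *
      (partialDeriv i (scalar G) y * G y j k - partialDeriv j (scalar G) y * G y i k)

/-- The (negative) divergence of the Weyl tensor,
`δW(X, Y, Z) = - ∑ (∇_{E_a} W)(E_a, X, Y, Z)`; in components `(δW)_ijk = - g^{ab} ∇_a W_bijk`.
It is antisymmetric in its last two arguments. -/
def divWeyl (G : Coord n → Matrix (Fin n) (Fin n) ℝ) (y : Coord n) (i j k : Fin n) : ℝ :=
  - ∑ a, ∑ b, (G y)⁻¹ a b * covDeriv₄ G (weyl G) y a b i j k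

/-- The formal adjoint `δ^D` of
`d^D ω (X, Y, Z) = (D_X ω)(Y, Z) - (D_Y ω)(X, Z)`, on 3-tensors that are antisymmetric in the first
two arguments: `(δ^D T)_jk = - g^{ab} ∇_a T_bjk`. -/
def adjointDD (G : Coord n → Matrix (Fin n) (Fin n) ℝ)
    (T : Coord n → Fin n → Fin n → Fin n → ℝ) (y : Coord n) (j k : Fin n) : ℝ :=
  - ∑ a, ∑ b, (G y)⁻¹ a b * covDeriv₃ G T y a b j k

/-- `(W̊z)_ij = ∑ W(∂_i, E_a, ∂_j, E_b) z(E_a, E_b)` for an orthonormal frame `E`; in components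
`g^{ac} g^{bd} W_iajb z_cd`. -/
def weylActionZ (G : Coord n → Matrix (Fin n) (Fin n) ℝ) (y : Coord n) (i j : Fin n) : ℝ :=
  ∑ a, ∑ b, ∑ c, ∑ d,
    (G y)⁻¹ a c * (G y)⁻¹ b d * weyl G y i a j b * tracelessRicci G y c d

/-- The Bach tensor `B = (1 / (n-3)) δ^D δW + (1 / (n-2)) W̊z`, where `δW` is read as a section of
`Λ² ⊗ T*`, i.e. with its two antisymmetric arguments first. -/
def bach (G : Coord n → Matrix (Fin n) (Fin n) ℝ) (y : Coord n) (i j : Fin n) : ℝ :=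
  1 / ((n : ℝ) - 3) * adjointDD G (fun z a b c => divWeyl G z c a b) y i j
    + 1 / ((n : ℝ) - 2) * weylActionZ G y i j

/-! ### Tensor fields on a Riemannian manifold -/

section Manifold

variable {M : Type*} [TopologicalSpace M] [ChartedSpace (EuclideanSpace ℝ (Fin n)) M]
  [Bundle.RiemannianBundle (fun x : M => TangentSpace (𝓡 n) x)]

/-- The components `g_ij = ⟨∂_i, ∂_j⟩` of the Riemannian metric in the chart `e`, as functions on
the target of the chart; `∂_i` is the image of the `i`-th basis vector under `d(e⁻¹)`. -/
def chartMetric (e : OpenPartialHomeomorph M (EuclideanSpace ℝ (Fin n))) (y : Coord n) :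
    Matrix (Fin n) (Fin n) ℝ :=
  fun i j => inner ℝ
    (mfderiv (𝓡 n) (𝓡 n) e.symm y (EuclideanSpace.single i (1 : ℝ)) :
      TangentSpace (𝓡 n) (e.symm y))
    (mfderiv (𝓡 n) (𝓡 n) e.symm y (EuclideanSpace.single j (1 : ℝ)) :
      TangentSpace (𝓡 n) (e.symm y))

variable (n M)

/-- The metric is Bach-flat: all components of the Bach tensor vanish in all smooth charts. -/
def IsBachFlat : Prop :=
  ∀ e ∈ IsManifold.maximalAtlas (𝓡 n) ∞ M, ∀ y ∈ e.target, ∀ i j,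
    bach (chartMetric e) y i j = 0

/-- The Cotton tensor of the metric vanishes identically. -/
def IsCottonFlat : Prop :=
  ∀ e ∈ IsManifold.maximalAtlas (𝓡 n) ∞ M, ∀ y ∈ e.target, ∀ i j k,
    cotton (chartMetric e) y i j k = 0

/-- The metric has harmonic Weyl curvature: `δW = 0`. -/
def HasHarmonicWeyl : Prop :=
  ∀ e ∈ IsManifold.maximalAtlas (𝓡 n) ∞ M, ∀ y ∈ e.target, ∀ i j k,
    divWeyl (chartMetric e) y i j k = 0

variable {M}

/-- `(M, g, ∇u, h, Λ)` is an `h`-almost gradient Ricci soliton with potential function `u`, signal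
function `h` and soliton function `Λ`, i.e. `r + h Ddu = Λ g` with `u`, `h`, `Λ` smooth and `h`
positive everywhere or negative everywhere. (Completeness of `M` is not included here.) -/
structure IsAlmostGradientRicciSoliton (u h Λ : M → ℝ) : Prop where
  smooth_potential : ContMDiff (𝓡 n) 𝓘(ℝ, ℝ) ∞ u
  smooth_signal : ContMDiff (𝓡 n) 𝓘(ℝ, ℝ) ∞ h
  smooth_soliton : ContMDiff (𝓡 n) 𝓘(ℝ, ℝ) ∞ Λ
  signal : (∀ x, 0 < h x) ∨ (∀ x, h x < 0)
  equation : ∀ e ∈ IsManifold.maximalAtlas (𝓡 n) ∞ M, ∀ y ∈ e.target, ∀ i j,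
    ricci (chartMetric e) y i j
        + h (e.symm y) * hessian (chartMetric e) (fun z => u (e.symm z)) y i j
      = Λ (e.symm y) * chartMetric e y i j

end Manifold

end RicciSoliton

end

noncomputable section

namespace RicciSoliton

open Filter Topology Matrix MeasureTheory Set

variable {n : ℕ}

/-! ### Partial derivatives -/

/-! Write X = ∇u, Q = |X|², dh = k du with k > 0, and let T be the trace-free part of du ∧ r
(`solitonTensor`). Differentiating the soliton equation, skew-symmetrising and applying the Ricci
identity gives C = -h W(·,·,·,X) + (k/h + h/(n-2)) T (`IsSolitonOn.cotton_eq`). The one-form in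
front of the metric terms need not be computed: it is forced by the vanishing traces of C and W.

The central object is the one-form V = C(·,X,X) (`cottonFlux`). Bach-flatness says div C = -W̊z.
Inserting this and the formula for C into div V, the terms containing C cancel, and div V = ½ (k/h²
+ 1/(n-2)) |T|² remains (`IsSolitonOn.div_cottonFlux`). The sign hypothesis on dh/du makes this
coefficient positive, whatever the sign of h.

On the other hand V(X) = C(X,X,X) = 0, so V annihilates the gradient of every function of u. Since
each level set is compact, there is a compactly supported χ ≥ 0, positive on a given level and
locally a smooth function of u (`exists_cutoff`). Hence ∫ χ div V = -∫ V(∇χ) = 0, and T = 0 on that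
level (`solitonTensor_eq_zero`).

When T = 0, C = -h W(·,·,·,X). This vanishes where du = 0, and everywhere C(·,·,X) = 0. Where du ≠
0, T = 0 forces r = β g + γ du ⊗ du (`ricci_eq_of_solitonTensor_eq_zero`), so that C = η ∧ g + κ ⊗
du. The trace of C and its contraction with X then give η = 0 and κ = 0
(`IsSolitonOn.cotton_eq_zero`). Finally δW is a multiple of C (`divWeyl_eq`).

All tensor calculus takes place in coordinates, and integrals over M are sums of chart integrals
over a finite partition of unity. To compare charts, only gradient inner products and the volume
density need transformation laws: `cottonFlux_eq` expresses V through first derivatives of u, h and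
Q, so its pairing with df is a globally defined scalar (`fluxPairing`). The same formula removes k,
about which no smoothness is known. -/

lemma partialDeriv_congr {f g : Coord n → ℝ} {y : Coord n} (i : Fin n) (h : f =ᶠ[𝓝 y] g) :
    partialDeriv i f y = partialDeriv i g y := by
  unfold partialDeriv
  rw [h.fderiv_eq]

section
variable {f g : Coord n → ℝ} {y : Coord n} (i : Fin n)

lemma partialDeriv_add (hf : DifferentiableAt ℝ f y) (hg : DifferentiableAt ℝ g y) :
    partialDeriv i (fun z => f z + g z) y = partialDeriv i f y + partialDeriv i g y := by
  simp [partialDeriv, fderiv_fun_add hf hg]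

lemma partialDeriv_sub (hf : DifferentiableAt ℝ f y) (hg : DifferentiableAt ℝ g y) :
    partialDeriv i (fun z => f z - g z) y = partialDeriv i f y - partialDeriv i g y := by
  simp [partialDeriv, fderiv_fun_sub hf hg]

lemma partialDeriv_mul (hf : DifferentiableAt ℝ f y) (hg : DifferentiableAt ℝ g y) :
    partialDeriv i (fun z => f z * g z) y
      = partialDeriv i f y * g y + f y * partialDeriv i g y := by
  simp [partialDeriv, fderiv_fun_mul hf hg]
  ring

lemma partialDeriv_neg : partialDeriv i (fun z => - f z) y = - partialDeriv i f y := by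
  simp [partialDeriv, fderiv_fun_neg]

lemma partialDeriv_const (c : ℝ) : partialDeriv i (fun _ : Coord n => c) y = 0 := by
  simp [partialDeriv]

lemma partialDeriv_const_mul (c : ℝ) (hf : DifferentiableAt ℝ f y) :
    partialDeriv i (fun z => c * f z) y = c * partialDeriv i f y := by
  rw [partialDeriv_mul i (differentiableAt_const c) hf, partialDeriv_const, zero_mul, zero_add]

lemma partialDeriv_sum {ι : Type*} (s : Finset ι) {F : ι → Coord n → ℝ}
    (hF : ∀ k ∈ s, DifferentiableAt ℝ (F k) y) :
    partialDeriv i (fun z => ∑ k ∈ s, F k z) y = ∑ k ∈ s, partialDeriv i (F k) y := by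
  simp [partialDeriv, fderiv_fun_sum hF]

lemma _root_.ContDiffAt.diff (hf : ContDiffAt ℝ ∞ f y) : DifferentiableAt ℝ f y :=
  hf.differentiableAt (by simp)

lemma contDiffAt_partialDeriv (hf : ContDiffAt ℝ ∞ f y) :
    ContDiffAt ℝ ∞ (partialDeriv i f) y := by
  have h : ContDiffAt ℝ ∞ (fderiv ℝ f) y := hf.fderiv_right (by simp)
  exact h.clm_apply contDiffAt_const

lemma partialDeriv_comm (j : Fin n) (hf : ContDiffAt ℝ ∞ f y) :
    partialDeriv i (partialDeriv j f) y = partialDeriv j (partialDeriv i f) y := by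
  have hs : IsSymmSndFDerivAt ℝ f y := hf.isSymmSndFDerivAt (by simp; norm_cast)
  have hd : DifferentiableAt ℝ (fderiv ℝ f) y :=
    (hf.fderiv_right (m := ∞) (by simp)).differentiableAt (by simp)
  have key : ∀ k l : Fin n, partialDeriv k (partialDeriv l f) y
      = fderiv ℝ (fderiv ℝ f) y (EuclideanSpace.single k 1) (EuclideanSpace.single l 1) := by
    intro k l
    unfold partialDeriv
    rw [fderiv_clm_apply hd (differentiableAt_const _)]
    simp
  rw [key, key]
  exact hs _ _

end

/-! ### Matrix valued functions -/

/-- The entrywise partial derivative of a matrix valued function. -/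
def matDeriv (i : Fin n) (A : Coord n → Matrix (Fin n) (Fin n) ℝ) (y : Coord n) :
    Matrix (Fin n) (Fin n) ℝ :=
  Matrix.of fun k l => partialDeriv i (fun z => A z k l) y

/-- A matrix valued function with smooth entries at `y`. -/
def MatSmoothAt (A : Coord n → Matrix (Fin n) (Fin n) ℝ) (y : Coord n) : Prop :=
  ∀ k l, ContDiffAt ℝ ∞ (fun z => A z k l) y

section
variable {A B : Coord n → Matrix (Fin n) (Fin n) ℝ} {y : Coord n}

lemma MatSmoothAt.add (hA : MatSmoothAt A y) (hB : MatSmoothAt B y) :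
    MatSmoothAt (fun z => A z + B z) y := fun k l => (hA k l).add (hB k l)

lemma MatSmoothAt.sub (hA : MatSmoothAt A y) (hB : MatSmoothAt B y) :
    MatSmoothAt (fun z => A z - B z) y := fun k l => (hA k l).sub (hB k l)

lemma MatSmoothAt.mul (hA : MatSmoothAt A y) (hB : MatSmoothAt B y) :
    MatSmoothAt (fun z => A z * B z) y := by
  intro k l
  simp only [Matrix.mul_apply]
  exact ContDiffAt.sum fun p _ => (hA k p).mul (hB p l)

lemma MatSmoothAt.transpose (hA : MatSmoothAt A y) :
    MatSmoothAt (fun z => (A z).transpose) y := fun k l => hA l k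

lemma MatSmoothAt.matDeriv (i : Fin n) (hA : MatSmoothAt A y) :
    MatSmoothAt (matDeriv i A) y := fun k l => contDiffAt_partialDeriv i (hA k l)

lemma matDeriv_congr (i : Fin n) (h : A =ᶠ[𝓝 y] B) : matDeriv i A y = matDeriv i B y := by
  ext k l
  exact partialDeriv_congr i (h.mono fun z hz => by simp only [hz])

lemma matDeriv_add (i : Fin n) (hA : MatSmoothAt A y) (hB : MatSmoothAt B y) :
    matDeriv i (fun z => A z + B z) y = matDeriv i A y + matDeriv i B y := by
  ext k l
  exact partialDeriv_add i (hA k l).diff (hB k l).diff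

lemma matDeriv_sub (i : Fin n) (hA : MatSmoothAt A y) (hB : MatSmoothAt B y) :
    matDeriv i (fun z => A z - B z) y = matDeriv i A y - matDeriv i B y := by
  ext k l
  exact partialDeriv_sub i (hA k l).diff (hB k l).diff

lemma matDeriv_mul (i : Fin n) (hA : MatSmoothAt A y) (hB : MatSmoothAt B y) :
    matDeriv i (fun z => A z * B z) y = matDeriv i A y * B y + A y * matDeriv i B y := by
  ext k l
  simp only [matDeriv, Matrix.of_apply, Matrix.mul_apply, Matrix.add_apply]
  rw [partialDeriv_sum i _ fun p _ => ((hA k p).mul (hB p l)).diff, ← Finset.sum_add_distrib]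
  exact Finset.sum_congr rfl fun p _ => partialDeriv_mul i (hA k p).diff (hB p l).diff

lemma matDeriv_transpose (i : Fin n) :
    matDeriv i (fun z => (A z).transpose) y = (matDeriv i A y).transpose := rfl

lemma matDeriv_comm (i j : Fin n) (hA : MatSmoothAt A y) :
    matDeriv i (matDeriv j A) y = matDeriv j (matDeriv i A) y := by
  ext k l
  exact partialDeriv_comm i j (hA k l)

lemma matDeriv_const (i : Fin n) (C : Matrix (Fin n) (Fin n) ℝ) :
    matDeriv i (fun _ => C) y = 0 := by
  ext k l
  exact partialDeriv_const i (C k l)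

lemma MatSmoothAt.det (hA : MatSmoothAt A y) : ContDiffAt ℝ ∞ (fun z => (A z).det) y := by
  simp only [Matrix.det_apply']
  exact ContDiffAt.sum fun σ _ => contDiffAt_const.mul (contDiffAt_prod fun k _ => hA (σ k) k)

/-- Each cofactor is a determinant of a matrix whose entries are entries of `A` or constants. -/
lemma MatSmoothAt.adjugate (hA : MatSmoothAt A y) :
    MatSmoothAt (fun z => (A z).adjugate) y := by
  intro k l
  simp only [Matrix.adjugate_apply]
  refine MatSmoothAt.det (A := fun z => (A z).updateRow l (Pi.single k 1)) fun p q => ?_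
  by_cases hp : p = l
  · subst hp
    simpa using contDiffAt_const
  · simpa [hp] using hA p q

lemma MatSmoothAt.inv (hA : MatSmoothAt A y) (hy : (A y).det ≠ 0) :
    MatSmoothAt (fun z => (A z)⁻¹) y := by
  intro k l
  simp only [Matrix.inv_def, Matrix.smul_apply, smul_eq_mul, Ring.inverse_eq_inv']
  exact (hA.det.inv hy).mul (hA.adjugate k l)

/-- **Jacobi's formula** for the derivative of a determinant. -/
lemma partialDeriv_det (i : Fin n) (hA : MatSmoothAt A y) :
    partialDeriv i (fun z => (A z).det) y = ((A y).adjugate * matDeriv i A y).trace := by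
  -- The Leibniz expansion is multilinear in the columns, so its derivative differentiates one
  -- column at a time; Cramer's rule then recognises the adjugate.
  have h1 : partialDeriv i (fun z => (A z).det) y
      = ∑ k, ((A y).updateCol k (fun p => matDeriv i A y p k)).det := by
    simp only [Matrix.det_apply']
    have hsm : ∀ σ : Equiv.Perm (Fin n), ContDiffAt ℝ ∞ (fun z => ∏ k, A z (σ k) k) y :=
      fun σ => contDiffAt_prod fun k _ => hA (σ k) k
    rw [partialDeriv_sum i _ fun σ _ => (contDiffAt_const.mul (hsm σ)).diff, Finset.sum_comm]
    refine Finset.sum_congr rfl fun σ _ => ?_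
    rw [partialDeriv_const_mul i _ (hsm σ).diff, ← Finset.mul_sum]
    congr 1
    have hd : HasFDerivAt (fun z => ∏ k, A z (σ k) k)
        (∑ k, (∏ p ∈ Finset.univ.erase k, A y (σ p) p) • fderiv ℝ (fun z => A z (σ k) k) y) y :=
      HasFDerivAt.finsetProd fun k _ => (hA (σ k) k).diff.hasFDerivAt
    unfold partialDeriv
    rw [hd.fderiv]
    simp only [_root_.sum_apply, _root_.smul_apply, smul_eq_mul]
    refine Finset.sum_congr rfl fun k _ => ?_
    rw [← Finset.mul_prod_erase Finset.univ _ (Finset.mem_univ k), mul_comm]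
    congr 1
    · simp [matDeriv, partialDeriv]
    · refine Finset.prod_congr rfl fun p hp => ?_
      rw [Matrix.updateCol_ne (Finset.ne_of_mem_erase hp)]
  rw [h1]
  simp only [Matrix.trace, Matrix.diag_apply, Matrix.mul_apply]
  refine Finset.sum_congr rfl fun k _ => ?_
  rw [← Matrix.cramer_apply, Matrix.cramer_eq_adjugate_mulVec]
  rfl

end

/-! ### Riemannian metrics in coordinates -/

/-- `G` is a smooth Riemannian metric on the open set `U`. -/
structure IsMetricOn (G : Coord n → Matrix (Fin n) (Fin n) ℝ) (U : Set (Coord n)) : Prop where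
  isOpen : IsOpen U
  smooth : ∀ y ∈ U, MatSmoothAt G y
  posDef : ∀ y ∈ U, (G y).PosDef

namespace IsMetricOn

variable {G : Coord n → Matrix (Fin n) (Fin n) ℝ} {U : Set (Coord n)} {y : Coord n}

lemma mem_nhds (hG : IsMetricOn G U) (hy : y ∈ U) : U ∈ 𝓝 y := hG.isOpen.mem_nhds hy

lemma transpose_eq (hG : IsMetricOn G U) (hy : y ∈ U) : (G y)ᵀ = G y := by
  simpa using (hG.posDef y hy).isHermitian.eq

lemma symm (hG : IsMetricOn G U) (hy : y ∈ U) (i j : Fin n) : G y i j = G y j i := by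
  conv_lhs => rw [← hG.transpose_eq hy]
  rfl

lemma det_pos (hG : IsMetricOn G U) (hy : y ∈ U) : 0 < (G y).det := (hG.posDef y hy).det_pos

lemma mul_inv (hG : IsMetricOn G U) (hy : y ∈ U) : G y * (G y)⁻¹ = 1 :=
  Matrix.mul_nonsing_inv _ (hG.det_pos hy).ne'.isUnit

lemma inv_mul (hG : IsMetricOn G U) (hy : y ∈ U) : (G y)⁻¹ * G y = 1 :=
  Matrix.nonsing_inv_mul _ (hG.det_pos hy).ne'.isUnit

lemma inv_transpose (hG : IsMetricOn G U) (hy : y ∈ U) : ((G y)⁻¹)ᵀ = (G y)⁻¹ := by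
  rw [Matrix.transpose_nonsing_inv, hG.transpose_eq hy]

lemma inv_symm (hG : IsMetricOn G U) (hy : y ∈ U) (i j : Fin n) :
    (G y)⁻¹ i j = (G y)⁻¹ j i := by
  conv_lhs => rw [← hG.inv_transpose hy]
  rfl

lemma smooth_inv (hG : IsMetricOn G U) (hy : y ∈ U) : MatSmoothAt (fun z => (G z)⁻¹) y :=
  (hG.smooth y hy).inv (hG.det_pos hy).ne'

lemma partialDeriv_symm (hG : IsMetricOn G U) (hy : y ∈ U) (l i j : Fin n) :
    partialDeriv l (fun z => G z i j) y = partialDeriv l (fun z => G z j i) y :=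
  partialDeriv_congr l (by
    filter_upwards [hG.mem_nhds hy] with z hz using hG.symm hz i j)

lemma smooth_christoffel (hG : IsMetricOn G U) (hy : y ∈ U) (k i j : Fin n) :
    ContDiffAt ℝ ∞ (fun z => christoffel G z k i j) y := by
  refine contDiffAt_const.mul (ContDiffAt.sum fun l _ => (hG.smooth_inv hy k l).mul ?_)
  exact ((contDiffAt_partialDeriv i (hG.smooth y hy j l)).add
    (contDiffAt_partialDeriv j (hG.smooth y hy i l))).sub
    (contDiffAt_partialDeriv l (hG.smooth y hy i j))

lemma christoffel_symm (hG : IsMetricOn G U) (hy : y ∈ U) (k i j : Fin n) :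
    christoffel G y k i j = christoffel G y k j i := by
  unfold christoffel
  congr 1
  refine Finset.sum_congr rfl fun l _ => ?_
  rw [hG.partialDeriv_symm hy l i j]
  ring

/-- Lowering the upper index cancels the inverse metric in the definition; this is the Koszul
formula for coordinate fields. -/
lemma lower_christoffel (hG : IsMetricOn G U) (hy : y ∈ U) (k i j : Fin n) :
    ∑ p, G y k p * christoffel G y p i j
      = (1 / 2) * (partialDeriv i (fun z => G z j k) y + partialDeriv j (fun z => G z i k) y
        - partialDeriv k (fun z => G z i j) y) := by
  set D : Fin n → ℝ := fun l => partialDeriv i (fun z => G z j l) y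
    + partialDeriv j (fun z => G z i l) y - partialDeriv l (fun z => G z i j) y with hD
  have h : (G y *ᵥ ((G y)⁻¹ *ᵥ D)) k = D k := by
    rw [Matrix.mulVec_mulVec, hG.mul_inv hy, Matrix.one_mulVec]
  have h2 : ∑ p, G y k p * christoffel G y p i j = (1 / 2) * (G y *ᵥ ((G y)⁻¹ *ᵥ D)) k := by
    simp only [Matrix.mulVec, dotProduct, christoffel, Finset.mul_sum]
    refine Finset.sum_congr rfl fun p _ => Finset.sum_congr rfl fun l _ => ?_
    simp only [hD]
    ring
  rw [h2, h]

end IsMetricOn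

/-! ### Curvature form, curvature symmetries and Bianchi identities -/

/-- The matrix of the connection form in the direction `∂_i`. -/
def conn (G : Coord n → Matrix (Fin n) (Fin n) ℝ) (i : Fin n) (y : Coord n) :
    Matrix (Fin n) (Fin n) ℝ :=
  Matrix.of fun m k => christoffel G y m i k

/-- The curvature of the connection, as an endomorphism valued two-form. -/
def curv (G : Coord n → Matrix (Fin n) (Fin n) ℝ) (i j : Fin n) (y : Coord n) :
    Matrix (Fin n) (Fin n) ℝ :=
  matDeriv i (conn G j) y - matDeriv j (conn G i) y
    + (conn G i y * conn G j y - conn G j y * conn G i y)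

lemma curv_apply (G : Coord n → Matrix (Fin n) (Fin n) ℝ) (i j m k : Fin n) (y : Coord n) :
    curv G i j y m k = curvatureUp G y m i j k := by
  simp only [curv, Matrix.add_apply, Matrix.sub_apply, Matrix.mul_apply, matDeriv, conn,
    Matrix.of_apply, curvatureUp, ← Finset.sum_sub_distrib]
  congr 1
  exact Finset.sum_congr rfl fun p _ => by ring

lemma riemann_eq (G : Coord n → Matrix (Fin n) (Fin n) ℝ) (y : Coord n) (i j k l : Fin n) :
    riemann G y i j k l = (G y * curv G i j y) k l := by
  simp only [riemann, Matrix.mul_apply, curv_apply]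

lemma curv_antisymm (G : Coord n → Matrix (Fin n) (Fin n) ℝ) (i j : Fin n) (y : Coord n) :
    curv G i j y = - curv G j i y := by
  unfold curv
  abel

namespace IsMetricOn

variable {G : Coord n → Matrix (Fin n) (Fin n) ℝ} {U : Set (Coord n)} {y : Coord n}

lemma smooth_conn (hG : IsMetricOn G U) (hy : y ∈ U) (i : Fin n) : MatSmoothAt (conn G i) y :=
  fun m k => hG.smooth_christoffel hy m i k

lemma smooth_curv (hG : IsMetricOn G U) (hy : y ∈ U) (i j : Fin n) :
    MatSmoothAt (curv G i j) y :=
  (((hG.smooth_conn hy j).matDeriv i).sub ((hG.smooth_conn hy i).matDeriv j)).add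
    (((hG.smooth_conn hy i).mul (hG.smooth_conn hy j)).sub
      ((hG.smooth_conn hy j).mul (hG.smooth_conn hy i)))

lemma smooth_riemann (hG : IsMetricOn G U) (hy : y ∈ U) (i j k l : Fin n) :
    ContDiffAt ℝ ∞ (fun z => riemann G z i j k l) y := by
  simp only [riemann_eq]
  exact ((hG.smooth y hy).mul (hG.smooth_curv hy i j)) k l

/-- The Levi-Civita connection is metric. -/
lemma matDeriv_metric (hG : IsMetricOn G U) (hy : y ∈ U) (i : Fin n) :
    matDeriv i G y = (conn G i y)ᵀ * G y + G y * conn G i y := by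
  ext j k
  have h1 : ((conn G i y)ᵀ * G y) j k = ∑ p, G y k p * christoffel G y p i j := by
    simp only [Matrix.mul_apply, Matrix.transpose_apply, conn, Matrix.of_apply]
    exact Finset.sum_congr rfl fun p _ => by rw [hG.symm hy p k, mul_comm]
  have h2 : (G y * conn G i y) j k = ∑ p, G y j p * christoffel G y p i k := by
    simp only [Matrix.mul_apply, conn, Matrix.of_apply]
  rw [Matrix.add_apply, h1, h2, hG.lower_christoffel hy, hG.lower_christoffel hy,
    hG.partialDeriv_symm hy i k j]
  simp only [matDeriv, Matrix.of_apply]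
  ring

/-- Differentiate `G * G⁻¹ = 1` and multiply by `G⁻¹` from the left: the inverse metric is parallel.
-/
lemma matDeriv_inv (hG : IsMetricOn G U) (hy : y ∈ U) (i : Fin n) :
    matDeriv i (fun z => (G z)⁻¹) y
      = - (conn G i y * (G y)⁻¹ + (G y)⁻¹ * (conn G i y)ᵀ) := by
  have h1 : matDeriv i (fun z => G z * (G z)⁻¹) y = 0 := by
    rw [matDeriv_congr (B := fun _ => 1) i, matDeriv_const]
    filter_upwards [hG.mem_nhds hy] with z hz using hG.mul_inv hz
  rw [matDeriv_mul i (hG.smooth y hy) (hG.smooth_inv hy), hG.matDeriv_metric hy] at h1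
  have h2 : (G y)⁻¹ * (((conn G i y)ᵀ * G y + G y * conn G i y) * (G y)⁻¹
      + G y * matDeriv i (fun z => (G z)⁻¹) y) = 0 := by rw [h1, mul_zero]
  have h3 : (G y)⁻¹ * (((conn G i y)ᵀ * G y + G y * conn G i y) * (G y)⁻¹
      + G y * matDeriv i (fun z => (G z)⁻¹) y)
      = (G y)⁻¹ * (conn G i y)ᵀ * (G y * (G y)⁻¹) + ((G y)⁻¹ * G y) * conn G i y * (G y)⁻¹
        + ((G y)⁻¹ * G y) * matDeriv i (fun z => (G z)⁻¹) y := by noncomm_ring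
  rw [h3, hG.mul_inv hy, hG.inv_mul hy, mul_one, one_mul, one_mul] at h2
  rw [eq_neg_iff_add_eq_zero, ← h2]
  abel

/-- The curvature endomorphisms are skew-adjoint. -/
lemma curv_skew (hG : IsMetricOn G U) (hy : y ∈ U) (i j : Fin n) :
    (curv G i j y)ᵀ * G y + G y * curv G i j y = 0 := by
  have key : ∀ i j, matDeriv i (matDeriv j G) y
      = (matDeriv i (conn G j) y)ᵀ * G y
        + (conn G j y)ᵀ * ((conn G i y)ᵀ * G y + G y * conn G i y)
        + (((conn G i y)ᵀ * G y + G y * conn G i y) * conn G j y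
          + G y * matDeriv i (conn G j) y) := by
    intro i j
    have h : matDeriv j G =ᶠ[𝓝 y] fun z => (conn G j z)ᵀ * G z + G z * conn G j z := by
      filter_upwards [hG.mem_nhds hy] with z hz using hG.matDeriv_metric hz j
    have hc := hG.smooth_conn hy j
    have hg := hG.smooth y hy
    rw [matDeriv_congr i h, matDeriv_add i (hc.transpose.mul hg) (hg.mul hc),
      matDeriv_mul i hc.transpose hg, matDeriv_mul i hg hc, matDeriv_transpose,
      hG.matDeriv_metric hy]
  -- In ∂ᵢ∂ⱼG - ∂ⱼ∂ᵢG = 0 the mixed terms ΓᵢᵀGΓⱼ + ΓⱼᵀGΓᵢ are symmetric and cancel; what is left is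
  -- the asserted identity.
  have h := matDeriv_comm i j (hG.smooth y hy)
  rw [key, key] at h
  have h' := sub_eq_zero.mpr h
  rw [← h']
  simp only [curv, Matrix.transpose_add, Matrix.transpose_sub, Matrix.transpose_mul]
  noncomm_ring

/-- The differential Bianchi identity for the curvature form. -/
lemma curv_bianchi (hG : IsMetricOn G U) (hy : y ∈ U) (i j k : Fin n) :
    (matDeriv i (curv G j k) y + (conn G i y * curv G j k y - curv G j k y * conn G i y))
    + (matDeriv j (curv G k i) y + (conn G j y * curv G k i y - curv G k i y * conn G j y))
    + (matDeriv k (curv G i j) y + (conn G k y * curv G i j y - curv G i j y * conn G k y))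
      = 0 := by
  have key : ∀ i j k, matDeriv i (curv G j k) y
      = matDeriv i (matDeriv j (conn G k)) y - matDeriv i (matDeriv k (conn G j)) y
      + (matDeriv i (conn G j) y * conn G k y + conn G j y * matDeriv i (conn G k) y
        - (matDeriv i (conn G k) y * conn G j y + conn G k y * matDeriv i (conn G j) y)) := by
    intro i j k
    have cj := hG.smooth_conn hy j
    have ck := hG.smooth_conn hy k
    unfold curv
    rw [matDeriv_add i ((ck.matDeriv j).sub (cj.matDeriv k)) ((cj.mul ck).sub (ck.mul cj)),
      matDeriv_sub i (ck.matDeriv j) (cj.matDeriv k), matDeriv_sub i (cj.mul ck) (ck.mul cj),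
      matDeriv_mul i cj ck, matDeriv_mul i ck cj]
  rw [key, key, key, matDeriv_comm j i (hG.smooth_conn hy k),
    matDeriv_comm k j (hG.smooth_conn hy i), matDeriv_comm k i (hG.smooth_conn hy j)]
  unfold curv
  noncomm_ring

lemma riemann_antisymm_left (G : Coord n → Matrix (Fin n) (Fin n) ℝ) (y : Coord n)
    (i j k l : Fin n) : riemann G y i j k l = - riemann G y j i k l := by
  rw [riemann_eq, riemann_eq, curv_antisymm G i j, Matrix.mul_neg, Matrix.neg_apply]

lemma riemann_antisymm_right (hG : IsMetricOn G U) (hy : y ∈ U) (i j k l : Fin n) :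
    riemann G y i j k l = - riemann G y i j l k := by
  rw [riemann_eq, riemann_eq]
  have h := congrFun (congrFun (hG.curv_skew hy i j) k) l
  have h2 : ((curv G i j y)ᵀ * G y) k l = (G y * curv G i j y) l k := by
    conv_rhs => rw [← Matrix.transpose_apply (G y * curv G i j y), Matrix.transpose_mul,
      hG.transpose_eq hy]
  rw [Matrix.add_apply, h2, Matrix.zero_apply] at h
  linarith

/-- The first Bianchi identity. -/
lemma riemann_bianchi (hG : IsMetricOn G U) (hy : y ∈ U) (i j k l : Fin n) :
    riemann G y i j l k + riemann G y j k l i + riemann G y k i l j = 0 := by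
  have key : ∀ m, curvatureUp G y m i j k + curvatureUp G y m j k i
      + curvatureUp G y m k i j = 0 := by
    intro m
    have hs : ∀ a b c d, partialDeriv a (fun z => christoffel G z b c d) y
        = partialDeriv a (fun z => christoffel G z b d c) y := fun a b c d =>
      partialDeriv_congr a (by
        filter_upwards [hG.mem_nhds hy] with z hz using hG.christoffel_symm hz b c d)
    unfold curvatureUp
    rw [hs i m k j, hs j m i k, hs k m j i]
    have e1 : ∑ p, (christoffel G y p j k * christoffel G y m i p
          - christoffel G y p i k * christoffel G y m j p)
        + ∑ p, (christoffel G y p k i * christoffel G y m j p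
          - christoffel G y p j i * christoffel G y m k p)
        + ∑ p, (christoffel G y p i j * christoffel G y m k p
          - christoffel G y p k j * christoffel G y m i p) = 0 := by
      rw [← Finset.sum_add_distrib, ← Finset.sum_add_distrib]
      refine Finset.sum_eq_zero fun p _ => ?_
      rw [hG.christoffel_symm hy p k j, hG.christoffel_symm hy p k i,
        hG.christoffel_symm hy p j i]
      ring
    linarith
  simp only [riemann]
  rw [← Finset.sum_add_distrib, ← Finset.sum_add_distrib]
  refine Finset.sum_eq_zero fun m _ => ?_
  rw [← mul_add, ← mul_add, key m, mul_zero]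

/-- The octahedron argument: four instances of the first Bianchi identity combine linearly, with the
two antisymmetries identifying the repeated terms. -/
lemma riemann_pair_symm (hG : IsMetricOn G U) (hy : y ∈ U) (i j k l : Fin n) :
    riemann G y i j k l = riemann G y k l i j := by
  have a := riemann_antisymm_left G y
  have b := hG.riemann_antisymm_right hy
  have c := hG.riemann_bianchi hy
  linarith [c i j k l, c j k l i, c k l i j, c l i j k, a i j l k, a j k l i, a k i l j, a i j k l,
    a k l i j, a l i j k, a j l i k, a j k i l, a i l k j, a l j k i, a i k l j,
    b i j k l, b i j l k, b j k l i, b k i l j, b j k i l, b k l i j, b k l j i, b l j i k,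
    b l i j k, b l i k j, b i k j l, b j l k i]

/-- Covariant derivative of the curvature tensor, in terms of the curvature form. -/
lemma covDeriv_riemann (hG : IsMetricOn G U) (hy : y ∈ U) (m i j k l : Fin n) :
    covDeriv₄ G (riemann G) y m i j k l
      = (G y * (matDeriv m (curv G i j) y
          + (conn G m y * curv G i j y - curv G i j y * conn G m y))) k l
        - ∑ p, christoffel G y p m i * riemann G y p j k l
        - ∑ p, christoffel G y p m j * riemann G y i p k l := by
  have h1 : partialDeriv m (fun z => riemann G z i j k l) y
      = (((conn G m y)ᵀ * G y + G y * conn G m y) * curv G i j y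
        + G y * matDeriv m (curv G i j) y) k l := by
    rw [← hG.matDeriv_metric hy, ← matDeriv_mul m (hG.smooth y hy) (hG.smooth_curv hy i j)]
    simp only [riemann_eq, matDeriv, Matrix.of_apply]
  have h2 : ∑ p, christoffel G y p m k * riemann G y i j p l
      = ((conn G m y)ᵀ * (G y * curv G i j y)) k l := by
    rw [Matrix.mul_apply]
    simp only [riemann_eq, conn, Matrix.transpose_apply, Matrix.of_apply]
  have h3 : ∑ p, christoffel G y p m l * riemann G y i j k p
      = ((G y * curv G i j y) * conn G m y) k l := by
    rw [Matrix.mul_apply]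
    simp only [riemann_eq, conn, Matrix.of_apply]
    exact Finset.sum_congr rfl fun p _ => mul_comm _ _
  have h4 : G y * (matDeriv m (curv G i j) y
          + (conn G m y * curv G i j y - curv G i j y * conn G m y))
      = (((conn G m y)ᵀ * G y + G y * conn G m y) * curv G i j y
        + G y * matDeriv m (curv G i j) y)
        - (conn G m y)ᵀ * (G y * curv G i j y) - (G y * curv G i j y) * conn G m y := by
    noncomm_ring
  unfold covDeriv₄
  rw [h1, h2, h3, h4, Matrix.sub_apply, Matrix.sub_apply]
  ring

/-- The second Bianchi identity. -/
lemma covDeriv_riemann_bianchi (hG : IsMetricOn G U) (hy : y ∈ U) (m i j k l : Fin n) :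
    covDeriv₄ G (riemann G) y m i j k l + covDeriv₄ G (riemann G) y i j m k l
      + covDeriv₄ G (riemann G) y j m i k l = 0 := by
  have h := congrArg (fun X => (G y * X) k l) (hG.curv_bianchi hy m i j)
  simp only [Matrix.mul_add, Matrix.add_apply, mul_zero, Matrix.zero_apply] at h
  rw [hG.covDeriv_riemann hy, hG.covDeriv_riemann hy, hG.covDeriv_riemann hy]
  simp only [Matrix.mul_add, Matrix.add_apply]
  -- The Christoffel corrections in the two form slots cancel over the cyclic sum, because the
  -- connection is torsion-free and the curvature is antisymmetric in those slots.
  have s : ∀ a b c, ∑ p, christoffel G y p a b * riemann G y p c k l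
      + ∑ p, christoffel G y p b a * riemann G y c p k l = 0 := by
    intro a b c
    rw [← Finset.sum_add_distrib]
    refine Finset.sum_eq_zero fun p _ => ?_
    rw [hG.christoffel_symm hy p a b, riemann_antisymm_left G y p c]
    ring
  linarith [s m i j, s i j m, s j m i]

end IsMetricOn

/-! ### Metric traces -/

/-- The trace `g^{ab} T_ab` of a covariant 2-tensor. -/
def tr (G : Coord n → Matrix (Fin n) (Fin n) ℝ) (y : Coord n) (T : Fin n → Fin n → ℝ) : ℝ :=
  ∑ a, ∑ b, (G y)⁻¹ a b * T a b

section
variable (G : Coord n → Matrix (Fin n) (Fin n) ℝ) (y : Coord n)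

lemma tr_add (S T : Fin n → Fin n → ℝ) :
    tr G y (fun a b => S a b + T a b) = tr G y S + tr G y T := by
  simp only [tr, mul_add, Finset.sum_add_distrib]

lemma tr_sub (S T : Fin n → Fin n → ℝ) :
    tr G y (fun a b => S a b - T a b) = tr G y S - tr G y T := by
  simp only [tr, mul_sub, Finset.sum_sub_distrib]

lemma tr_neg (T : Fin n → Fin n → ℝ) : tr G y (fun a b => - T a b) = - tr G y T := by
  simp only [tr, mul_neg, Finset.sum_neg_distrib]

lemma tr_zero : tr G y (fun _ _ => 0) = 0 := by
  simp only [tr, mul_zero, Finset.sum_const_zero]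

lemma tr_const_mul (c : ℝ) (T : Fin n → Fin n → ℝ) :
    tr G y (fun a b => c * T a b) = c * tr G y T := by
  simp only [tr, Finset.mul_sum]
  exact Finset.sum_congr rfl fun a _ => Finset.sum_congr rfl fun b _ => by ring

lemma tr_mul_const (c : ℝ) (T : Fin n → Fin n → ℝ) :
    tr G y (fun a b => T a b * c) = tr G y T * c := by
  simp only [mul_comm _ c, tr_const_mul]

lemma tr_sum {ι : Type*} (s : Finset ι) (T : ι → Fin n → Fin n → ℝ) :
    tr G y (fun a b => ∑ p ∈ s, T p a b) = ∑ p ∈ s, tr G y (T p) := by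
  simp only [tr, Finset.mul_sum]
  calc _ = ∑ a, ∑ p ∈ s, ∑ b, (G y)⁻¹ a b * T p a b :=
        Finset.sum_congr rfl fun a _ => Finset.sum_comm
    _ = _ := Finset.sum_comm

lemma tr_comm (T : Fin n → Fin n → Fin n → Fin n → ℝ) :
    tr G y (fun a b => tr G y (fun c d => T a b c d))
      = tr G y (fun c d => tr G y (fun a b => T a b c d)) := by
  simp only [tr, Finset.mul_sum]
  calc _ = ∑ a, ∑ c, ∑ b, ∑ d, (G y)⁻¹ a b * ((G y)⁻¹ c d * T a b c d) :=
        Finset.sum_congr rfl fun a _ => Finset.sum_comm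
    _ = ∑ c, ∑ a, ∑ b, ∑ d, (G y)⁻¹ a b * ((G y)⁻¹ c d * T a b c d) := Finset.sum_comm
    _ = ∑ c, ∑ a, ∑ d, ∑ b, (G y)⁻¹ a b * ((G y)⁻¹ c d * T a b c d) :=
        Finset.sum_congr rfl fun c _ => Finset.sum_congr rfl fun a _ => Finset.sum_comm
    _ = ∑ c, ∑ d, ∑ a, ∑ b, (G y)⁻¹ a b * ((G y)⁻¹ c d * T a b c d) :=
        Finset.sum_congr rfl fun c _ => Finset.sum_comm
    _ = _ := by
        refine Finset.sum_congr rfl fun c _ => Finset.sum_congr rfl fun d _ =>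
          Finset.sum_congr rfl fun a _ => Finset.sum_congr rfl fun b _ => ?_
        ring

end

namespace IsMetricOn

variable {G : Coord n → Matrix (Fin n) (Fin n) ℝ} {U : Set (Coord n)} {y : Coord n}

lemma tr_swap (hG : IsMetricOn G U) (hy : y ∈ U) (T : Fin n → Fin n → ℝ) :
    tr G y (fun a b => T b a) = tr G y T := by
  simp only [tr]
  rw [Finset.sum_comm]
  exact Finset.sum_congr rfl fun a _ => Finset.sum_congr rfl fun b _ => by
    rw [hG.inv_symm hy]

lemma sum_inv_mul (hG : IsMetricOn G U) (hy : y ∈ U) (i b : Fin n) :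
    ∑ a, (G y)⁻¹ b a * G y a i = if b = i then 1 else 0 := by
  rw [← Matrix.mul_apply, hG.inv_mul hy, Matrix.one_apply]

/-- Raising and then lowering an index does nothing; this evaluates every contraction below in which
a factor is the metric. -/
lemma tr_metric_mul (hG : IsMetricOn G U) (hy : y ∈ U) (i : Fin n) (X : Fin n → ℝ) :
    tr G y (fun a b => G y a i * X b) = X i := by
  simp only [tr]
  rw [Finset.sum_comm]
  calc _ = ∑ b, (∑ a, (G y)⁻¹ b a * G y a i) * X b := by
        refine Finset.sum_congr rfl fun b _ => ?_
        rw [Finset.sum_mul]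
        exact Finset.sum_congr rfl fun a _ => by rw [hG.inv_symm hy]; ring
    _ = X i := by simp [hG.sum_inv_mul hy]

lemma tr_metric_mul' (hG : IsMetricOn G U) (hy : y ∈ U) (i : Fin n) (X : Fin n → ℝ) :
    tr G y (fun a b => G y b i * X a) = X i := by
  rw [hG.tr_swap hy (fun a b => G y a i * X b), hG.tr_metric_mul hy]

lemma tr_metric (hG : IsMetricOn G U) (hy : y ∈ U) : tr G y (G y) = n := by
  have : tr G y (G y) = ((G y)⁻¹ * G y).trace := by
    simp only [tr, Matrix.trace, Matrix.diag_apply, Matrix.mul_apply]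
    exact Finset.sum_congr rfl fun a _ => Finset.sum_congr rfl fun b _ => by rw [hG.symm hy]
  rw [this, hG.inv_mul hy, Matrix.trace_one, Fintype.card_fin]

lemma smooth_tr (hG : IsMetricOn G U) (hy : y ∈ U) {T : Coord n → Fin n → Fin n → ℝ}
    (hT : ∀ a b, ContDiffAt ℝ ∞ (fun z => T z a b) y) :
    ContDiffAt ℝ ∞ (fun z => tr G z (T z)) y :=
  ContDiffAt.sum fun a _ => ContDiffAt.sum fun b _ => (hG.smooth_inv hy a b).mul (hT a b)

/-- The trace commutes with the covariant derivative. -/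
lemma partialDeriv_tr (hG : IsMetricOn G U) (hy : y ∈ U) {T : Coord n → Fin n → Fin n → ℝ}
    (hT : ∀ a b, ContDiffAt ℝ ∞ (fun z => T z a b) y) (m : Fin n) :
    partialDeriv m (fun z => tr G z (T z)) y = tr G y (covDeriv₂ G T y m) := by
  have hs : ∀ a b, ContDiffAt ℝ ∞ (fun z => (G z)⁻¹ a b * T z a b) y :=
    fun a b => (hG.smooth_inv hy a b).mul (hT a b)
  have h0 : ∀ a b, partialDeriv m (fun z => (G z)⁻¹ a b) y
      = - (∑ p, christoffel G y a m p * (G y)⁻¹ p b)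
        - ∑ p, (G y)⁻¹ a p * christoffel G y b m p := by
    intro a b
    have h := congrFun (congrFun (hG.matDeriv_inv hy m) a) b
    simp only [matDeriv, Matrix.of_apply, Matrix.neg_apply, Matrix.add_apply, Matrix.mul_apply,
      conn, Matrix.transpose_apply] at h
    rw [h]
    ring
  have h1 : partialDeriv m (fun z => tr G z (T z)) y
      = ∑ a, ∑ b, (partialDeriv m (fun z => (G z)⁻¹ a b) y * T y a b
        + (G y)⁻¹ a b * partialDeriv m (fun z => T z a b) y) := by
    unfold tr
    rw [partialDeriv_sum m _ fun a _ => (ContDiffAt.sum fun b _ => hs a b).diff]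
    refine Finset.sum_congr rfl fun a _ => ?_
    rw [partialDeriv_sum m _ fun b _ => (hs a b).diff]
    exact Finset.sum_congr rfl fun b _ =>
      partialDeriv_mul m (hG.smooth_inv hy a b).diff (hT a b).diff
  have h2 : ∑ a, ∑ b, (∑ p, christoffel G y a m p * (G y)⁻¹ p b) * T y a b
      = ∑ a, ∑ b, (G y)⁻¹ a b * ∑ p, christoffel G y p m a * T y p b := by
    simp only [Finset.sum_mul, Finset.mul_sum]
    calc _ = ∑ a, ∑ p, ∑ b, christoffel G y a m p * (G y)⁻¹ p b * T y a b :=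
          Finset.sum_congr rfl fun a _ => Finset.sum_comm
      _ = ∑ p, ∑ a, ∑ b, christoffel G y a m p * (G y)⁻¹ p b * T y a b := Finset.sum_comm
      _ = ∑ p, ∑ b, ∑ a, christoffel G y a m p * (G y)⁻¹ p b * T y a b :=
          Finset.sum_congr rfl fun a _ => Finset.sum_comm
      _ = _ := Finset.sum_congr rfl fun a _ => Finset.sum_congr rfl fun b _ =>
          Finset.sum_congr rfl fun p _ => by ring
  have h3 : ∑ a, ∑ b, (∑ p, (G y)⁻¹ a p * christoffel G y b m p) * T y a b
      = ∑ a, ∑ b, (G y)⁻¹ a b * ∑ p, christoffel G y p m b * T y a p := by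
    simp only [Finset.sum_mul, Finset.mul_sum]
    refine Finset.sum_congr rfl fun a _ => ?_
    rw [Finset.sum_comm]
    exact Finset.sum_congr rfl fun b _ => Finset.sum_congr rfl fun p _ => by ring
  rw [h1]
  simp only [h0, tr, covDeriv₂, mul_sub, sub_mul, neg_mul, Finset.sum_add_distrib,
    Finset.sum_sub_distrib, Finset.sum_neg_distrib]
  rw [h2, h3]
  ring

/-- Contracting the first and third slots commutes with the covariant derivative. -/
lemma covDeriv_tr₁₃ (hG : IsMetricOn G U) (hy : y ∈ U)
    {T : Coord n → Fin n → Fin n → Fin n → Fin n → ℝ}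
    (hT : ∀ i j k l, ContDiffAt ℝ ∞ (fun z => T z i j k l) y) (m j l : Fin n) :
    covDeriv₂ G (fun z j l => tr G z (fun i k => T z i j k l)) y m j l
      = tr G y (fun i k => covDeriv₄ G T y m i j k l) := by
  have h := hG.partialDeriv_tr hy (T := fun z i k => T z i j k l) (fun a b => hT a j b l) m
  unfold covDeriv₂ at h ⊢
  rw [h]
  simp only [← tr_const_mul, ← tr_sum, ← tr_sub, covDeriv₄]
  congr 1
  funext i k
  ring

end IsMetricOn

/-! ### Formal properties of covariant derivatives -/

section
variable {G : Coord n → Matrix (Fin n) (Fin n) ℝ} {y : Coord n}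

lemma covDeriv₂_congr {S T : Coord n → Fin n → Fin n → ℝ} (h : S =ᶠ[𝓝 y] T) (m i j : Fin n) :
    covDeriv₂ G S y m i j = covDeriv₂ G T y m i j := by
  unfold covDeriv₂
  rw [h.eq_of_nhds, partialDeriv_congr (g := fun z => T z i j) m
    (h.mono fun z hz => by simp only [hz])]

lemma covDeriv₃_congr {S T : Coord n → Fin n → Fin n → Fin n → ℝ} (h : S =ᶠ[𝓝 y] T)
    (m i j k : Fin n) : covDeriv₃ G S y m i j k = covDeriv₃ G T y m i j k := by
  unfold covDeriv₃
  rw [h.eq_of_nhds, partialDeriv_congr (g := fun z => T z i j k) m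
    (h.mono fun z hz => by simp only [hz])]

lemma covDeriv₄_congr {S T : Coord n → Fin n → Fin n → Fin n → Fin n → ℝ} (h : S =ᶠ[𝓝 y] T)
    (m i j k l : Fin n) : covDeriv₄ G S y m i j k l = covDeriv₄ G T y m i j k l := by
  unfold covDeriv₄
  rw [h.eq_of_nhds, partialDeriv_congr (g := fun z => T z i j k l) m
    (h.mono fun z hz => by simp only [hz])]

lemma covDeriv₂_swap (T : Coord n → Fin n → Fin n → ℝ) (m i j : Fin n) :
    covDeriv₂ G (fun z a b => T z b a) y m i j = covDeriv₂ G T y m j i := by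
  unfold covDeriv₂
  ring

lemma covDeriv₂_sub {S T : Coord n → Fin n → Fin n → ℝ}
    (hS : ∀ a b, ContDiffAt ℝ ∞ (fun z => S z a b) y)
    (hT : ∀ a b, ContDiffAt ℝ ∞ (fun z => T z a b) y) (m i j : Fin n) :
    covDeriv₂ G (fun z a b => S z a b - T z a b) y m i j
      = covDeriv₂ G S y m i j - covDeriv₂ G T y m i j := by
  unfold covDeriv₂
  rw [partialDeriv_sub m (hS i j).diff (hT i j).diff]
  simp only [mul_sub, Finset.sum_sub_distrib]
  ring

lemma covDeriv₂_add {S T : Coord n → Fin n → Fin n → ℝ}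
    (hS : ∀ a b, ContDiffAt ℝ ∞ (fun z => S z a b) y)
    (hT : ∀ a b, ContDiffAt ℝ ∞ (fun z => T z a b) y) (m i j : Fin n) :
    covDeriv₂ G (fun z a b => S z a b + T z a b) y m i j
      = covDeriv₂ G S y m i j + covDeriv₂ G T y m i j := by
  unfold covDeriv₂
  rw [partialDeriv_add m (hS i j).diff (hT i j).diff]
  simp only [mul_add, Finset.sum_add_distrib]
  ring

lemma covDeriv₂_mul {f : Coord n → ℝ} {T : Coord n → Fin n → Fin n → ℝ}
    (hf : ContDiffAt ℝ ∞ f y)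
    (hT : ∀ a b, ContDiffAt ℝ ∞ (fun z => T z a b) y) (m i j : Fin n) :
    covDeriv₂ G (fun z a b => f z * T z a b) y m i j
      = partialDeriv m f y * T y i j + f y * covDeriv₂ G T y m i j := by
  unfold covDeriv₂
  rw [partialDeriv_mul m hf.diff (hT i j).diff]
  simp only [mul_sub, mul_left_comm _ (f y), ← Finset.mul_sum]
  ring

lemma covDeriv₃_const_mul (c : ℝ) {T : Coord n → Fin n → Fin n → Fin n → ℝ}
    (hT : ∀ i j k, ContDiffAt ℝ ∞ (fun z => T z i j k) y) (m i j k : Fin n) :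
    covDeriv₃ G (fun z i j k => c * T z i j k) y m i j k = c * covDeriv₃ G T y m i j k := by
  unfold covDeriv₃
  rw [partialDeriv_const_mul m c (hT i j k).diff]
  simp only [mul_sub, mul_left_comm _ c, ← Finset.mul_sum]

lemma covDeriv₄_sub {S T : Coord n → Fin n → Fin n → Fin n → Fin n → ℝ}
    (hS : ∀ i j k l, ContDiffAt ℝ ∞ (fun z => S z i j k l) y)
    (hT : ∀ i j k l, ContDiffAt ℝ ∞ (fun z => T z i j k l) y) (m i j k l : Fin n) :
    covDeriv₄ G (fun z i j k l => S z i j k l - T z i j k l) y m i j k l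
      = covDeriv₄ G S y m i j k l - covDeriv₄ G T y m i j k l := by
  unfold covDeriv₄
  rw [partialDeriv_sub m (hS i j k l).diff (hT i j k l).diff]
  simp only [mul_sub, Finset.sum_sub_distrib]
  ring

lemma covDeriv₄_neg (T : Coord n → Fin n → Fin n → Fin n → Fin n → ℝ) (m i j k l : Fin n) :
    covDeriv₄ G (fun z i j k l => - T z i j k l) y m i j k l
      = - covDeriv₄ G T y m i j k l := by
  unfold covDeriv₄
  rw [partialDeriv_neg]
  simp only [mul_neg, Finset.sum_neg_distrib]
  ring

lemma covDeriv₄_swap₁₂ (T : Coord n → Fin n → Fin n → Fin n → Fin n → ℝ) (m i j k l : Fin n) :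
    covDeriv₄ G (fun z i j k l => T z j i k l) y m i j k l = covDeriv₄ G T y m j i k l := by
  unfold covDeriv₄
  ring

lemma covDeriv₄_swap_pairs (T : Coord n → Fin n → Fin n → Fin n → Fin n → ℝ)
    (m i j k l : Fin n) :
    covDeriv₄ G (fun z i j k l => T z k l i j) y m i j k l = covDeriv₄ G T y m k l i j := by
  unfold covDeriv₄
  ring

end

/-- The Kulkarni–Nomizu product of two 2-tensors. -/
def kulkarniNomizu (A B : Fin n → Fin n → ℝ) (i j k l : Fin n) : ℝ :=
  A i k * B j l + A j l * B i k - A i l * B j k - A j k * B i l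

lemma covDeriv_kulkarniNomizu {G : Coord n → Matrix (Fin n) (Fin n) ℝ} {y : Coord n}
    {A B : Coord n → Fin n → Fin n → ℝ}
    (hA : ∀ a b, ContDiffAt ℝ ∞ (fun z => A z a b) y)
    (hB : ∀ a b, ContDiffAt ℝ ∞ (fun z => B z a b) y) (m i j k l : Fin n) :
    covDeriv₄ G (fun z => kulkarniNomizu (A z) (B z)) y m i j k l
      = kulkarniNomizu (covDeriv₂ G A y m) (B y) i j k l
        + kulkarniNomizu (A y) (covDeriv₂ G B y m) i j k l := by
  have hm : ∀ a b c d, ContDiffAt ℝ ∞ (fun z => A z a b * B z c d) y :=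
    fun a b c d => (hA a b).mul (hB c d)
  have hd : ∀ a b c d, partialDeriv m (fun z => A z a b * B z c d) y
      = partialDeriv m (fun z => A z a b) y * B y c d
        + A y a b * partialDeriv m (fun z => B z c d) y :=
    fun a b c d => partialDeriv_mul m (hA a b).diff (hB c d).diff
  unfold covDeriv₄ kulkarniNomizu
  rw [partialDeriv_sub m (((hm i k j l).add (hm j l i k)).sub (hm i l j k)).diff (hm j k i l).diff,
    partialDeriv_sub m ((hm i k j l).add (hm j l i k)).diff (hm i l j k).diff,
    partialDeriv_add m (hm i k j l).diff (hm j l i k).diff, hd, hd, hd, hd]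
  unfold covDeriv₂
  simp only [mul_sub, mul_add, sub_mul, Finset.sum_sub_distrib, Finset.sum_add_distrib,
    Finset.sum_mul, Finset.mul_sum]
  simp only [mul_left_comm (A y _ _) (christoffel G y _ _ _), mul_assoc]
  ring

/-! ### Ricci, Schouten, Weyl, Cotton and Bach tensors -/

/-- The Schouten tensor. -/
def schouten (G : Coord n → Matrix (Fin n) (Fin n) ℝ) (y : Coord n) (i j : Fin n) : ℝ :=
  1 / ((n : ℝ) - 2) * (ricci G y i j - 1 / (2 * ((n : ℝ) - 1)) * (scalar G y * G y i j))

lemma ricci_eq_tr (G : Coord n → Matrix (Fin n) (Fin n) ℝ) (y : Coord n) (j l : Fin n) :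
    ricci G y j l = tr G y (fun i k => riemann G y i j k l) := rfl

/-- The Schouten form of the Ricci decomposition replaces the two correction terms by a single
product with the parallel tensor g, which is what makes covariant derivatives and traces short. -/
lemma weyl_eq (hn : 3 ≤ n) (G : Coord n → Matrix (Fin n) (Fin n) ℝ) (y : Coord n)
    (i j k l : Fin n) :
    weyl G y i j k l = riemann G y i j k l - kulkarniNomizu (schouten G y) (G y) i j k l := by
  have hn' : (3 : ℝ) ≤ n := by exact_mod_cast hn
  have h1 : (n : ℝ) - 1 ≠ 0 := by linarith
  have h2 : (n : ℝ) - 2 ≠ 0 := by linarith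
  unfold weyl kulkarniNomizu schouten
  field_simp
  ring

namespace IsMetricOn

variable {G : Coord n → Matrix (Fin n) (Fin n) ℝ} {U : Set (Coord n)} {y : Coord n}

lemma tr_const_mul_metric (hG : IsMetricOn G U) (hy : y ∈ U) (c : ℝ) :
    tr G y (fun a b => c * G y a b) = c * n := by
  rw [← hG.tr_metric hy]
  exact tr_const_mul G y c (G y)

lemma ricci_symm (hG : IsMetricOn G U) (hy : y ∈ U) (j l : Fin n) :
    ricci G y j l = ricci G y l j := by
  rw [ricci_eq_tr, ricci_eq_tr, ← hG.tr_swap hy]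
  congr 1
  funext i k
  exact hG.riemann_pair_symm hy k j i l

lemma smooth_ricci (hG : IsMetricOn G U) (hy : y ∈ U) (j l : Fin n) :
    ContDiffAt ℝ ∞ (fun z => ricci G z j l) y :=
  hG.smooth_tr hy fun i k => hG.smooth_riemann hy i j k l

lemma smooth_scalar (hG : IsMetricOn G U) (hy : y ∈ U) : ContDiffAt ℝ ∞ (scalar G) y :=
  hG.smooth_tr hy fun j l => hG.smooth_ricci hy j l

lemma smooth_schouten (hG : IsMetricOn G U) (hy : y ∈ U) (i j : Fin n) :
    ContDiffAt ℝ ∞ (fun z => schouten G z i j) y :=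
  contDiffAt_const.mul ((hG.smooth_ricci hy i j).sub
    (contDiffAt_const.mul ((hG.smooth_scalar hy).mul (hG.smooth y hy i j))))

lemma smooth_covDeriv₂ (hG : IsMetricOn G U) (hy : y ∈ U) {T : Coord n → Fin n → Fin n → ℝ}
    (hT : ∀ a b, ContDiffAt ℝ ∞ (fun z => T z a b) y) (m i j : Fin n) :
    ContDiffAt ℝ ∞ (fun z => covDeriv₂ G T z m i j) y :=
  ((contDiffAt_partialDeriv m (hT i j)).sub (ContDiffAt.sum fun p _ =>
    (hG.smooth_christoffel hy p m i).mul (hT p j))).sub (ContDiffAt.sum fun p _ =>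
    (hG.smooth_christoffel hy p m j).mul (hT i p))

lemma smooth_cotton (hG : IsMetricOn G U) (hy : y ∈ U) (i j k : Fin n) :
    ContDiffAt ℝ ∞ (fun z => cotton G z i j k) y := by
  have hr := hG.smooth_covDeriv₂ hy (hG.smooth_ricci hy)
  have hs := fun m => contDiffAt_partialDeriv m (hG.smooth_scalar hy)
  exact ((hr i j k).sub (hr j i k)).sub (contDiffAt_const.mul
    (((hs i).mul (hG.smooth y hy j k)).sub ((hs j).mul (hG.smooth y hy i k))))

lemma covDeriv_metric (hG : IsMetricOn G U) (hy : y ∈ U) (m i j : Fin n) :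
    covDeriv₂ G G y m i j = 0 := by
  have h := congrFun (congrFun (hG.matDeriv_metric hy m) i) j
  simp only [matDeriv, Matrix.of_apply, Matrix.add_apply, Matrix.mul_apply, conn,
    Matrix.transpose_apply] at h
  unfold covDeriv₂
  rw [h]
  simp only [mul_comm (G y i _)]
  ring

lemma covDeriv_riemann_antisymm_left (G : Coord n → Matrix (Fin n) (Fin n) ℝ) (y : Coord n) (m i j k l : Fin n) :
    covDeriv₄ G (riemann G) y m i j k l = - covDeriv₄ G (riemann G) y m j i k l := by
  have h : riemann G =ᶠ[𝓝 y] fun z i j k l => - riemann G z j i k l :=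
    Eventually.of_forall fun z => by
      funext i j k l
      exact riemann_antisymm_left G z i j k l
  exact (covDeriv₄_congr h m i j k l).trans
    ((covDeriv₄_neg (fun z i j k l => riemann G z j i k l) m i j k l).trans
      (congrArg Neg.neg (covDeriv₄_swap₁₂ (riemann G) m i j k l)))

lemma covDeriv_ricci_eq_tr (hG : IsMetricOn G U) (hy : y ∈ U) (m j l : Fin n) :
    covDeriv₂ G (ricci G) y m j l = tr G y (fun i k => covDeriv₄ G (riemann G) y m i j k l) :=
  hG.covDeriv_tr₁₃ hy (fun i j k l => hG.smooth_riemann hy i j k l) m j l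

lemma partialDeriv_scalar (hG : IsMetricOn G U) (hy : y ∈ U) (m : Fin n) :
    partialDeriv m (scalar G) y = tr G y (covDeriv₂ G (ricci G) y m) :=
  hG.partialDeriv_tr hy (fun i j => hG.smooth_ricci hy i j) m

lemma covDeriv_ricci_symm (hG : IsMetricOn G U) (hy : y ∈ U) (m i j : Fin n) :
    covDeriv₂ G (ricci G) y m i j = covDeriv₂ G (ricci G) y m j i := by
  have h : ricci G =ᶠ[𝓝 y] fun z a b => ricci G z b a := by
    filter_upwards [hG.mem_nhds hy] with z hz
    funext a b
    exact hG.ricci_symm hz a b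
  exact (covDeriv₂_congr h m i j).trans (covDeriv₂_swap (ricci G) m i j)

/-- The divergence of the curvature tensor. -/
lemma div_riemann (hG : IsMetricOn G U) (hy : y ∈ U) (i j l : Fin n) :
    tr G y (fun m k => covDeriv₄ G (riemann G) y m i j k l)
      = covDeriv₂ G (ricci G) y i j l - covDeriv₂ G (ricci G) y j i l := by
  rw [hG.covDeriv_ricci_eq_tr hy, hG.covDeriv_ricci_eq_tr hy, ← tr_sub]
  congr 1
  funext m k
  linarith [hG.covDeriv_riemann_bianchi hy m i j k l,
    covDeriv_riemann_antisymm_left G y i j m k l]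

/-- The contracted Bianchi identity. -/
lemma div_ricci (hG : IsMetricOn G U) (hy : y ∈ U) (i : Fin n) :
    tr G y (fun m k => covDeriv₂ G (ricci G) y m k i) = 1 / 2 * partialDeriv i (scalar G) y := by
  have hanti : ∀ m k l j, covDeriv₄ G (riemann G) y m i j k l
      = covDeriv₄ G (riemann G) y m j i l k := by
    intro m k l j
    have h : riemann G =ᶠ[𝓝 y] fun z i j k l => riemann G z j i l k := by
      filter_upwards [hG.mem_nhds hy] with z hz
      funext i j k l
      rw [riemann_antisymm_left G z i j k l, hG.riemann_antisymm_right hz j i k l, neg_neg]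
    rw [covDeriv₄_congr h]
    unfold covDeriv₄
    ring
  -- The double trace of ∇R is evaluated in two ways: `h1` contracts to Ricci first, `h2` uses the
  -- divergence of the curvature tensor first.
  have h1 : tr G y (fun j l => tr G y (fun m k => covDeriv₄ G (riemann G) y m i j k l))
      = tr G y (fun m k => covDeriv₂ G (ricci G) y m k i) := by
    rw [tr_comm]
    congr 1
    funext m k
    rw [hG.covDeriv_ricci_symm hy, hG.covDeriv_ricci_eq_tr hy]
    congr 1
    funext j l
    exact hanti m k l j
  have h2 : tr G y (fun j l => tr G y (fun m k => covDeriv₄ G (riemann G) y m i j k l))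
      = partialDeriv i (scalar G) y - tr G y (fun m k => covDeriv₂ G (ricci G) y m k i) := by
    simp only [hG.div_riemann hy]
    rw [tr_sub, ← hG.partialDeriv_scalar hy]
    congr 2
    funext m k
    exact hG.covDeriv_ricci_symm hy _ _ _
  linarith

lemma covDeriv_schouten (hG : IsMetricOn G U) (hy : y ∈ U) (m i j : Fin n) :
    covDeriv₂ G (schouten G) y m i j = 1 / ((n : ℝ) - 2) * (covDeriv₂ G (ricci G) y m i j
      - 1 / (2 * ((n : ℝ) - 1)) * (partialDeriv m (scalar G) y * G y i j)) := by
  have hs := hG.smooth_scalar hy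
  have hr := hG.smooth_ricci hy
  have hg := hG.smooth y hy
  have e1 := covDeriv₂_mul (G := G) (f := fun _ => 1 / ((n : ℝ) - 2))
    (T := fun z i j => ricci G z i j - 1 / (2 * ((n : ℝ) - 1)) * (scalar G z * G z i j))
    contDiffAt_const
    (fun a b => (hr a b).sub (contDiffAt_const.mul (hs.mul (hg a b)))) m i j
  have e2 := covDeriv₂_mul (G := G) (f := fun _ => 1 / (2 * ((n : ℝ) - 1)))
    (T := fun z i j => scalar G z * G z i j)
    contDiffAt_const (fun a b => hs.mul (hg a b)) m i j
  have e3 := covDeriv₂_mul (G := G) (f := scalar G) (T := G) hs hg m i j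
  have e4 := covDeriv₂_sub (G := G) (S := ricci G)
    (T := fun z i j => 1 / (2 * ((n : ℝ) - 1)) * (scalar G z * G z i j)) hr
    (fun a b => contDiffAt_const.mul (hs.mul (hg a b))) m i j
  rw [partialDeriv_const, zero_mul, zero_add] at e1 e2
  rw [hG.covDeriv_metric hy, mul_zero, add_zero] at e3
  rw [e3] at e2
  rw [e2] at e4
  rw [e4] at e1
  exact e1

lemma div_schouten (hn : 3 ≤ n) (hG : IsMetricOn G U) (hy : y ∈ U) (i : Fin n) :
    tr G y (fun m k => covDeriv₂ G (schouten G) y m k i)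
      = 1 / (2 * ((n : ℝ) - 1)) * partialDeriv i (scalar G) y := by
  have hn' : (3 : ℝ) ≤ n := by exact_mod_cast hn
  have h1 : (n : ℝ) - 1 ≠ 0 := by linarith
  have h2 : (n : ℝ) - 2 ≠ 0 := by linarith
  have h : tr G y (fun m k => partialDeriv m (scalar G) y * G y k i)
      = partialDeriv i (scalar G) y := by
    simp only [mul_comm (partialDeriv _ (scalar G) y)]
    exact hG.tr_metric_mul' hy i _
  simp only [hG.covDeriv_schouten hy, tr_const_mul, tr_sub, h, hG.div_ricci hy]
  field_simp
  ring

lemma weyl_pair_symm (hG : IsMetricOn G U) (hy : y ∈ U) (i j k l : Fin n) :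
    weyl G y i j k l = weyl G y k l i j := by
  unfold weyl
  rw [hG.riemann_pair_symm hy i j k l, hG.ricci_symm hy i k, hG.ricci_symm hy j l,
    hG.ricci_symm hy i l, hG.ricci_symm hy j k, hG.symm hy i k, hG.symm hy j l, hG.symm hy i l,
    hG.symm hy j k]
  ring

lemma smooth_kulkarniNomizu_schouten (hG : IsMetricOn G U) (hy : y ∈ U) (i j k l : Fin n) :
    ContDiffAt ℝ ∞ (fun z => kulkarniNomizu (schouten G z) (G z) i j k l) y := by
  have h : ∀ a b c d, ContDiffAt ℝ ∞ (fun z => schouten G z a b * G z c d) y :=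
    fun a b c d => (hG.smooth_schouten hy a b).mul (hG.smooth y hy c d)
  exact (((h _ _ _ _).add (h _ _ _ _)).sub (h _ _ _ _)).sub (h _ _ _ _)

/-- Since ∇g = 0, the Leibniz rule leaves only the derivative of the Schouten factor. -/
lemma covDeriv_weyl (hn : 3 ≤ n) (hG : IsMetricOn G U) (hy : y ∈ U) (m i j k l : Fin n) :
    covDeriv₄ G (weyl G) y m i j k l = covDeriv₄ G (riemann G) y m i j k l
      - kulkarniNomizu (covDeriv₂ G (schouten G) y m) (G y) i j k l := by
  have h : weyl G = fun z i j k l => riemann G z i j k l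
      - kulkarniNomizu (schouten G z) (G z) i j k l := by
    funext z i j k l
    exact weyl_eq hn G z i j k l
  have h0 : kulkarniNomizu (schouten G y) (covDeriv₂ G G y m) i j k l = 0 := by
    simp only [kulkarniNomizu, hG.covDeriv_metric hy, mul_zero]
    norm_num
  rw [h, covDeriv₄_sub (S := riemann G)
    (T := fun z i j k l => kulkarniNomizu (schouten G z) (G z) i j k l)
    (hG.smooth_riemann hy) (hG.smooth_kulkarniNomizu_schouten hy)]
  congr 1
  rw [← add_zero (kulkarniNomizu (covDeriv₂ G (schouten G) y m) (G y) i j k l), ← h0]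
  exact covDeriv_kulkarniNomizu (B := G) (hG.smooth_schouten hy) (hG.smooth y hy) m i j k l

/-- The divergence of the Weyl tensor is a multiple of the Cotton tensor. -/
lemma divWeyl_eq (hn : 3 ≤ n) (hG : IsMetricOn G U) (hy : y ∈ U) (i j k : Fin n) :
    divWeyl G y i j k = - (((n : ℝ) - 3) / ((n : ℝ) - 2)) * cotton G y j k i := by
  have hn' : (3 : ℝ) ≤ n := by exact_mod_cast hn
  have h1 : (n : ℝ) - 1 ≠ 0 := by linarith
  have h2 : (n : ℝ) - 2 ≠ 0 := by linarith
  -- Pair symmetry moves the contracted index to the third slot, the one contracted in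
  -- `div_riemann`.
  have hsym : ∀ a b, covDeriv₄ G (weyl G) y a b i j k = covDeriv₄ G (weyl G) y a j k b i := by
    intro a b
    have h : weyl G =ᶠ[𝓝 y] fun z i j k l => weyl G z k l i j := by
      filter_upwards [hG.mem_nhds hy] with z hz
      funext p q r s
      exact hG.weyl_pair_symm hz p q r s
    exact (covDeriv₄_congr h a b i j k).trans (covDeriv₄_swap_pairs (weyl G) a b i j k)
  have hP : ∀ m i j, covDeriv₂ G (schouten G) y m i j = covDeriv₂ G (schouten G) y m j i := by
    intro m i j
    rw [hG.covDeriv_schouten hy, hG.covDeriv_schouten hy, hG.covDeriv_ricci_symm hy m i j,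
      hG.symm hy i j]
  have hd : divWeyl G y i j k = - tr G y (fun a b => covDeriv₄ G (weyl G) y a b i j k) := rfl
  rw [hd]
  simp only [hsym, hG.covDeriv_weyl hn hy, kulkarniNomizu, tr_sub, tr_add, hG.div_riemann hy]
  have t1 : tr G y (fun a b => covDeriv₂ G (schouten G) y a j b * G y k i)
      = 1 / (2 * ((n : ℝ) - 1)) * partialDeriv j (scalar G) y * G y k i := by
    simp only [tr_mul_const, hP _ j, hG.div_schouten hn hy]
  have t2 : tr G y (fun a b => covDeriv₂ G (schouten G) y a k i * G y j b)
      = covDeriv₂ G (schouten G) y j k i := by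
    simp only [hG.symm hy j, mul_comm _ (G y _ j)]
    exact hG.tr_metric_mul' hy j fun a => covDeriv₂ G (schouten G) y a k i
  have t3 : tr G y (fun a b => covDeriv₂ G (schouten G) y a j i * G y k b)
      = covDeriv₂ G (schouten G) y k j i := by
    simp only [hG.symm hy k, mul_comm _ (G y _ k)]
    exact hG.tr_metric_mul' hy k fun a => covDeriv₂ G (schouten G) y a j i
  have t4 : tr G y (fun a b => covDeriv₂ G (schouten G) y a k b * G y j i)
      = 1 / (2 * ((n : ℝ) - 1)) * partialDeriv k (scalar G) y * G y j i := by
    simp only [tr_mul_const, hP _ k, hG.div_schouten hn hy]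
  rw [t1, t2, t3, t4, hG.covDeriv_schouten hy, hG.covDeriv_schouten hy]
  unfold cotton
  field_simp
  ring

/-- The Bach tensor in terms of the divergence of the Cotton tensor. -/
lemma bach_eq (hn : 4 ≤ n) (hG : IsMetricOn G U) (hy : y ∈ U) (i j : Fin n) :
    bach G y i j = 1 / ((n : ℝ) - 2) *
      (tr G y (fun a b => covDeriv₃ G (cotton G) y a b i j) + weylActionZ G y i j) := by
  have hn' : (4 : ℝ) ≤ n := by exact_mod_cast hn
  have h2 : (n : ℝ) - 2 ≠ 0 := by linarith
  have h3 : (n : ℝ) - 3 ≠ 0 := by linarith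
  have h : ∀ a b, covDeriv₃ G (fun z a b c => divWeyl G z c a b) y a b i j
      = - (((n : ℝ) - 3) / ((n : ℝ) - 2)) * covDeriv₃ G (cotton G) y a b i j := by
    intro a b
    rw [← covDeriv₃_const_mul _ (hG.smooth_cotton hy)]
    refine covDeriv₃_congr ?_ a b i j
    filter_upwards [hG.mem_nhds hy] with z hz
    funext p q r
    exact hG.divWeyl_eq (by omega) hz r p q
  have hadj : adjointDD G (fun z a b c => divWeyl G z c a b) y i j
      = ((n : ℝ) - 3) / ((n : ℝ) - 2) * tr G y (fun a b => covDeriv₃ G (cotton G) y a b i j) := by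
    have : adjointDD G (fun z a b c => divWeyl G z c a b) y i j
      = - tr G y (fun a b => covDeriv₃ G (fun z a b c => divWeyl G z c a b) y a b i j) := rfl
    rw [this]
    simp only [h, tr_const_mul]
    ring
  rw [bach, hadj]
  field_simp

lemma cotton_antisymm (G : Coord n → Matrix (Fin n) (Fin n) ℝ) (y : Coord n) (i j k : Fin n) :
    cotton G y i j k = - cotton G y j i k := by
  unfold cotton
  ring

/-- The Cotton tensor is trace free. -/
lemma tr_cotton (hn : 3 ≤ n) (hG : IsMetricOn G U) (hy : y ∈ U) (i : Fin n) :
    tr G y (fun j k => cotton G y i j k) = 0 := by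
  have hn' : (3 : ℝ) ≤ n := by exact_mod_cast hn
  have h1 : (n : ℝ) - 1 ≠ 0 := by linarith
  unfold cotton
  have t1 : tr G y (fun j k => covDeriv₂ G (ricci G) y j i k)
      = 1 / 2 * partialDeriv i (scalar G) y := by
    simp only [hG.covDeriv_ricci_symm hy _ i, hG.div_ricci hy]
  have t2 : tr G y (fun j k => partialDeriv j (scalar G) y * G y i k)
      = partialDeriv i (scalar G) y := by
    simp only [hG.symm hy i, mul_comm (partialDeriv _ (scalar G) y)]
    exact hG.tr_metric_mul' hy i _
  have t3 : tr G y (fun j k => covDeriv₂ G (ricci G) y i j k) = partialDeriv i (scalar G) y :=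
    (hG.partialDeriv_scalar hy i).symm
  simp only [tr_sub, hG.tr_const_mul_metric hy, tr_const_mul, t1, t2, t3]
  field_simp
  ring

/-- Contracting the two middle slots carries the sign opposite to the Ricci contraction, hence the
factor 2 - n. It is used to check that the Weyl tensor is trace-free. -/
lemma tr_kulkarniNomizu_metric (hG : IsMetricOn G U) (hy : y ∈ U) (A : Fin n → Fin n → ℝ)
    (i l : Fin n) :
    tr G y (fun j k => kulkarniNomizu A (G y) i j k l)
      = (2 - n) * A i l - tr G y A * G y i l := by
  have t1 : tr G y (fun j k => A i k * G y j l) = A i l := by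
    simp only [mul_comm (A i _)]
    exact hG.tr_metric_mul hy l _
  have t2 : tr G y (fun j k => A j l * G y i k) = A i l := by
    simp only [hG.symm hy i, mul_comm (A _ l)]
    exact hG.tr_metric_mul' hy i fun a => A a l
  have t3 : tr G y (fun j k => A i l * G y j k) = A i l * n :=
    hG.tr_const_mul_metric hy _
  have t4 : tr G y (fun j k => A j k * G y i l) = tr G y A * G y i l := tr_mul_const _ _ _ _
  simp only [kulkarniNomizu, tr_sub, tr_add, t1, t2, t3, t4]
  ring

lemma tr_schouten (hn : 3 ≤ n) (hG : IsMetricOn G U) (hy : y ∈ U) :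
    tr G y (schouten G y) = 1 / (2 * ((n : ℝ) - 1)) * scalar G y := by
  have hn' : (3 : ℝ) ≤ n := by exact_mod_cast hn
  have h1 : (n : ℝ) - 1 ≠ 0 := by linarith
  have h2 : (n : ℝ) - 2 ≠ 0 := by linarith
  have t' : tr G y (fun j k => ricci G y j k) = scalar G y := rfl
  have : tr G y (schouten G y) = tr G y (fun i j => 1 / ((n : ℝ) - 2) *
    (ricci G y i j - 1 / (2 * ((n : ℝ) - 1)) * (scalar G y * G y i j))) := rfl
  rw [this]
  simp only [hG.tr_const_mul_metric hy, tr_const_mul, tr_sub, t']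
  field_simp
  ring

/-- The Weyl tensor is trace free. -/
lemma tr_weyl (hn : 3 ≤ n) (hG : IsMetricOn G U) (hy : y ∈ U) (i l : Fin n) :
    tr G y (fun j k => weyl G y i j k l) = 0 := by
  have hn' : (3 : ℝ) ≤ n := by exact_mod_cast hn
  have h1 : (n : ℝ) - 1 ≠ 0 := by linarith
  have h2 : (n : ℝ) - 2 ≠ 0 := by linarith
  have t : tr G y (fun j k => riemann G y i j k l) = - ricci G y i l := by
    rw [ricci_eq_tr, ← tr_neg]
    congr 1
    funext j k
    exact riemann_antisymm_left G y i j k l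
  simp only [weyl_eq hn, tr_sub, t, hG.tr_kulkarniNomizu_metric hy,
    hG.tr_schouten hn hy]
  unfold schouten
  field_simp
  ring

lemma weyl_antisymm_left (G : Coord n → Matrix (Fin n) (Fin n) ℝ) (y : Coord n)
    (i j k l : Fin n) : weyl G y i j k l = - weyl G y j i k l := by
  unfold weyl
  rw [riemann_antisymm_left G y i j]
  ring

lemma weyl_antisymm_right (hG : IsMetricOn G U) (hy : y ∈ U) (i j k l : Fin n) :
    weyl G y i j k l = - weyl G y i j l k := by
  unfold weyl
  rw [hG.riemann_antisymm_right hy i j]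
  ring

end IsMetricOn

/-! ### Gradients -/

/-- The components of the gradient of `f`. -/
def grad (G : Coord n → Matrix (Fin n) (Fin n) ℝ) (f : Coord n → ℝ) (y : Coord n) (i : Fin n) :
    ℝ := ∑ p, (G y)⁻¹ i p * partialDeriv p f y

/-- The inner product of the gradients of two functions. -/
def gradInner (G : Coord n → Matrix (Fin n) (Fin n) ℝ) (f₁ f₂ : Coord n → ℝ) (y : Coord n) : ℝ :=
  tr G y (fun a b => partialDeriv a f₁ y * partialDeriv b f₂ y)

/-- The covariant derivative of a one-form. -/
def covDeriv₁ (G : Coord n → Matrix (Fin n) (Fin n) ℝ) (T : Coord n → Fin n → ℝ)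
    (y : Coord n) (m i : Fin n) : ℝ :=
  partialDeriv m (fun z => T z i) y - ∑ p, christoffel G y p m i * T y p

lemma covDeriv₂_du_mul_du {G : Coord n → Matrix (Fin n) (Fin n) ℝ} {y : Coord n}
    {f : Coord n → ℝ} (hf : ContDiffAt ℝ ∞ f y) (m a b : Fin n) :
    covDeriv₂ G (fun z a b => partialDeriv a f z * partialDeriv b f z) y m a b
      = hessian G f y m a * partialDeriv b f y + partialDeriv a f y * hessian G f y m b := by
  have hd := fun a => contDiffAt_partialDeriv a hf
  unfold covDeriv₂ hessian
  rw [partialDeriv_mul m (hd a).diff (hd b).diff]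
  simp only [mul_left_comm _ (partialDeriv a f y), ← mul_assoc, ← Finset.sum_mul]
  simp only [mul_assoc, ← Finset.mul_sum]
  ring

namespace IsMetricOn

variable {G : Coord n → Matrix (Fin n) (Fin n) ℝ} {U : Set (Coord n)} {y : Coord n}
  {f f₁ f₂ : Coord n → ℝ}

lemma tr_partialDeriv_mul (hG : IsMetricOn G U) (hy : y ∈ U) (X : Fin n → ℝ) :
    tr G y (fun a b => partialDeriv a f y * X b) = ∑ b, X b * grad G f y b := by
  simp only [tr, grad, Finset.mul_sum]
  rw [Finset.sum_comm]
  exact Finset.sum_congr rfl fun a _ => Finset.sum_congr rfl fun b _ => by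
    rw [hG.inv_symm hy]; ring

lemma gradInner_eq (hG : IsMetricOn G U) (hy : y ∈ U) :
    gradInner G f₁ f₂ y = ∑ b, partialDeriv b f₂ y * grad G f₁ y b :=
  hG.tr_partialDeriv_mul hy fun b => partialDeriv b f₂ y

lemma sum_metric_grad (hG : IsMetricOn G U) (hy : y ∈ U) (i : Fin n) :
    ∑ l, G y i l * grad G f y l = partialDeriv i f y := by
  have h : (G y *ᵥ ((G y)⁻¹ *ᵥ fun p => partialDeriv p f y)) i = partialDeriv i f y := by
    rw [Matrix.mulVec_mulVec, hG.mul_inv hy, Matrix.one_mulVec]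
  exact h

lemma smooth_grad (hG : IsMetricOn G U) (hy : y ∈ U) (hf : ContDiffAt ℝ ∞ f y) (i : Fin n) :
    ContDiffAt ℝ ∞ (fun z => grad G f z i) y :=
  ContDiffAt.sum fun p _ => (hG.smooth_inv hy i p).mul (contDiffAt_partialDeriv p hf)

lemma smooth_gradInner (hG : IsMetricOn G U) (hy : y ∈ U) (hf₁ : ContDiffAt ℝ ∞ f₁ y)
    (hf₂ : ContDiffAt ℝ ∞ f₂ y) : ContDiffAt ℝ ∞ (gradInner G f₁ f₂) y :=
  hG.smooth_tr hy fun a b => (contDiffAt_partialDeriv a hf₁).mul (contDiffAt_partialDeriv b hf₂)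

lemma hessian_symm (hG : IsMetricOn G U) (hy : y ∈ U) (hf : ContDiffAt ℝ ∞ f y) (i j : Fin n) :
    hessian G f y i j = hessian G f y j i := by
  unfold hessian
  rw [partialDeriv_comm i j hf]
  simp only [hG.christoffel_symm hy _ i j]

lemma smooth_hessian (hG : IsMetricOn G U) (hy : y ∈ U) (hf : ContDiffAt ℝ ∞ f y)
    (i j : Fin n) : ContDiffAt ℝ ∞ (fun z => hessian G f z i j) y :=
  (contDiffAt_partialDeriv i (contDiffAt_partialDeriv j hf)).sub (ContDiffAt.sum fun k _ =>
    (hG.smooth_christoffel hy k i j).mul (contDiffAt_partialDeriv k hf))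

/-- The derivative of the gradient is the Hessian, with one index raised. -/
lemma partialDeriv_grad (hG : IsMetricOn G U) (hy : y ∈ U) (hf : ContDiffAt ℝ ∞ f y)
    (a i : Fin n) : partialDeriv a (fun z => grad G f z i) y
      = ∑ p, (G y)⁻¹ i p * hessian G f y a p - ∑ p, christoffel G y i a p * grad G f y p := by
  have h0 : ∀ p, partialDeriv a (fun z => (G z)⁻¹ i p) y
      = - (∑ q, christoffel G y i a q * (G y)⁻¹ q p)
        - ∑ q, (G y)⁻¹ i q * christoffel G y p a q := by
    intro p
    have h := congrFun (congrFun (hG.matDeriv_inv hy a) i) p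
    simp only [matDeriv, Matrix.of_apply, Matrix.neg_apply, Matrix.add_apply, Matrix.mul_apply,
      conn, Matrix.transpose_apply] at h
    rw [h]
    ring
  unfold grad
  rw [partialDeriv_sum a _ fun p _ =>
    ((hG.smooth_inv hy i p).mul (contDiffAt_partialDeriv p hf)).diff]
  have h1 : ∀ p, partialDeriv a (fun z => (G z)⁻¹ i p * partialDeriv p f z) y
      = (- (∑ q, christoffel G y i a q * (G y)⁻¹ q p)
        - ∑ q, (G y)⁻¹ i q * christoffel G y p a q) * partialDeriv p f y
        + (G y)⁻¹ i p * partialDeriv a (partialDeriv p f) y := fun p => by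
    rw [partialDeriv_mul a (hG.smooth_inv hy i p).diff (contDiffAt_partialDeriv p hf).diff, h0]
  have h2 : ∑ p, ∑ q, (G y)⁻¹ i q * christoffel G y p a q * partialDeriv p f y
      = ∑ p, ∑ q, (G y)⁻¹ i p * (christoffel G y q a p * partialDeriv q f y) := by
    rw [Finset.sum_comm]
    exact Finset.sum_congr rfl fun p _ => Finset.sum_congr rfl fun q _ => by ring
  have h3 : ∑ p, ∑ q, christoffel G y i a q * (G y)⁻¹ q p * partialDeriv p f y
      = ∑ p, ∑ q, christoffel G y i a p * ((G y)⁻¹ p q * partialDeriv q f y) := by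
    rw [Finset.sum_comm]
    exact Finset.sum_congr rfl fun p _ => Finset.sum_congr rfl fun q _ => by ring
  simp only [h1, hessian, sub_mul, neg_mul, mul_sub, Finset.sum_add_distrib,
    Finset.sum_sub_distrib, Finset.sum_neg_distrib, Finset.sum_mul, Finset.mul_sum]
  rw [h2, h3]
  ring

/-- Covariant Leibniz rule for the contraction of the last slot with a gradient. -/
lemma covDeriv₂_contract_grad (hG : IsMetricOn G U) (hy : y ∈ U) (hf : ContDiffAt ℝ ∞ f y)
    {T : Coord n → Fin n → Fin n → Fin n → ℝ}
    (hT : ∀ i j k, ContDiffAt ℝ ∞ (fun z => T z i j k) y) (a b i : Fin n) :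
    covDeriv₂ G (fun z b i => ∑ j, T z b i j * grad G f z j) y a b i
      = ∑ j, covDeriv₃ G T y a b i j * grad G f y j
        + tr G y (fun j p => T y b i j * hessian G f y a p) := by
  have hg := hG.smooth_grad hy hf
  have h1 : ∀ j, partialDeriv a (fun z => T z b i j * grad G f z j) y
      = partialDeriv a (fun z => T z b i j) y * grad G f y j
      + T y b i j * (∑ p, (G y)⁻¹ j p * hessian G f y a p
        - ∑ p, christoffel G y j a p * grad G f y p) := fun j => by
    rw [partialDeriv_mul a (hT b i j).diff (hg j).diff, hG.partialDeriv_grad hy hf]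
  unfold covDeriv₂
  rw [partialDeriv_sum a _ fun j _ => ((hT b i j).mul (hg j)).diff]
  have h2 : ∑ j, ∑ p, T y b i j * (christoffel G y j a p * grad G f y p)
      = ∑ j, ∑ p, christoffel G y p a j * T y b i p * grad G f y j := by
    rw [Finset.sum_comm]
    exact Finset.sum_congr rfl fun p _ => Finset.sum_congr rfl fun q _ => by ring
  have h3 : ∑ p, christoffel G y p a b * ∑ j, T y p i j * grad G f y j
      = ∑ j, ∑ p, christoffel G y p a b * T y p i j * grad G f y j := by
    simp only [Finset.mul_sum]
    rw [Finset.sum_comm]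
    simp only [mul_assoc]
  have h4 : ∑ p, christoffel G y p a i * ∑ j, T y b p j * grad G f y j
      = ∑ j, ∑ p, christoffel G y p a i * T y b p j * grad G f y j := by
    simp only [Finset.mul_sum]
    rw [Finset.sum_comm]
    simp only [mul_assoc]
  have h5 : ∑ j, ∑ p, T y b i j * ((G y)⁻¹ j p * hessian G f y a p)
      = tr G y (fun j p => T y b i j * hessian G f y a p) :=
    Finset.sum_congr rfl fun j _ => Finset.sum_congr rfl fun p _ => by ring
  rw [h3, h4, ← h5]
  simp only [h1, covDeriv₃, sub_mul, mul_sub, Finset.sum_add_distrib, Finset.sum_sub_distrib,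
    Finset.sum_mul, Finset.mul_sum]
  rw [h2]
  ring

lemma covDeriv₁_contract_grad (hG : IsMetricOn G U) (hy : y ∈ U) (hf : ContDiffAt ℝ ∞ f y)
    {T : Coord n → Fin n → Fin n → ℝ}
    (hT : ∀ i j, ContDiffAt ℝ ∞ (fun z => T z i j) y) (a b : Fin n) :
    covDeriv₁ G (fun z b => ∑ j, T z b j * grad G f z j) y a b
      = ∑ j, covDeriv₂ G T y a b j * grad G f y j
        + tr G y (fun j p => T y b j * hessian G f y a p) := by
  have hg := hG.smooth_grad hy hf
  have h1 : ∀ j, partialDeriv a (fun z => T z b j * grad G f z j) y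
      = partialDeriv a (fun z => T z b j) y * grad G f y j
      + T y b j * (∑ p, (G y)⁻¹ j p * hessian G f y a p
        - ∑ p, christoffel G y j a p * grad G f y p) := fun j => by
    rw [partialDeriv_mul a (hT b j).diff (hg j).diff, hG.partialDeriv_grad hy hf]
  unfold covDeriv₁
  rw [partialDeriv_sum a _ fun j _ => ((hT b j).mul (hg j)).diff]
  have h2 : ∑ j, ∑ p, T y b j * (christoffel G y j a p * grad G f y p)
      = ∑ j, ∑ p, christoffel G y p a j * T y b p * grad G f y j := by
    rw [Finset.sum_comm]
    exact Finset.sum_congr rfl fun p _ => Finset.sum_congr rfl fun q _ => by ring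
  have h3 : ∑ p, christoffel G y p a b * ∑ j, T y p j * grad G f y j
      = ∑ j, ∑ p, christoffel G y p a b * T y p j * grad G f y j := by
    simp only [Finset.mul_sum]
    rw [Finset.sum_comm]
    simp only [mul_assoc]
  have h5 : ∑ j, ∑ p, T y b j * ((G y)⁻¹ j p * hessian G f y a p)
      = tr G y (fun j p => T y b j * hessian G f y a p) :=
    Finset.sum_congr rfl fun j _ => Finset.sum_congr rfl fun p _ => by ring
  rw [h3, ← h5]
  simp only [h1, covDeriv₂, sub_mul, mul_sub, Finset.sum_add_distrib, Finset.sum_sub_distrib,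
    Finset.sum_mul, Finset.mul_sum]
  rw [h2]
  ring

/-- This is dQ = 2 Ddu(∇u, ·), which lets the soliton equation express r(∇u, ·) through du and dQ.
-/
lemma partialDeriv_gradInner_self (hG : IsMetricOn G U) (hy : y ∈ U) (hf : ContDiffAt ℝ ∞ f y)
    (m : Fin n) :
    partialDeriv m (gradInner G f f) y = 2 * ∑ j, hessian G f y m j * grad G f y j := by
  have hd := fun a => contDiffAt_partialDeriv a hf
  have h2 := hG.partialDeriv_tr hy (T := fun z a b => partialDeriv a f z * partialDeriv b f z)
    (fun a b => (hd a).mul (hd b)) m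
  have h3 : partialDeriv m (gradInner G f f) y
      = partialDeriv m (fun z => tr G z (fun a b => partialDeriv a f z * partialDeriv b f z)) y :=
    rfl
  have h4 : (covDeriv₂ G (fun z a b => partialDeriv a f z * partialDeriv b f z) y m)
      = fun a b => hessian G f y m a * partialDeriv b f y
        + partialDeriv a f y * hessian G f y m b := by
    funext a b
    exact covDeriv₂_du_mul_du hf m a b
  have h5 : tr G y (fun a b => hessian G f y m a * partialDeriv b f y)
      = ∑ j, hessian G f y m j * grad G f y j := by
    rw [← hG.tr_swap hy, ← hG.tr_partialDeriv_mul hy]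
    simp only [mul_comm]
  rw [h3, h2, h4, tr_add, h5, hG.tr_partialDeriv_mul hy]
  ring

/-- The Ricci identity for the third covariant derivatives of a function. -/
lemma covDeriv_hessian_comm (hG : IsMetricOn G U) (hy : y ∈ U) (hf : ContDiffAt ℝ ∞ f y)
    (i j k : Fin n) :
    covDeriv₂ G (hessian G f) y i j k - covDeriv₂ G (hessian G f) y j i k
      = ∑ l, riemann G y i j k l * grad G f y l := by
  -- Antisymmetry in the last pair puts the gradient into the slot whose index was lowered, where
  -- lowering it back gives df.
  have hR : ∑ l, riemann G y i j k l * grad G f y l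
      = - ∑ m, curvatureUp G y m i j k * partialDeriv m f y := by
    have : ∀ l, riemann G y i j k l * grad G f y l
        = - ∑ m, curvatureUp G y m i j k * (G y m l * grad G f y l) := by
      intro l
      rw [hG.riemann_antisymm_right hy, riemann, neg_mul, Finset.sum_mul]
      congr 1
      exact Finset.sum_congr rfl fun m _ => by rw [hG.symm hy l m]; ring
    simp only [this, Finset.sum_neg_distrib]
    rw [Finset.sum_comm]
    simp only [← Finset.mul_sum, hG.sum_metric_grad hy]
  have hd := fun a => contDiffAt_partialDeriv a hf
  have h1 : ∀ i j k, partialDeriv i (fun z => hessian G f z j k) y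
      = partialDeriv i (partialDeriv j (partialDeriv k f)) y
        - ∑ p, (partialDeriv i (fun z => christoffel G z p j k) y * partialDeriv p f y
          + christoffel G y p j k * partialDeriv i (partialDeriv p f) y) := by
    intro i j k
    have hs : ∀ p, ContDiffAt ℝ ∞ (fun z => christoffel G z p j k * partialDeriv p f z) y :=
      fun p => (hG.smooth_christoffel hy p j k).mul (hd p)
    unfold hessian
    rw [partialDeriv_sub i (contDiffAt_partialDeriv j (hd k)).diff
      (ContDiffAt.sum fun p _ => hs p).diff, partialDeriv_sum i _ fun p _ => (hs p).diff]
    congr 1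
    exact Finset.sum_congr rfl fun p _ =>
      partialDeriv_mul i (hG.smooth_christoffel hy p j k).diff (hd p).diff
  have h2 : ∀ i j k, ∑ p, christoffel G y p i k * hessian G f y j p
      = ∑ p, christoffel G y p i k * partialDeriv j (partialDeriv p f) y
        - ∑ p, ∑ q, christoffel G y q i k * christoffel G y p j q * partialDeriv p f y := by
    intro i j k
    unfold hessian
    simp only [mul_sub, Finset.sum_sub_distrib, Finset.mul_sum]
    congr 1
    rw [Finset.sum_comm]
    exact Finset.sum_congr rfl fun p _ => Finset.sum_congr rfl fun q _ => by ring
  have h3 : ∑ p, christoffel G y p i j * hessian G f y p k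
      = ∑ p, christoffel G y p j i * hessian G f y p k :=
    Finset.sum_congr rfl fun p _ => by rw [hG.christoffel_symm hy p i j]
  rw [hR]
  unfold covDeriv₂
  rw [h1, h1, h2, h2, h3, partialDeriv_comm i j (hd k)]
  simp only [curvatureUp, add_mul, sub_mul, Finset.sum_add_distrib, Finset.sum_sub_distrib,
    Finset.sum_mul]
  ring

end IsMetricOn

/-! ### Solitons in coordinates -/

/-- The equation of an almost gradient soliton in coordinates, whose signal function `h` is locally
a function of the potential `u` with derivative `k > 0`. -/
structure IsSolitonOn (G : Coord n → Matrix (Fin n) (Fin n) ℝ) (U : Set (Coord n))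
    (u h Λ k : Coord n → ℝ) : Prop where
  metric : IsMetricOn G U
  smooth_u : ∀ y ∈ U, ContDiffAt ℝ ∞ u y
  smooth_h : ∀ y ∈ U, ContDiffAt ℝ ∞ h y
  smooth_soliton : ∀ y ∈ U, ContDiffAt ℝ ∞ Λ y
  h_ne : ∀ y ∈ U, h y ≠ 0
  equation : ∀ y ∈ U, ∀ i j, ricci G y i j + h y * hessian G u y i j = Λ y * G y i j
  partialDeriv_h : ∀ y ∈ U, ∀ i, partialDeriv i h y = k y * partialDeriv i u y
  k_pos : ∀ y ∈ U, 0 < k y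

/-- The one-form `r(∇u, ·)`. -/
def ricciGrad (G : Coord n → Matrix (Fin n) (Fin n) ℝ) (u : Coord n → ℝ) (y : Coord n)
    (i : Fin n) : ℝ := ∑ l, ricci G y i l * grad G u y l

/-- The one-form that makes `solitonTensor` trace free. -/
def solitonForm (G : Coord n → Matrix (Fin n) (Fin n) ℝ) (u : Coord n → ℝ) (y : Coord n)
    (i : Fin n) : ℝ :=
  1 / ((n : ℝ) - 1) * (ricciGrad G u y i - scalar G y * partialDeriv i u y)

/-- The trace free part of `du ∧ r`. -/
def solitonTensor (G : Coord n → Matrix (Fin n) (Fin n) ℝ) (u : Coord n → ℝ) (y : Coord n)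
    (i j k : Fin n) : ℝ :=
  partialDeriv i u y * ricci G y j k - partialDeriv j u y * ricci G y i k
    + solitonForm G u y i * G y j k - solitonForm G u y j * G y i k

/-- The coefficient of `solitonTensor` in the Cotton tensor of a soliton. -/
def solitonCoeff (n : ℕ) (h k : ℝ) : ℝ := k / h + h / ((n : ℝ) - 2)

lemma solitonTensor_antisymm (G : Coord n → Matrix (Fin n) (Fin n) ℝ) (u : Coord n → ℝ)
    (y : Coord n) (i j k : Fin n) :
    solitonTensor G u y i j k = - solitonTensor G u y j i k := by
  unfold solitonTensor
  ring

namespace IsMetricOn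

variable {G : Coord n → Matrix (Fin n) (Fin n) ℝ} {U : Set (Coord n)} {y : Coord n}

/-- A term of the form θ ∧ g is determined by its trace; one-forms such as those in C and T are
identified this way. -/
lemma tr_wedge_metric (hG : IsMetricOn G U) (hy : y ∈ U) (θ : Fin n → ℝ) (i : Fin n) :
    tr G y (fun j k => θ i * G y j k - θ j * G y i k) = ((n : ℝ) - 1) * θ i := by
  have t : tr G y (fun j k => θ j * G y i k) = θ i := by
    simp only [hG.symm hy i, mul_comm (θ _)]
    exact hG.tr_metric_mul' hy i _
  rw [tr_sub, hG.tr_const_mul_metric hy, t]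
  ring

lemma tr_wedge_ricci (hG : IsMetricOn G U) (hy : y ∈ U) (u : Coord n → ℝ) (i : Fin n) :
    tr G y (fun j k => partialDeriv i u y * ricci G y j k - partialDeriv j u y * ricci G y i k)
      = partialDeriv i u y * scalar G y - ricciGrad G u y i := by
  have t : tr G y (fun j k => partialDeriv i u y * ricci G y j k)
      = partialDeriv i u y * scalar G y := tr_const_mul _ _ _ _
  rw [tr_sub, t, hG.tr_partialDeriv_mul hy]
  rfl

lemma tr_solitonTensor (hn : 3 ≤ n) (hG : IsMetricOn G U) (hy : y ∈ U) (u : Coord n → ℝ)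
    (i : Fin n) : tr G y (fun j k => solitonTensor G u y i j k) = 0 := by
  have hn' : (3 : ℝ) ≤ n := by exact_mod_cast hn
  have h1 : (n : ℝ) - 1 ≠ 0 := by linarith
  have h : (fun j k => solitonTensor G u y i j k) = fun j k =>
      (partialDeriv i u y * ricci G y j k - partialDeriv j u y * ricci G y i k)
      + (solitonForm G u y i * G y j k - solitonForm G u y j * G y i k) := by
    funext j k
    unfold solitonTensor
    ring
  rw [h, tr_add, hG.tr_wedge_ricci hy, hG.tr_wedge_metric hy]
  unfold solitonForm
  field_simp
  ring

lemma solitonTensor_contract (hG : IsMetricOn G U) (hy : y ∈ U) (u : Coord n → ℝ)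
    (b i : Fin n) : ∑ j, solitonTensor G u y b i j * grad G u y j
      = partialDeriv b u y * ricciGrad G u y i - partialDeriv i u y * ricciGrad G u y b
        + solitonForm G u y b * partialDeriv i u y
        - solitonForm G u y i * partialDeriv b u y := by
  simp only [solitonTensor, add_mul, sub_mul, Finset.sum_add_distrib, Finset.sum_sub_distrib,
    mul_assoc, ← Finset.mul_sum, hG.sum_metric_grad hy]
  rfl

end IsMetricOn

namespace IsSolitonOn

variable {G : Coord n → Matrix (Fin n) (Fin n) ℝ} {U : Set (Coord n)} {y : Coord n}
  {u h Λ k : Coord n → ℝ}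

lemma hessian_eq (S : IsSolitonOn G U u h Λ k) (hy : y ∈ U) (i j : Fin n) :
    hessian G u y i j = (Λ y * G y i j - ricci G y i j) / h y := by
  rw [eq_div_iff (S.h_ne y hy), ← S.equation y hy]
  ring

/-- Differentiate r = Λ g - h Ddu. The function k enters only pointwise through dh = k du and is
never differentiated. -/
lemma covDeriv_ricci (S : IsSolitonOn G U u h Λ k) (hy : y ∈ U) (m i j : Fin n) :
    covDeriv₂ G (ricci G) y m i j = partialDeriv m Λ y * G y i j
      - k y * partialDeriv m u y * hessian G u y i j
      - h y * covDeriv₂ G (hessian G u) y m i j := by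
  have hG := S.metric
  have e : ricci G =ᶠ[𝓝 y] fun z i j => Λ z * G z i j - h z * hessian G u z i j := by
    filter_upwards [hG.mem_nhds hy] with z hz
    funext i j
    linarith [S.equation z hz i j]
  have hg := hG.smooth y hy
  have hh := hG.smooth_hessian hy (S.smooth_u y hy)
  have e1 := covDeriv₂_congr (G := G) e m i j
  have e2 := covDeriv₂_sub (G := G) (S := fun z i j => Λ z * G z i j)
    (T := fun z i j => h z * hessian G u z i j)
    (fun a b => (S.smooth_soliton y hy).mul (hg a b)) (fun a b => (S.smooth_h y hy).mul (hh a b))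
    m i j
  have e3 := covDeriv₂_mul (G := G) (T := G) (S.smooth_soliton y hy) hg m i j
  have e4 := covDeriv₂_mul (G := G) (T := hessian G u) (S.smooth_h y hy) hh m i j
  rw [hG.covDeriv_metric hy, mul_zero, add_zero] at e3
  rw [e1, e2, e3, e4, S.partialDeriv_h y hy]
  ring

/-- The Cotton tensor of a soliton. -/
lemma cotton_eq (hn : 3 ≤ n) (S : IsSolitonOn G U u h Λ k) (hy : y ∈ U) (i j l : Fin n) :
    cotton G y i j l = - h y * ∑ m, weyl G y i j l m * grad G u y m
      + solitonCoeff n (h y) (k y) * solitonTensor G u y i j l := by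
  have hG := S.metric
  have hn' : (3 : ℝ) ≤ n := by exact_mod_cast hn
  have h1 : (n : ℝ) - 1 ≠ 0 := by linarith
  have h2 : (n : ℝ) - 2 ≠ 0 := by linarith
  have hh := S.h_ne y hy
  set P : Fin n → ℝ := fun i => ∑ m, schouten G y i m * grad G u y m with hP
  -- All terms containing the metric are collected in θ ∧ g. The derivatives of Λ and of the scalar
  -- curvature occur only here.
  set θ : Fin n → ℝ := fun i => partialDeriv i Λ y - k y * Λ y / h y * partialDeriv i u y
    + h y * P i - h y * scalar G y / (2 * (n - 1) * (n - 2)) * partialDeriv i u y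
    - 1 / (2 * (n - 1)) * partialDeriv i (scalar G) y with hθ
  have hKN : ∀ i j l, ∑ m, kulkarniNomizu (schouten G y) (G y) i j l m * grad G u y m
      = schouten G y i l * partialDeriv j u y + P j * G y i l - P i * G y j l
        - schouten G y j l * partialDeriv i u y := by
    intro i j l
    rw [← hG.sum_metric_grad (f := u) hy j, ← hG.sum_metric_grad (f := u) hy i]
    simp only [hP, kulkarniNomizu, Finset.mul_sum, Finset.sum_mul, ← Finset.sum_add_distrib,
      ← Finset.sum_sub_distrib]
    exact Finset.sum_congr rfl fun m _ => by ring
  have key : ∀ i j l, cotton G y i j l = - h y * ∑ m, weyl G y i j l m * grad G u y m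
      + solitonCoeff n (h y) (k y) *
        (partialDeriv i u y * ricci G y j l - partialDeriv j u y * ricci G y i l)
      + (θ i * G y j l - θ j * G y i l) := by
    intro i j l
    have hW : ∑ m, weyl G y i j l m * grad G u y m
        = (covDeriv₂ G (hessian G u) y i j l - covDeriv₂ G (hessian G u) y j i l)
          - ∑ m, kulkarniNomizu (schouten G y) (G y) i j l m * grad G u y m := by
      rw [hG.covDeriv_hessian_comm hy (S.smooth_u y hy), ← Finset.sum_sub_distrib]
      exact Finset.sum_congr rfl fun m _ => by rw [weyl_eq hn]; ring
    rw [hW, hKN, cotton, S.covDeriv_ricci hy, S.covDeriv_ricci hy, S.hessian_eq hy,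
      S.hessian_eq hy]
    simp only [hθ, schouten, solitonCoeff]
    field_simp
    ring
  have hθ' : ∀ i, θ i = solitonCoeff n (h y) (k y) * solitonForm G u y i := by
    intro i
    -- C and W have zero trace, so tracing `key` solves for θ and shows that it completes du ∧ r to
    -- the trace-free tensor T.
    have htr : ((n : ℝ) - 1) * θ i
        = - solitonCoeff n (h y) (k y) *
          (partialDeriv i u y * scalar G y - ricciGrad G u y i) := by
      have h0 := hG.tr_cotton hn hy i
      simp only [key] at h0
      have t : tr G y (fun j l => ∑ m, weyl G y i j l m * grad G u y m) = 0 := by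
        simp only [tr_sum, tr_mul_const, hG.tr_weyl hn hy, zero_mul, Finset.sum_const_zero]
      rw [tr_add, tr_add, tr_const_mul, t, tr_const_mul, hG.tr_wedge_ricci hy,
        hG.tr_wedge_metric hy] at h0
      linarith
    unfold solitonForm
    field_simp
    linarith
  rw [key, hθ', hθ', solitonTensor]
  ring

/-- `C(·, ∇u, ∇u)`. -/
def cottonFlux (G : Coord n → Matrix (Fin n) (Fin n) ℝ) (u : Coord n → ℝ) (y : Coord n)
    (b : Fin n) : ℝ := ∑ i, (∑ j, cotton G y b i j * grad G u y j) * grad G u y i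

/-- An expression for `C(·, ∇u, ∇u)` in first derivatives of `u`, `h` and `|∇u|²`. -/
lemma cottonFlux_eq (hn : 3 ≤ n) (S : IsSolitonOn G U u h Λ k) (hy : y ∈ U) (b : Fin n) :
    cottonFlux G u y b = 1 / (2 * ((n : ℝ) - 1)) *
      (h y ^ 2 * (gradInner G u u y * partialDeriv b (gradInner G u u) y
          - gradInner G u (gradInner G u u) y * partialDeriv b u y)
        + ((n : ℝ) - 2) * (gradInner G u h y * partialDeriv b (gradInner G u u) y
          - gradInner G u (gradInner G u u) y * partialDeriv b h y)) := by
  have hG := S.metric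
  have hn' : (3 : ℝ) ≤ n := by exact_mod_cast hn
  have h1 : (n : ℝ) - 1 ≠ 0 := by linarith
  have h2 : (n : ℝ) - 2 ≠ 0 := by linarith
  have hh := S.h_ne y hy
  set X := grad G u y with hX
  set Q := gradInner G u u y with hQ
  have hQ' : Q = ∑ i, partialDeriv i u y * X i := hG.gradInner_eq hy
  set ρ : ℝ := ∑ i, ricciGrad G u y i * X i with hρ
  -- Two gradients are inserted into an antisymmetric pair of slots.
  have hWXX : ∑ i, (∑ j, (∑ m, weyl G y b i j m * X m) * X j) * X i = 0 := by
    refine Finset.sum_eq_zero fun i _ => ?_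
    have : ∑ j, (∑ m, weyl G y b i j m * X m) * X j = 0 := by
      have e : ∑ j, (∑ m, weyl G y b i j m * X m) * X j
          = - ∑ j, (∑ m, weyl G y b i j m * X m) * X j := by
        conv_rhs => rw [← Finset.sum_neg_distrib]
        simp only [Finset.sum_mul, ← Finset.sum_neg_distrib]
        rw [Finset.sum_comm]
        refine Finset.sum_congr rfl fun j _ => Finset.sum_congr rfl fun m _ => ?_
        rw [hG.weyl_antisymm_right hy b i m j]
        ring
      linarith
    rw [this, zero_mul]
  have hTX : ∀ i, ∑ j, solitonTensor G u y b i j * X j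
      = partialDeriv b u y * ricciGrad G u y i - partialDeriv i u y * ricciGrad G u y b
        + solitonForm G u y b * partialDeriv i u y - solitonForm G u y i * partialDeriv b u y :=
    fun i => hG.solitonTensor_contract hy u b i
  have hform : ∑ i, solitonForm G u y i * X i = 1 / ((n : ℝ) - 1) * (ρ - scalar G y * Q) := by
    rw [hQ', hρ]
    simp only [solitonForm, Finset.mul_sum, ← Finset.sum_sub_distrib]
    exact Finset.sum_congr rfl fun m _ => by ring
  have hTXX : ∑ i, (∑ j, solitonTensor G u y b i j * X j) * X i
      = (n - 2) / (n - 1) * (partialDeriv b u y * ρ - Q * ricciGrad G u y b) := by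
    have e : ∑ i, (∑ j, solitonTensor G u y b i j * X j) * X i
        = partialDeriv b u y * ρ - Q * ricciGrad G u y b + solitonForm G u y b * Q
          - (∑ i, solitonForm G u y i * X i) * partialDeriv b u y := by
      rw [hQ', hρ]
      simp only [hTX, Finset.mul_sum, Finset.sum_mul, ← Finset.sum_add_distrib,
        ← Finset.sum_sub_distrib]
      exact Finset.sum_congr rfl fun m _ => by ring
    rw [e, hform, solitonForm]
    field_simp
    ring
  have hV : cottonFlux G u y b = solitonCoeff n (h y) (k y) * ((n - 2) / (n - 1) *
      (partialDeriv b u y * ρ - Q * ricciGrad G u y b)) := by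
    have e : cottonFlux G u y b
        = - h y * ∑ i, (∑ j, (∑ m, weyl G y b i j m * X m) * X j) * X i
          + solitonCoeff n (h y) (k y) * ∑ i, (∑ j, solitonTensor G u y b i j * X j) * X i := by
      simp only [cottonFlux, S.cotton_eq hn hy, add_mul, Finset.sum_add_distrib, mul_assoc,
        ← Finset.mul_sum, ← hX]
    rw [e, hWXX, hTXX]
    ring
  have hQd : ∀ i, ricciGrad G u y i
      = Λ y * partialDeriv i u y - h y / 2 * partialDeriv i (gradInner G u u) y := by
    intro i
    rw [hG.partialDeriv_gradInner_self hy (S.smooth_u y hy), ← hG.sum_metric_grad (f := u) hy i]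
    simp only [ricciGrad, S.hessian_eq hy, Finset.mul_sum, ← Finset.sum_sub_distrib]
    exact Finset.sum_congr rfl fun m _ => by field_simp; ring
  have hρ' : ρ = Λ y * Q - h y / 2 * gradInner G u (gradInner G u u) y := by
    rw [hQ', hρ, hG.gradInner_eq (f₁ := u) (f₂ := gradInner G u u) hy]
    simp only [hQd, Finset.mul_sum, ← Finset.sum_sub_distrib]
    exact Finset.sum_congr rfl fun m _ => by ring
  -- This and dh = k du let the final expression absorb k into ⟨∇u, ∇h⟩ and dh, leaving only first
  -- derivatives of globally smooth functions.
  have hk : gradInner G u h y = k y * Q := by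
    rw [hQ', hG.gradInner_eq hy]
    simp only [S.partialDeriv_h y hy, Finset.mul_sum]
    exact Finset.sum_congr rfl fun m _ => by ring
  rw [hV, hQd, hρ', hk, S.partialDeriv_h y hy, solitonCoeff]
  field_simp
  ring

end IsSolitonOn

/-! ### Norms of tensors and the divergence of C(·, ∇u, ∇u) -/

/-- The squared norm of a covariant 3-tensor. -/
def normSq₃ (G : Coord n → Matrix (Fin n) (Fin n) ℝ) (y : Coord n)
    (T : Fin n → Fin n → Fin n → ℝ) : ℝ :=
  tr G y (fun a d => tr G y (fun b e => tr G y (fun c f => T a b c * T d e f)))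

namespace IsMetricOn

variable {G : Coord n → Matrix (Fin n) (Fin n) ℝ} {U : Set (Coord n)} {y : Coord n}

/-- Relabelling both contracted pairs; it compares a full contraction of a symmetric with an
antisymmetric tensor to its own negative. -/
lemma tr_tr_reverse (hG : IsMetricOn G U) (hy : y ∈ U) (F : Fin n → Fin n → Fin n → Fin n → ℝ) :
    tr G y (fun a b => tr G y (fun i p => F p i b a))
      = tr G y (fun a b => tr G y (fun i p => F a b i p)) :=
  calc _ = tr G y (fun i p => tr G y (fun a b => F p i b a)) := tr_comm G y _
    _ = tr G y (fun i p => tr G y (fun a b => F p i a b)) :=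
        congrArg _ (funext fun i => funext fun p => hG.tr_swap hy (fun a b => F p i a b))
    _ = _ := hG.tr_swap hy (fun p i => tr G y (fun a b => F p i a b))

-- The positive inverse metric factors as `Bᵀ * B`. The rows of `B` form an orthonormal frame,
-- turning metric traces into sums over a frame.
open scoped MatrixOrder Matrix.Norms.L2Operator in
lemma exists_frame (hG : IsMetricOn G U) (hy : y ∈ U) :
    ∃ B : Matrix (Fin n) (Fin n) ℝ, (∀ T, tr G y T = ∑ p, ∑ a, ∑ b, B p a * B p b * T a b) ∧
      IsUnit B.det := by
  obtain ⟨B, hB⟩ := CStarAlgebra.nonneg_iff_eq_star_mul_self.mp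
    (hG.posDef y hy).inv.posSemidef.nonneg
  rw [Matrix.star_eq_conjTranspose, Matrix.conjTranspose_eq_transpose_of_trivial] at hB
  refine ⟨B, fun T => ?_, ?_⟩
  · unfold tr
    rw [hB]
    simp only [Matrix.mul_apply, Matrix.transpose_apply, Finset.sum_mul]
    calc _ = ∑ a, ∑ p, ∑ b, B p a * B p b * T a b :=
          Finset.sum_congr rfl fun a _ => Finset.sum_comm
      _ = _ := Finset.sum_comm
  · have h : (G y)⁻¹.det = B.det * B.det := by
      rw [hB, Matrix.det_mul, Matrix.det_transpose]
    have h2 : (G y)⁻¹.det ≠ 0 := (hG.posDef y hy).inv.det_pos.ne'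
    rw [h] at h2
    exact (left_ne_zero_of_mul h2).isUnit

lemma eq_zero_of_contract_eq_zero {B : Matrix (Fin n) (Fin n) ℝ} (hB : IsUnit B.det)
    {X : Fin n → ℝ} (h : ∀ p, ∑ a, B p a * X a = 0) : X = 0 := by
  have h1 : B *ᵥ X = 0 := funext h
  have h2 : B⁻¹ *ᵥ (B *ᵥ X) = X := by
    rw [Matrix.mulVec_mulVec, Matrix.nonsing_inv_mul _ hB, Matrix.one_mulVec]
  rw [← h2, h1, Matrix.mulVec_zero]

/-- In an orthonormal frame the norm is a sum of squares of components, which gives both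
nonnegativity and definiteness. -/
lemma normSq₃_eq_sum (hG : IsMetricOn G U) (hy : y ∈ U) :
    ∃ B : Matrix (Fin n) (Fin n) ℝ, IsUnit B.det ∧ ∀ T, normSq₃ G y T
      = ∑ r, ∑ q, ∑ p, (∑ a, B p a * ∑ b, B q b * ∑ c, B r c * T a b c) ^ 2 := by
  obtain ⟨B, hB, hdet⟩ := hG.exists_frame hy
  refine ⟨B, hdet, fun T => ?_⟩
  have h1 : ∀ f g : Fin n → ℝ, tr G y (fun a b => f a * g b)
      = ∑ p, (∑ a, B p a * f a) * (∑ b, B p b * g b) := by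
    intro f g
    rw [hB]
    refine Finset.sum_congr rfl fun p _ => ?_
    rw [Finset.sum_mul_sum]
    exact Finset.sum_congr rfl fun a _ => Finset.sum_congr rfl fun b _ => by ring
  simp only [normSq₃, h1, tr_sum, sq]

lemma normSq₃_nonneg (hG : IsMetricOn G U) (hy : y ∈ U) (T : Fin n → Fin n → Fin n → ℝ) :
    0 ≤ normSq₃ G y T := by
  obtain ⟨B, -, hB⟩ := hG.normSq₃_eq_sum hy
  rw [hB]
  positivity

lemma eq_zero_of_normSq₃_eq_zero (hG : IsMetricOn G U) (hy : y ∈ U)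
    {T : Fin n → Fin n → Fin n → ℝ} (h : normSq₃ G y T = 0) (a b c : Fin n) : T a b c = 0 := by
  obtain ⟨B, hdet, hB⟩ := hG.normSq₃_eq_sum hy
  rw [hB] at h
  have h0 : ∀ p q r, ∑ a, B p a * ∑ b, B q b * ∑ c, B r c * T a b c = 0 := by
    intro p q r
    have h1 := (Finset.sum_eq_zero_iff_of_nonneg (fun p _ => by positivity)).mp h r
      (Finset.mem_univ r)
    have h2 := (Finset.sum_eq_zero_iff_of_nonneg (fun q _ => by positivity)).mp h1 q
      (Finset.mem_univ q)
    have h3 := (Finset.sum_eq_zero_iff_of_nonneg (fun r _ => by positivity)).mp h2 p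
      (Finset.mem_univ p)
    exact pow_eq_zero_iff (two_ne_zero) |>.mp h3
  have h1 : ∀ a q r, ∑ b, B q b * ∑ c, B r c * T a b c = 0 := fun a q r =>
    congrFun (eq_zero_of_contract_eq_zero hdet fun p => h0 p q r) a
  have h2 : ∀ a b r, ∑ c, B r c * T a b c = 0 := fun a b r =>
    congrFun (eq_zero_of_contract_eq_zero hdet fun q => h1 a q r) b
  exact congrFun (eq_zero_of_contract_eq_zero hdet fun r => h2 a b r) c

/-- T is trace-free, so in ⟨T, T⟩ the metric terms of the second factor contribute nothing and it
may be replaced by du ∧ r. Antisymmetry makes the two remaining terms equal; the minus sign comes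
from moving ∇u to the second slot. -/
lemma normSq₃_solitonTensor (hn : 3 ≤ n) (hG : IsMetricOn G U) (hy : y ∈ U) (u : Coord n → ℝ) :
    normSq₃ G y (solitonTensor G u y) = - 2 * ∑ i, tr G y (fun a c => tr G y (fun b d =>
      solitonTensor G u y a i b * ricci G y c d)) * grad G u y i := by
  set T := solitonTensor G u y with hT
  have hanti : ∀ i j k, T i j k = - T j i k := solitonTensor_antisymm G u y
  have htr : ∀ i, tr G y (fun j k => T i j k) = 0 := hG.tr_solitonTensor hn hy u
  have htr' : ∀ j, tr G y (fun i k => T i j k) = 0 := by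
    intro j
    simp only [hanti _ j, tr_neg, htr, neg_zero]
  have hcon : ∀ a b d, tr G y (fun c f => T a b c * G y d f) = T a b d := by
    intro a b d
    simp only [hG.symm hy d, mul_comm (T a b _)]
    exact hG.tr_metric_mul' hy d fun c => T a b c
  have h1 : ∀ a b d e, tr G y (fun c f => T a b c * T d e f)
      = partialDeriv d u y * tr G y (fun c f => T a b c * ricci G y e f)
        - partialDeriv e u y * tr G y (fun c f => T a b c * ricci G y d f)
        + solitonForm G u y d * T a b e - solitonForm G u y e * T a b d := by
    intro a b d e
    rw [← hcon a b e, ← hcon a b d]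
    simp only [← tr_const_mul, ← tr_add, ← tr_sub]
    congr 1
    funext c f
    rw [show T d e f = partialDeriv d u y * ricci G y e f - partialDeriv e u y * ricci G y d f
      + solitonForm G u y d * G y e f - solitonForm G u y e * G y d f from rfl]
    ring
  have h2 : ∀ a d, tr G y (fun b e => tr G y (fun c f => T a b c * T d e f))
      = partialDeriv d u y * tr G y (fun b e => tr G y (fun c f => T a b c * ricci G y e f))
        - tr G y (fun b e =>
            partialDeriv e u y * tr G y (fun c f => T a b c * ricci G y d f))
        - tr G y (fun b e => solitonForm G u y e * T a b d) := by
    intro a d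
    simp only [h1, tr_sub, tr_add, tr_const_mul, htr]
    ring
  have h3 : tr G y (fun a d => tr G y (fun b e => solitonForm G u y e * T a b d)) = 0 := by
    rw [tr_comm]
    simp only [tr_const_mul, htr', mul_zero, tr_zero]
  have h4 : tr G y (fun a d => partialDeriv d u y *
        tr G y (fun b e => tr G y (fun c f => T a b c * ricci G y e f)))
      = - ∑ i, tr G y (fun a c => tr G y (fun b d => T a i b * ricci G y c d)) * grad G u y i := by
    rw [← hG.tr_swap hy, hG.tr_partialDeriv_mul hy, ← Finset.sum_neg_distrib]
    refine Finset.sum_congr rfl fun i _ => ?_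
    simp only [hanti i, neg_mul, tr_neg]
  have h5 : tr G y (fun a d => tr G y (fun b e =>
        partialDeriv e u y * tr G y (fun c f => T a b c * ricci G y d f)))
      = ∑ i, tr G y (fun a c => tr G y (fun b d => T a i b * ricci G y c d)) * grad G u y i := by
    rw [tr_comm]
    simp only [tr_const_mul]
    rw [← hG.tr_swap hy, hG.tr_partialDeriv_mul hy]
  unfold normSq₃
  simp only [h2, tr_sub]
  rw [h3, h4, h5]
  ring

end IsMetricOn

namespace IsSolitonOn

variable {G : Coord n → Matrix (Fin n) (Fin n) ℝ} {U : Set (Coord n)} {y : Coord n}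
  {u h Λ k : Coord n → ℝ}

/-- W is trace-free, so subtracting a multiple of g from the Ricci tensor does not change the
contraction. -/
lemma weylActionZ_eq (hn : 3 ≤ n) (hG : IsMetricOn G U) (hy : y ∈ U) (i j : Fin n) :
    weylActionZ G y i j
      = tr G y (fun a c => tr G y (fun b d => weyl G y i a j b * ricci G y c d)) := by
  have h1 : weylActionZ G y i j
      = tr G y (fun a c => tr G y (fun b d => weyl G y i a j b * tracelessRicci G y c d)) := by
    unfold weylActionZ tr
    refine Finset.sum_congr rfl fun a _ => ?_
    rw [Finset.sum_comm]
    refine Finset.sum_congr rfl fun c _ => ?_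
    rw [Finset.mul_sum]
    refine Finset.sum_congr rfl fun b _ => ?_
    rw [Finset.mul_sum]
    exact Finset.sum_congr rfl fun d _ => by ring
  have h2 : ∀ a c, tr G y (fun b d => weyl G y i a j b * G y c d) = weyl G y i a j c := by
    intro a c
    simp only [hG.symm hy c, mul_comm (weyl G y i a j _)]
    exact hG.tr_metric_mul' hy c fun b => weyl G y i a j b
  have h3 : tr G y (fun a c => tr G y (fun b d => scalar G y / n * (weyl G y i a j b * G y c d)))
      = 0 := by
    have h4 : tr G y (fun a c => weyl G y i a j c) = 0 := by
      rw [← neg_eq_zero, ← tr_neg, ← hG.tr_weyl hn hy i j]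
      congr 1
      funext a c
      rw [hG.weyl_antisymm_right hy i a j c, neg_neg]
    simp only [tr_const_mul, h2, h4, mul_zero]
  rw [h1, ← sub_zero (tr G y fun a c => tr G y fun b d => weyl G y i a j b * ricci G y c d), ← h3]
  simp only [← tr_sub]
  congr 1
  funext a c
  congr 1
  funext b d
  unfold tracelessRicci
  ring

/-- The divergence of `C(·, ∇u, ∇u)` on a Bach flat soliton. -/
lemma div_cottonFlux (hn : 4 ≤ n) (S : IsSolitonOn G U u h Λ k)
    (hB : ∀ y ∈ U, ∀ i j, bach G y i j = 0) (hy : y ∈ U) :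
    tr G y (covDeriv₁ G (cottonFlux G u) y)
      = solitonCoeff n (h y) (k y) / (2 * h y) * normSq₃ G y (solitonTensor G u y) := by
  have hG := S.metric
  have hn3 : 3 ≤ n := by omega
  have hn' : (4 : ℝ) ≤ n := by exact_mod_cast hn
  have hn2 : (n : ℝ) - 2 ≠ 0 := by linarith
  have hu := S.smooth_u y hy
  have hh := S.h_ne y hy
  have hC := hG.smooth_cotton hy
  have hX := hG.smooth_grad hy hu
  set X := grad G u y with hXdef
  have hsym : ∀ a p, hessian G u y a p = hessian G u y p a := hG.hessian_symm hy hu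
  have hS : ∀ i j, ContDiffAt ℝ ∞ (fun z => ∑ l, cotton G z i j l * grad G u z l) y :=
    fun i j => ContDiffAt.sum fun l _ => (hC i j l).mul (hX l)
  have e1 : ∀ a b, covDeriv₁ G (cottonFlux G u) y a b
      = ∑ i, (∑ j, covDeriv₃ G (cotton G) y a b i j * X j) * X i
        + ∑ i, tr G y (fun j p => cotton G y b i j * hessian G u y a p) * X i
        + tr G y (fun i p => (∑ j, cotton G y b i j * X j) * hessian G u y a p) := by
    intro a b
    have := hG.covDeriv₁_contract_grad hy hu
      (T := fun z b i => ∑ j, cotton G z b i j * grad G u z j) hS a b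
    refine this.trans ?_
    rw [← Finset.sum_add_distrib]
    congr 1
    refine Finset.sum_congr rfl fun i _ => ?_
    rw [hG.covDeriv₂_contract_grad hy hu hC]
    ring
  -- Bach-flatness enters here: it replaces the divergence of C by minus the Weyl action.
  have t1 : tr G y (fun a b => ∑ i, (∑ j, covDeriv₃ G (cotton G) y a b i j * X j) * X i)
      = - ∑ i, (∑ j, tr G y (fun a c => tr G y (fun b d =>
          weyl G y i a j b * ricci G y c d)) * X j) * X i := by
    simp only [tr_sum, tr_mul_const]
    rw [← Finset.sum_neg_distrib]
    refine Finset.sum_congr rfl fun i _ => ?_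
    rw [← neg_mul, ← Finset.sum_neg_distrib]
    congr 1
    refine Finset.sum_congr rfl fun j _ => ?_
    have hb := hB y hy i j
    rw [hG.bach_eq hn hy, weylActionZ_eq hn3 hG hy] at hb
    have := (mul_eq_zero.mp hb).resolve_left (one_div_ne_zero hn2)
    rw [eq_neg_of_add_eq_zero_left this, neg_mul]
  -- The antisymmetric pair of C is contracted with the symmetric Hessian.
  have t3 : tr G y (fun a b => tr G y (fun i p =>
      (∑ j, cotton G y b i j * X j) * hessian G u y a p)) = 0 := by
    set A : Fin n → Fin n → ℝ := fun b i => ∑ j, cotton G y b i j * X j with hA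
    have hAa : ∀ b i, A b i = - A i b := by
      intro b i
      simp only [hA, ← Finset.sum_neg_distrib]
      exact Finset.sum_congr rfl fun j _ => by rw [IsMetricOn.cotton_antisymm]; ring
    have : tr G y (fun a b => tr G y (fun i p => A b i * hessian G u y a p))
        = - tr G y (fun a b => tr G y (fun i p => A b i * hessian G u y a p)) := by
      refine (hG.tr_tr_reverse hy (fun a b i p => A b i * hessian G u y a p)).symm.trans ?_
      rw [← tr_neg]
      congr 1
      funext a b
      rw [← tr_neg]
      congr 1
      funext i p
      rw [hAa i b, hsym p a]
      ring
    linarith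
  -- Substitute Ddu = (Λ g - r)/h; the g part drops out because C is trace-free.
  have t2 : ∀ i, tr G y (fun a b => tr G y (fun j p => cotton G y b i j * hessian G u y a p))
      = - (1 / h y) * tr G y (fun a c => tr G y (fun b d =>
        cotton G y a i b * ricci G y c d)) := by
    intro i
    have c1 : ∀ a b, tr G y (fun j p => cotton G y b i j * hessian G u y a p)
        = Λ y / h y * cotton G y b i a
          - 1 / h y * tr G y (fun j p => cotton G y b i j * ricci G y a p) := by
      intro a b
      have : tr G y (fun j p => cotton G y b i j * G y a p) = cotton G y b i a := by
        simp only [hG.symm hy a, mul_comm (cotton G y b i _)]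
        exact hG.tr_metric_mul' hy a fun j => cotton G y b i j
      rw [← this, ← tr_const_mul, ← tr_const_mul, ← tr_sub]
      congr 1
      funext j p
      rw [S.hessian_eq hy]
      field_simp
    have c2 : tr G y (fun a b => cotton G y b i a) = 0 := by
      rw [hG.tr_swap hy (fun a b => cotton G y a i b)]
      simp only [IsMetricOn.cotton_antisymm G y _ i, tr_neg, hG.tr_cotton hn3 hy, neg_zero]
    simp only [c1, tr_sub, tr_const_mul, c2]
    rw [hG.tr_swap hy (fun a c => tr G y (fun b d => cotton G y a i b * ricci G y c d))]
    ring
  have hWC : ∀ i a b, ∑ j, weyl G y i a j b * X j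
      = 1 / h y * (solitonCoeff n (h y) (k y) * solitonTensor G u y a i b
        - cotton G y a i b) := by
    intro i a b
    have : ∑ j, weyl G y i a j b * X j = ∑ j, weyl G y a i b j * X j :=
      Finset.sum_congr rfl fun j _ => by
        rw [IsMetricOn.weyl_antisymm_left G y i a, hG.weyl_antisymm_right hy a i j b, neg_neg]
    rw [this, S.cotton_eq hn3 hy]
    field_simp
    ring
  have t1' : ∀ i, ∑ j, tr G y (fun a c => tr G y (fun b d =>
        weyl G y i a j b * ricci G y c d)) * X j
      = solitonCoeff n (h y) (k y) / h y * tr G y (fun a c => tr G y (fun b d =>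
          solitonTensor G u y a i b * ricci G y c d))
        - 1 / h y * tr G y (fun a c => tr G y (fun b d => cotton G y a i b * ricci G y c d)) := by
    intro i
    simp only [← tr_mul_const, ← tr_const_mul, ← tr_sum, ← tr_sub]
    congr 1
    funext a c
    congr 1
    funext b d
    have : ∑ j, weyl G y i a j b * ricci G y c d * X j
        = (∑ j, weyl G y i a j b * X j) * ricci G y c d := by
      rw [Finset.sum_mul]
      exact Finset.sum_congr rfl fun j _ => by ring
    rw [this, hWC]
    ring
  have t2' : tr G y (fun a b => ∑ i, tr G y (fun j p => cotton G y b i j * hessian G u y a p) * X i)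
      = ∑ i, (- (1 / h y) * tr G y (fun a c => tr G y (fun b d =>
        cotton G y a i b * ricci G y c d))) * X i := by
    simp only [tr_sum, tr_mul_const, t2]
  have hfun : covDeriv₁ G (cottonFlux G u) y = fun a b => _ := funext fun a => funext fun b => e1 a b
  rw [hfun, tr_add, tr_add, t1, t2', t3, hG.normSq₃_solitonTensor hn3 hy]
  simp only [t1', Finset.mul_sum, ← Finset.sum_neg_distrib, ← Finset.sum_add_distrib, add_zero]
  refine Finset.sum_congr rfl fun i _ => ?_
  field_simp
  ring

end IsSolitonOn

/-! ### From T = 0 to the vanishing of the Cotton tensor -/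

namespace IsMetricOn

variable {G : Coord n → Matrix (Fin n) (Fin n) ℝ} {U : Set (Coord n)} {y : Coord n}

lemma partialDeriv_eq_zero_of_gradInner_eq_zero (hG : IsMetricOn G U) (hy : y ∈ U)
    {u : Coord n → ℝ} (h : gradInner G u u y = 0) (i : Fin n) : partialDeriv i u y = 0 := by
  obtain ⟨B, hB, hdet⟩ := hG.exists_frame hy
  have h1 : gradInner G u u y = ∑ p, (∑ a, B p a * partialDeriv a u y) ^ 2 := by
    rw [gradInner, hB]
    refine Finset.sum_congr rfl fun p _ => ?_
    rw [sq, Finset.sum_mul_sum]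
    exact Finset.sum_congr rfl fun a _ => Finset.sum_congr rfl fun b _ => by ring
  rw [h1] at h
  refine congrFun (eq_zero_of_contract_eq_zero hdet (X := fun a => partialDeriv a u y)
    fun p => ?_) i
  exact pow_eq_zero_iff (two_ne_zero) |>.mp
    ((Finset.sum_eq_zero_iff_of_nonneg fun p _ => by positivity).mp h p (Finset.mem_univ p))

/-- If `solitonTensor` vanishes where `du ≠ 0`, then the Ricci tensor has two eigenvalues. -/
lemma ricci_eq_of_solitonTensor_eq_zero (hn : 4 ≤ n) (hG : IsMetricOn G U) (hy : y ∈ U)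
    {u : Coord n → ℝ} (hQ : gradInner G u u y ≠ 0)
    (hT : ∀ i j l, solitonTensor G u y i j l = 0) (j l : Fin n) :
    ricci G y j l =
      (scalar G y - (∑ i, ricciGrad G u y i * grad G u y i) / gradInner G u u y) / ((n : ℝ) - 1)
        * G y j l
      + (n * ((∑ i, ricciGrad G u y i * grad G u y i) / gradInner G u u y) - scalar G y)
        / ((n : ℝ) - 1) / gradInner G u u y * (partialDeriv j u y * partialDeriv l u y) := by
  have hn' : (4 : ℝ) ≤ n := by exact_mod_cast hn
  have h1 : (n : ℝ) - 1 ≠ 0 := by linarith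
  have h2 : (n : ℝ) - 2 ≠ 0 := by linarith
  set X := grad G u y with hX
  set Q := gradInner G u u y with hQdef
  set σ := ∑ i, ricciGrad G u y i * X i with hσ
  have hQ' : Q = ∑ i, partialDeriv i u y * X i := hG.gradInner_eq hy
  -- T(·,·,∇u) is a nonzero multiple, involving n - 2, of du ∧ r(∇u,·). Its vanishing makes ∇u an
  -- eigenvector of Ricci, with eigenvalue σ/Q.
  have hcomm : ∀ i j, partialDeriv i u y * ricciGrad G u y j
      = partialDeriv j u y * ricciGrad G u y i := by
    intro i j
    have h := hG.solitonTensor_contract hy u i j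
    simp only [hT, zero_mul, Finset.sum_const_zero, solitonForm] at h
    field_simp at h
    have : ((n : ℝ) - 2) * (partialDeriv i u y * ricciGrad G u y j
      - partialDeriv j u y * ricciGrad G u y i) = 0 := by linarith
    linarith [(mul_eq_zero.mp this).resolve_left h2]
  have hρ : ∀ j, ricciGrad G u y j = σ / Q * partialDeriv j u y := by
    intro j
    have : Q * ricciGrad G u y j = σ * partialDeriv j u y := by
      rw [hQ', hσ, Finset.sum_mul, Finset.sum_mul]
      exact Finset.sum_congr rfl fun i _ => by linear_combination X i * hcomm i j
    field_simp
    linarith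
  have hlow : ∑ i, ricci G y i l * X i = ricciGrad G u y l :=
    Finset.sum_congr rfl fun i _ => by rw [hG.ricci_symm hy i l]
  have hlow' : ∑ i, G y i l * X i = partialDeriv l u y := by
    rw [← hG.sum_metric_grad hy]
    exact Finset.sum_congr rfl fun i _ => by rw [hG.symm hy i l]
  have hform : ∑ i, solitonForm G u y i * X i = 1 / ((n : ℝ) - 1) * (σ - scalar G y * Q) := by
    rw [hQ', hσ]
    simp only [solitonForm, Finset.mul_sum, ← Finset.sum_sub_distrib]
    exact Finset.sum_congr rfl fun m _ => by ring
  -- Contracting the first slot of T = 0 with ∇u produces Q r plus known terms, which can be solved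
  -- for r.
  have hc : Q * ricci G y j l - partialDeriv j u y * ricciGrad G u y l
      + 1 / ((n : ℝ) - 1) * (σ - scalar G y * Q) * G y j l
      - solitonForm G u y j * partialDeriv l u y = 0 := by
    rw [← hform, ← hlow, ← hlow', hQ']
    have : ∑ i, solitonTensor G u y i j l * X i = 0 := by
      simp only [hT, zero_mul, Finset.sum_const_zero]
    rw [← this]
    simp only [solitonTensor, Finset.mul_sum, Finset.sum_mul, ← Finset.sum_add_distrib,
      ← Finset.sum_sub_distrib]
    exact Finset.sum_congr rfl fun m _ => by ring
  simp only [solitonForm, hρ] at hc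
  have hc' : Q * ricci G y j l = partialDeriv j u y * (σ / Q * partialDeriv l u y)
      - 1 / ((n : ℝ) - 1) * (σ - scalar G y * Q) * G y j l
      + 1 / ((n : ℝ) - 1) * (σ / Q * partialDeriv j u y - scalar G y * partialDeriv j u y)
        * partialDeriv l u y := by linarith
  apply mul_left_cancel₀ hQ
  rw [hc']
  field_simp
  ring

end IsMetricOn

namespace IsSolitonOn

variable {G : Coord n → Matrix (Fin n) (Fin n) ℝ} {U : Set (Coord n)} {y : Coord n}
  {u h Λ k : Coord n → ℝ}

/-- If `solitonTensor` vanishes, then so does the Cotton tensor. -/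
lemma cotton_eq_zero (hn : 4 ≤ n) (S : IsSolitonOn G U u h Λ k)
    (hT : ∀ y ∈ U, ∀ i j l, solitonTensor G u y i j l = 0) (hy : y ∈ U) (i j l : Fin n) :
    cotton G y i j l = 0 := by
  have hG := S.metric
  have hn3 : 3 ≤ n := by omega
  have hn' : (4 : ℝ) ≤ n := by exact_mod_cast hn
  have h1 : (n : ℝ) - 1 ≠ 0 := by linarith
  have h2 : (n : ℝ) - 2 ≠ 0 := by linarith
  have hh := S.h_ne y hy
  have hu := S.smooth_u y hy
  have hC : ∀ i j l, cotton G y i j l = - h y * ∑ m, weyl G y i j l m * grad G u y m := by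
    intro i j l
    rw [S.cotton_eq hn3 hy, hT y hy, mul_zero, add_zero]
  -- At critical points of u the formula C = -h W(·,·,·,∇u) already gives zero.
  by_cases hQ : gradInner G u u y = 0
  · have : ∀ m, grad G u y m = 0 := fun m => by
      simp only [grad, hG.partialDeriv_eq_zero_of_gradInner_eq_zero hy hQ, mul_zero,
        Finset.sum_const_zero]
    simp only [hC, this, mul_zero, Finset.sum_const_zero]
  set σ : Coord n → ℝ := fun z => ∑ i, ricciGrad G u z i * grad G u z i with hσ
  set β : Coord n → ℝ := fun z => (scalar G z - σ z / gradInner G u u z) / ((n : ℝ) - 1) with hβ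
  set γ : Coord n → ℝ := fun z => (n * (σ z / gradInner G u u z) - scalar G z)
    / ((n : ℝ) - 1) / gradInner G u u z with hγ
  have hX := hG.smooth_grad hy hu
  have hQs := hG.smooth_gradInner hy hu hu
  have hss := hG.smooth_scalar hy
  have hσs : ContDiffAt ℝ ∞ σ y := ContDiffAt.sum fun i _ =>
    (ContDiffAt.sum fun l _ => (hG.smooth_ricci hy i l).mul (hX l)).mul (hX i)
  have hβs : ContDiffAt ℝ ∞ β y := (hss.sub (hσs.div hQs hQ)).div_const _
  have hγs : ContDiffAt ℝ ∞ γ y :=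
    (((contDiffAt_const.mul (hσs.div hQs hQ)).sub hss).div_const _).div hQs hQ
  -- Q stays nonzero near `y`, so this form of the Ricci tensor holds on a neighbourhood and may be
  -- differentiated.
  have hr : ricci G =ᶠ[𝓝 y] fun z j l => β z * G z j l
      + γ z * (partialDeriv j u z * partialDeriv l u z) := by
    filter_upwards [hG.mem_nhds hy, hQs.continuousAt.eventually_ne hQ] with z hz hQz
    funext j l
    exact hG.ricci_eq_of_solitonTensor_eq_zero hn hz hQz (hT z hz) j l
  have hd := fun a => contDiffAt_partialDeriv a hu
  have hdd : ∀ a b, ContDiffAt ℝ ∞ (fun z => partialDeriv a u z * partialDeriv b u z) y :=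
    fun a b => (hd a).mul (hd b)
  have hDr : ∀ m a b, covDeriv₂ G (ricci G) y m a b = partialDeriv m β y * G y a b
      + (partialDeriv m γ y * (partialDeriv a u y * partialDeriv b u y)
      + γ y * (hessian G u y m a * partialDeriv b u y
        + partialDeriv a u y * hessian G u y m b)) := by
    intro m a b
    have e1 := covDeriv₂_add (G := G) (S := fun z j l => β z * G z j l)
      (T := fun z j l => γ z * (partialDeriv j u z * partialDeriv l u z))
      (fun a b => hβs.mul (hG.smooth y hy a b)) (fun a b => hγs.mul (hdd a b)) m a b
    have e2 := covDeriv₂_mul (G := G) (T := G) hβs (hG.smooth y hy) m a b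
    have e3 := covDeriv₂_mul (G := G)
      (T := fun z j l => partialDeriv j u z * partialDeriv l u z) hγs hdd m a b
    rw [covDeriv₂_congr hr, e1, e2, e3, hG.covDeriv_metric hy, covDeriv₂_du_mul_du hu]
    ring
  have hhess : ∀ a b, hessian G u y a b = ((Λ y - β y) * G y a b
      - γ y * (partialDeriv a u y * partialDeriv b u y)) / h y := by
    intro a b
    have := congrFun (congrFun hr.eq_of_nhds a) b
    rw [S.hessian_eq hy, this]
    ring
  -- In the skew-symmetrisation of ∇r the Hessian is rewritten through g and du ⊗ du, so C is
  -- reduced to η ∧ g + κ ⊗ du with κ = dγ ∧ du.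
  set η : Fin n → ℝ := fun i => partialDeriv i β y - γ y * (Λ y - β y) / h y * partialDeriv i u y
    - 1 / (2 * ((n : ℝ) - 1)) * partialDeriv i (scalar G) y with hη
  set κ : Fin n → Fin n → ℝ := fun i j => partialDeriv i γ y * partialDeriv j u y
    - partialDeriv j γ y * partialDeriv i u y with hκ
  have hform : ∀ i j l, cotton G y i j l = (η i * G y j l - η j * G y i l)
      + κ i j * partialDeriv l u y := by
    intro i j l
    rw [cotton, hDr, hDr, hG.hessian_symm hy hu j i, hhess, hhess, hhess]
    simp only [hη, hκ]
    field_simp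
    ring
  have htr : ∀ i, ((n : ℝ) - 1) * η i + (partialDeriv i γ y * gradInner G u u y
      - gradInner G u γ y * partialDeriv i u y) = 0 := by
    intro i
    have h0 := hG.tr_cotton hn3 hy i
    have t : tr G y (fun j l => κ i j * partialDeriv l u y)
        = partialDeriv i γ y * gradInner G u u y - gradInner G u γ y * partialDeriv i u y := by
      rw [← hG.tr_swap hy]
      simp only [mul_comm (κ i _)]
      rw [hG.tr_partialDeriv_mul hy, hG.gradInner_eq (f₂ := u) hy, hG.gradInner_eq (f₂ := γ) hy]
      simp only [hκ, Finset.mul_sum, Finset.sum_mul, ← Finset.sum_sub_distrib]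
      exact Finset.sum_congr rfl fun m _ => by ring
    simp only [hform] at h0
    rw [tr_add, t, hG.tr_wedge_metric hy] at h0
    exact h0
  have hCX : ∀ i j, η i * partialDeriv j u y - η j * partialDeriv i u y
      + κ i j * gradInner G u u y = 0 := by
    intro i j
    -- Since C = -h W(·,·,·,∇u), a second gradient lands in the antisymmetric last pair of W.
    have h0 : ∑ l, cotton G y i j l * grad G u y l = 0 := by
      have : ∑ l, cotton G y i j l * grad G u y l = - ∑ l, cotton G y i j l * grad G u y l := by
        simp only [hC, mul_assoc, ← Finset.mul_sum, Finset.sum_mul]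
        rw [← mul_neg, ← Finset.sum_neg_distrib]
        conv_lhs => rw [Finset.sum_comm]
        congr 1
        refine Finset.sum_congr rfl fun m _ => ?_
        rw [← Finset.sum_neg_distrib]
        refine Finset.sum_congr rfl fun l _ => ?_
        rw [hG.weyl_antisymm_right hy i j l m]
        ring
      linarith
    rw [← h0, hG.gradInner_eq hy, ← hG.sum_metric_grad (f := u) hy j,
      ← hG.sum_metric_grad (f := u) hy i]
    simp only [hform, Finset.mul_sum, ← Finset.sum_sub_distrib, ← Finset.sum_add_distrib]
    exact Finset.sum_congr rfl fun m _ => by ring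
  have hκ0 : ∀ i j, κ i j = 0 := by
    intro i j
    have : gradInner G u u y * ((n : ℝ) - 2) * κ i j = 0 := by
      have e : κ i j = partialDeriv i γ y * partialDeriv j u y
        - partialDeriv j γ y * partialDeriv i u y := rfl
      have := hCX i j
      rw [e] at this ⊢
      -- Eliminate η between the contraction and the trace identity: (n-1)Qκ loses one copy of Qκ,
      -- because wedging κ(·,∇u) with du gives Qκ again.
      linear_combination ((n : ℝ) - 1) * this - partialDeriv j u y * htr i
        + partialDeriv i u y * htr j
    exact (mul_eq_zero.mp this).resolve_left (mul_ne_zero hQ h2)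
  have hη0 : ∀ i, η i = 0 := by
    intro i
    have e : partialDeriv i γ y * gradInner G u u y - gradInner G u γ y * partialDeriv i u y
        = ∑ j, κ i j * grad G u y j := by
      rw [hG.gradInner_eq (f₂ := u) hy, hG.gradInner_eq (f₂ := γ) hy]
      simp only [hκ, Finset.mul_sum, Finset.sum_mul, ← Finset.sum_sub_distrib]
      exact Finset.sum_congr rfl fun m _ => by ring
    have h0 := htr i
    simp only [e, hκ0, zero_mul, Finset.sum_const_zero, add_zero] at h0
    exact (mul_eq_zero.mp h0).resolve_left h1
  rw [hform, hη0, hη0, hκ0]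
  ring

end IsSolitonOn

/-! ### Volume density and integration by parts in coordinates -/

/-- The Riemannian volume density. -/
def volDensity (G : Coord n → Matrix (Fin n) (Fin n) ℝ) (y : Coord n) : ℝ := Real.sqrt (G y).det

namespace IsMetricOn

variable {G : Coord n → Matrix (Fin n) (Fin n) ℝ} {U : Set (Coord n)} {y : Coord n}

lemma volDensity_pos (hG : IsMetricOn G U) (hy : y ∈ U) : 0 < volDensity G y :=
  Real.sqrt_pos.mpr (hG.det_pos hy)

lemma smooth_volDensity (hG : IsMetricOn G U) (hy : y ∈ U) : ContDiffAt ℝ ∞ (volDensity G) y :=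
  (hG.smooth y hy).det.sqrt (hG.det_pos hy).ne'

/-- By Jacobi's formula and ∂G = ΓᵀG + GΓ, the logarithmic derivative of det G is twice the trace of
Γ; the square root halves it. -/
lemma partialDeriv_volDensity (hG : IsMetricOn G U) (hy : y ∈ U) (a : Fin n) :
    partialDeriv a (volDensity G) y = volDensity G y * ∑ p, christoffel G y p a p := by
  have hdet := (hG.smooth y hy).det
  have h1 : partialDeriv a (fun z => (G z).det) y
      = 2 * (G y).det * ∑ p, christoffel G y p a p := by
    have hadj : (G y).adjugate = (G y).det • (G y)⁻¹ := by
      rw [Matrix.inv_def, smul_smul, Ring.inverse_eq_inv', mul_inv_cancel₀ (hG.det_pos hy).ne',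
        one_smul]
    have ht : (conn G a y).trace = ∑ p, christoffel G y p a p := rfl
    have h2 : ((G y)⁻¹ * ((conn G a y)ᵀ * G y)).trace = (conn G a y).trace := by
      rw [← Matrix.mul_assoc, Matrix.trace_mul_comm, ← Matrix.mul_assoc, hG.mul_inv hy,
        Matrix.one_mul, Matrix.trace_transpose]
    have h3 : ((G y)⁻¹ * (G y * conn G a y)).trace = (conn G a y).trace := by
      rw [← Matrix.mul_assoc, hG.inv_mul hy, Matrix.one_mul]
    rw [partialDeriv_det a (hG.smooth y hy), hG.matDeriv_metric hy, hadj, Matrix.smul_mul,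
      Matrix.trace_smul, Matrix.mul_add, Matrix.trace_add, h2, h3, ← ht, smul_eq_mul]
    ring
  have hs : partialDeriv a (volDensity G) y
      = 1 / (2 * volDensity G y) * partialDeriv a (fun z => (G z).det) y := by
    unfold partialDeriv volDensity
    rw [fderiv_sqrt hdet.diff (hG.det_pos hy).ne']
    simp
  have hpos := hG.volDensity_pos hy
  have hsq : (G y).det = volDensity G y ^ 2 := (Real.sq_sqrt (hG.det_pos hy).le).symm
  rw [hs, h1, hsq]
  field_simp

/-- The divergence of a one-form in coordinates. -/
lemma sum_partialDeriv_volDensity_mul (hG : IsMetricOn G U) (hy : y ∈ U)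
    {V : Coord n → Fin n → ℝ} (hV : ∀ b, ContDiffAt ℝ ∞ (fun z => V z b) y) :
    ∑ a, partialDeriv a (fun z => volDensity G z * ∑ b, (G z)⁻¹ a b * V z b) y
      = volDensity G y * tr G y (covDeriv₁ G V y) := by
  have h0 : ∀ a b, partialDeriv a (fun z => (G z)⁻¹ a b) y
      = - (∑ q, christoffel G y a a q * (G y)⁻¹ q b)
        - ∑ q, (G y)⁻¹ a q * christoffel G y b a q := by
    intro a b
    have h := congrFun (congrFun (hG.matDeriv_inv hy a) a) b
    simp only [matDeriv, Matrix.of_apply, Matrix.neg_apply, Matrix.add_apply, Matrix.mul_apply,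
      conn, Matrix.transpose_apply] at h
    rw [h]
    ring
  have hi := hG.smooth_inv hy
  have hs : ∀ a, ContDiffAt ℝ ∞ (fun z => ∑ b, (G z)⁻¹ a b * V z b) y :=
    fun a => ContDiffAt.sum fun b _ => (hi a b).mul (hV b)
  have h1 : ∀ a, partialDeriv a (fun z => volDensity G z * ∑ b, (G z)⁻¹ a b * V z b) y
      = volDensity G y * ((∑ p, christoffel G y p a p) * (∑ b, (G y)⁻¹ a b * V y b)
        + ∑ b, ((- (∑ q, christoffel G y a a q * (G y)⁻¹ q b)
        - ∑ q, (G y)⁻¹ a q * christoffel G y b a q) * V y b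
          + (G y)⁻¹ a b * partialDeriv a (fun z => V z b) y)) := by
    intro a
    rw [partialDeriv_mul a (hG.smooth_volDensity hy).diff (hs a).diff,
      hG.partialDeriv_volDensity hy, partialDeriv_sum a _ fun b _ => ((hi a b).mul (hV b)).diff]
    have : ∀ b, partialDeriv a (fun z => (G z)⁻¹ a b * V z b) y
        = (- (∑ q, christoffel G y a a q * (G y)⁻¹ q b)
        - ∑ q, (G y)⁻¹ a q * christoffel G y b a q) * V y b
          + (G y)⁻¹ a b * partialDeriv a (fun z => V z b) y := fun b => by
      rw [partialDeriv_mul a (hi a b).diff (hV b).diff, h0]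
    simp only [this]
    ring
  simp only [h1, ← Finset.mul_sum]
  congr 1
  have h2 : ∑ a, ∑ b, ∑ p, christoffel G y p a p * ((G y)⁻¹ a b * V y b)
      = ∑ a, ∑ b, ∑ q, christoffel G y a a q * (G y)⁻¹ q b * V y b :=
    calc _ = ∑ a, ∑ p, ∑ b, christoffel G y p a p * ((G y)⁻¹ a b * V y b) :=
          Finset.sum_congr rfl fun a _ => Finset.sum_comm
      _ = ∑ p, ∑ a, ∑ b, christoffel G y p a p * ((G y)⁻¹ a b * V y b) := Finset.sum_comm
      _ = ∑ p, ∑ b, ∑ a, christoffel G y p a p * ((G y)⁻¹ a b * V y b) :=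
          Finset.sum_congr rfl fun p _ => Finset.sum_comm
      _ = _ := Finset.sum_congr rfl fun p _ => Finset.sum_congr rfl fun b _ =>
          Finset.sum_congr rfl fun a _ => by rw [hG.christoffel_symm hy p a p]; ring
  have h3 : ∑ a, ∑ b, ∑ q, (G y)⁻¹ a q * christoffel G y b a q * V y b
      = ∑ a, ∑ b, ∑ p, (G y)⁻¹ a b * (christoffel G y p a b * V y p) := by
    refine Finset.sum_congr rfl fun a _ => ?_
    rw [Finset.sum_comm]
    exact Finset.sum_congr rfl fun b _ => Finset.sum_congr rfl fun p _ => by ring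
  simp only [tr, covDeriv₁, Finset.sum_add_distrib, Finset.sum_mul, Finset.mul_sum, sub_mul,
    neg_mul, mul_sub, Finset.sum_sub_distrib, Finset.sum_neg_distrib]
  rw [h2, h3]
  ring

end IsMetricOn

/-- A derivative of a compactly supported function on an open set has integral zero. -/
lemma setIntegral_partialDeriv_eq_zero {U K : Set (Coord n)} (hU : IsOpen U) (hK : IsCompact K)
    (hKU : K ⊆ U) {w : Coord n → ℝ} (hw : ∀ y ∈ U, ContDiffAt ℝ ∞ w y)
    (h0 : ∀ y ∈ U, y ∉ K → w y = 0) (a : Fin n) :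
    IntegrableOn (partialDeriv a w) U ∧ ∫ y in U, partialDeriv a w y = 0 := by
  classical
  -- Extension by zero is smooth on the whole space: away from `K` it vanishes on an open set, and
  -- `K` lies inside `U`.
  set W := U.indicator w with hW
  have hWw : ∀ y ∈ U, W =ᶠ[𝓝 y] w := fun y hy => by
    filter_upwards [hU.mem_nhds hy] with z hz
    exact Set.indicator_of_mem hz w
  have hW0 : ∀ y ∉ K, W y = 0 := fun y hy => by
    by_cases hyU : y ∈ U
    · rw [hW, Set.indicator_of_mem hyU, h0 y hyU hy]
    · exact Set.indicator_of_notMem hyU w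
  have hWs : ContDiff ℝ ∞ W := by
    rw [contDiff_iff_contDiffAt]
    intro y
    by_cases hyU : y ∈ U
    · exact (hw y hyU).congr_of_eventuallyEq (hWw y hyU)
    · have : W =ᶠ[𝓝 y] fun _ => 0 := by
        filter_upwards [hK.isClosed.isOpen_compl.mem_nhds (fun h => hyU (hKU h))] with z hz
        exact hW0 z hz
      exact contDiffAt_const.congr_of_eventuallyEq this
  have hWc : HasCompactSupport W := HasCompactSupport.intro hK hW0
  have hdc : HasCompactSupport (partialDeriv a W) := hWc.fderiv_apply ℝ _
  have hcont : Continuous (partialDeriv a W) :=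
    (hWs.continuous_fderiv (by simp)).clm_apply continuous_const
  have hint : Integrable (partialDeriv a W) := hcont.integrable_of_hasCompactSupport hdc
  have hzero : ∫ y, partialDeriv a W y = 0 := by
    have hint' : Integrable (fun y => fderiv ℝ W y (EuclideanSpace.single a 1)) := hint
    -- Integration by parts against the constant function 1.
    have := integral_mul_fderiv_eq_neg_fderiv_mul_of_integrable (𝕜 := ℝ) (μ := volume)
      (f := fun _ : Coord n => (1 : ℝ)) (g := W) (v := EuclideanSpace.single a 1)
      (by simp) (by simpa using hint')
      (by simpa using hWs.continuous.integrable_of_hasCompactSupport hWc)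
      (fun _ _ => differentiableAt_const _) (fun y _ => hWs.differentiable (by simp) y)
    simp only [one_mul, fderiv_const_apply, _root_.zero_apply, zero_mul,
      integral_zero, neg_zero] at this
    exact this
  have heq : Set.EqOn (partialDeriv a W) (partialDeriv a w) U := fun y hy =>
    partialDeriv_congr a (hWw y hy)
  refine ⟨hint.integrableOn.congr_fun heq hU.measurableSet, ?_⟩
  rw [← setIntegral_congr_fun hU.measurableSet heq,
    setIntegral_eq_integral_of_forall_compl_eq_zero, hzero]
  intro y hy
  have : W =ᶠ[𝓝 y] fun _ => 0 := by
    filter_upwards [hK.isClosed.isOpen_compl.mem_nhds (fun h => hy (hKU h))] with z hz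
    exact hW0 z hz
  rw [partialDeriv_congr a this, partialDeriv_const]

/-- Integration by parts against a one-form, on an open set with a Riemannian metric. -/
lemma IsMetricOn.integral_mul_div {G : Coord n → Matrix (Fin n) (Fin n) ℝ}
    {U K : Set (Coord n)} (hG : IsMetricOn G U) (hK : IsCompact K) (hKU : K ⊆ U)
    {f : Coord n → ℝ} (hf : ∀ y ∈ U, ContDiffAt ℝ ∞ f y) (h0 : ∀ y ∈ U, y ∉ K → f y = 0)
    {V : Coord n → Fin n → ℝ} (hV : ∀ y ∈ U, ∀ b, ContDiffAt ℝ ∞ (fun z => V z b) y) :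
    ∫ y in U, (f y * tr G y (covDeriv₁ G V y)
      + tr G y (fun a b => partialDeriv a f y * V y b)) * volDensity G y = 0 := by
  set w : Fin n → Coord n → ℝ := fun a z => volDensity G z * ∑ b, (G z)⁻¹ a b * (f z * V z b)
    with hw
  have hws : ∀ a, ∀ y ∈ U, ContDiffAt ℝ ∞ (w a) y := fun a y hy =>
    (hG.smooth_volDensity hy).mul (ContDiffAt.sum fun b _ =>
      (hG.smooth_inv hy a b).mul ((hf y hy).mul (hV y hy b)))
  have hw0 : ∀ a, ∀ y ∈ U, y ∉ K → w a y = 0 := fun a y hy hyK => by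
    simp only [hw, h0 y hy hyK, zero_mul, mul_zero, Finset.sum_const_zero]
  have hI := fun a => setIntegral_partialDeriv_eq_zero hG.isOpen hK hKU (hws a) (hw0 a) a
  have hsum : ∫ y in U, ∑ a, partialDeriv a (w a) y = 0 := by
    rw [integral_finsetSum _ fun a _ => (hI a).1]
    exact Finset.sum_eq_zero fun a _ => (hI a).2
  rw [← hsum]
  refine setIntegral_congr_fun hG.isOpen.measurableSet fun y hy => ?_
  have h1 := hG.sum_partialDeriv_volDensity_mul hy (V := fun z b => f z * V z b)
    (fun b => (hf y hy).mul (hV y hy b))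
  have h2 : covDeriv₁ G (fun z b => f z * V z b) y
      = fun a b => partialDeriv a f y * V y b + f y * covDeriv₁ G V y a b := by
    funext a b
    unfold covDeriv₁
    rw [partialDeriv_mul a (hf y hy).diff (hV y hy b).diff]
    simp only [mul_sub, mul_left_comm _ (f y), ← Finset.mul_sum]
    ring
  have h3 : tr G y (fun a b => f y * covDeriv₁ G V y a b) = f y * tr G y (covDeriv₁ G V y) :=
    tr_const_mul _ _ _ _
  simp only [hw]
  rw [h1, h2, tr_add, h3]
  ring

/-! ### Charts of the maximal atlas -/

section

variable {M : Type*} [TopologicalSpace M] [ChartedSpace (EuclideanSpace ℝ (Fin n)) M]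
  {e e' : OpenPartialHomeomorph M (EuclideanSpace ℝ (Fin n))} {y : Coord n}

lemma mdifferentiable_of_mem_maximalAtlas (he : e ∈ IsManifold.maximalAtlas (𝓡 n) ∞ M) :
    e.MDifferentiable (𝓡 n) (𝓡 n) :=
  ⟨(contMDiffOn_of_mem_maximalAtlas he).mdifferentiableOn (by simp),
    (contMDiffOn_symm_of_mem_maximalAtlas he).mdifferentiableOn (by simp)⟩

lemma contMDiffAt_tangent_symm [IsManifold (𝓡 n) ∞ M]
    (he : e ∈ IsManifold.maximalAtlas (𝓡 n) ∞ M)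
    (hy : y ∈ e.target) (v : EuclideanSpace ℝ (Fin n)) :
    ContMDiffAt (𝓡 n) (𝓡 n).tangent ∞ (fun z =>
      (⟨e.symm z, mfderiv (𝓡 n) (𝓡 n) e.symm z v⟩ : TangentBundle (𝓡 n) M)) y := by
  have h := (contMDiffOn_symm_of_mem_maximalAtlas he).contMDiffOn_tangentMapWithin
    (m := ∞) (by simp) e.open_target.uniqueMDiffOn
  have hs : ContMDiff (𝓡 n) (𝓡 n).tangent ∞
      (fun z => (⟨z, v⟩ : TangentBundle (𝓡 n) (EuclideanSpace ℝ (Fin n)))) :=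
    contMDiff_vectorSpace_iff_contDiff.mpr contDiff_const
  have hc := h.comp (hs.contMDiffOn (s := e.target)) (fun z hz => hz)
  refine (hc.contMDiffAt (e.open_target.mem_nhds hy)).congr_of_eventuallyEq ?_
  filter_upwards [e.open_target.mem_nhds hy] with z hz
  simp only [Function.comp, tangentMapWithin]
  rw [mfderivWithin_of_isOpen e.open_target hz]

/-- The Jacobian matrix of the change of charts from `e` to `e'`. -/
def transitionMatrix (e e' : OpenPartialHomeomorph M (EuclideanSpace ℝ (Fin n))) (y : Coord n) :
    Matrix (Fin n) (Fin n) ℝ :=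
  Matrix.of fun k i => fderiv ℝ (fun z => e' (e.symm z)) y (EuclideanSpace.single i 1) k

lemma differentiableAt_transition (he : e ∈ IsManifold.maximalAtlas (𝓡 n) ∞ M)
    (he' : e' ∈ IsManifold.maximalAtlas (𝓡 n) ∞ M) (hy : y ∈ e.target)
    (hy' : e.symm y ∈ e'.source) : DifferentiableAt ℝ (fun z => e' (e.symm z)) y := by
  rw [← mdifferentiableAt_iff_differentiableAt]
  exact ((mdifferentiable_of_mem_maximalAtlas he').mdifferentiableAt hy').comp y
    ((mdifferentiable_of_mem_maximalAtlas he).mdifferentiableAt_symm hy)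

lemma fderiv_transition_single {X : Type*} [TopologicalSpace X]
    (e e' : OpenPartialHomeomorph X (EuclideanSpace ℝ (Fin n))) (y : Coord n) (i : Fin n) :
    fderiv ℝ (fun z => e' (e.symm z)) y (EuclideanSpace.single i 1)
      = ∑ k, transitionMatrix e e' y k i • EuclideanSpace.single k (1 : ℝ) := by
  ext l
  simp [transitionMatrix, Finset.sum_apply, Pi.single_apply]

lemma partialDeriv_transition (he : e ∈ IsManifold.maximalAtlas (𝓡 n) ∞ M)
    (he' : e' ∈ IsManifold.maximalAtlas (𝓡 n) ∞ M) (hy : y ∈ e.target)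
    (hy' : e.symm y ∈ e'.source) {f : M → ℝ}
    (hf : DifferentiableAt ℝ (fun z => f (e'.symm z)) (e' (e.symm y))) (i : Fin n) :
    partialDeriv i (fun z => f (e.symm z)) y = ∑ k, transitionMatrix e e' y k i *
      partialDeriv k (fun z => f (e'.symm z)) (e' (e.symm y)) := by
  have hev : (fun z => f (e.symm z)) =ᶠ[𝓝 y]
      (fun z => f (e'.symm z)) ∘ fun z => e' (e.symm z) := by
    filter_upwards [(e.continuousAt_symm hy).preimage_mem_nhds (e'.open_source.mem_nhds hy')]
      with z hz
    simp only [Function.comp, e'.left_inv hz]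
  rw [partialDeriv_congr i hev]
  unfold partialDeriv
  rw [fderiv_comp y hf (differentiableAt_transition he he' hy hy'),
    ContinuousLinearMap.comp_apply, fderiv_transition_single, map_sum]
  simp only [map_smul, smul_eq_mul]

section

variable [Bundle.RiemannianBundle (fun x : M => TangentSpace (𝓡 n) x)]

/-- The metric at a point, as a form on the model space. -/
def metricAt (x : M) (v w : EuclideanSpace ℝ (Fin n)) : ℝ :=
  @inner ℝ (TangentSpace (𝓡 n) x) _ v w

lemma metricAt_sum (x : M) (v : Fin n → EuclideanSpace ℝ (Fin n)) (a b : Fin n → ℝ) :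
    metricAt x (∑ i, a i • v i) (∑ j, b j • v j)
      = ∑ i, ∑ j, a i * b j * metricAt x (v i) (v j) := by
  have h : ∀ w : Fin n → TangentSpace (𝓡 n) x, inner ℝ (∑ i, a i • w i) (∑ j, b j • w j)
      = ∑ i, ∑ j, a i * b j * inner ℝ (w i) (w j) := by
    intro w
    simp only [sum_inner, inner_sum, inner_smul_left, inner_smul_right, conj_trivial]
    rw [Finset.sum_comm]
    refine Finset.sum_congr rfl fun j _ => ?_
    rw [Finset.mul_sum]
    exact Finset.sum_congr rfl fun i _ => by ring
  exact h v

lemma metricAt_pos (x : M) {v : EuclideanSpace ℝ (Fin n)} (hv : v ≠ 0) : 0 < metricAt x v v := by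
  have h : ∀ w : TangentSpace (𝓡 n) x, w ≠ 0 → 0 < inner ℝ w w :=
    fun w hw => real_inner_self_pos.mpr hw
  exact h v hv

lemma metricAt_comm (x : M) (v w : EuclideanSpace ℝ (Fin n)) : metricAt x v w = metricAt x w v := by
  have h : ∀ v w : TangentSpace (𝓡 n) x, inner ℝ v w = inner ℝ w v :=
    fun v w => real_inner_comm w v
  exact h v w

/-- The chart metric is the pullback of the inner product by the derivative of `e.symm`, which is
injective. -/
lemma posDef_chartMetric (he : e ∈ IsManifold.maximalAtlas (𝓡 n) ∞ M)
    (hy : y ∈ e.target) : (chartMetric e y).PosDef := by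
  refine Matrix.PosDef.of_dotProduct_mulVec_pos ?_ fun x hx => ?_
  · ext i j
    exact metricAt_comm _ _ _
  · set L : EuclideanSpace ℝ (Fin n) →L[ℝ] EuclideanSpace ℝ (Fin n) :=
      mfderiv (𝓡 n) (𝓡 n) e.symm y with hL
    have hinj : Function.Injective L :=
      (mdifferentiable_of_mem_maximalAtlas he).symm.mfderiv_injective hy
    have hx' : WithLp.toLp 2 x = ∑ i, x i • EuclideanSpace.single i (1 : ℝ) := by
      ext i
      simp [Finset.sum_apply, Pi.single_apply]
    have hLx : L (WithLp.toLp 2 x) = ∑ i, x i • L (EuclideanSpace.single i (1 : ℝ)) := by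
      rw [hx', map_sum]
      simp only [map_smul]
    have hne : L (WithLp.toLp 2 x) ≠ 0 := fun h0 => hx (by
      have := hinj (h0.trans (map_zero L).symm)
      simpa using this)
    have hpos := metricAt_pos (e.symm y) hne
    rw [hLx, metricAt_sum] at hpos
    have h : star x ⬝ᵥ (chartMetric e y *ᵥ x) = ∑ i, ∑ j, x i * x j * metricAt (e.symm y)
        (L (EuclideanSpace.single i (1 : ℝ))) (L (EuclideanSpace.single j (1 : ℝ))) := by
      simp only [dotProduct, Matrix.mulVec, Finset.mul_sum]
      refine Finset.sum_congr rfl fun i _ => Finset.sum_congr rfl fun j _ => ?_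
      rw [show chartMetric e y i j = metricAt (e.symm y)
        (L (EuclideanSpace.single i (1 : ℝ))) (L (EuclideanSpace.single j (1 : ℝ))) from rfl]
      simp only [Pi.star_apply, star_trivial]
      ring
    rw [h]
    exact hpos

/-- Chain rule for `e.symm = e'.symm ∘ (e' ∘ e.symm)`. The two base points agree only
propositionally; `metricAt`, a form on the fixed model space, lets that equality be rewritten. -/
lemma chartMetric_transition (he : e ∈ IsManifold.maximalAtlas (𝓡 n) ∞ M)
    (he' : e' ∈ IsManifold.maximalAtlas (𝓡 n) ∞ M) (hy : y ∈ e.target)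
    (hy' : e.symm y ∈ e'.source) :
    chartMetric e y = (transitionMatrix e e' y)ᵀ * chartMetric e' (e' (e.symm y))
      * transitionMatrix e e' y := by
  have hev : e.symm =ᶠ[𝓝 y] e'.symm ∘ fun z => e' (e.symm z) := by
    filter_upwards [(e.continuousAt_symm hy).preimage_mem_nhds (e'.open_source.mem_nhds hy')]
      with z hz
    exact (e'.left_inv hz).symm
  have hL : ∀ v : EuclideanSpace ℝ (Fin n),
      (mfderiv (𝓡 n) (𝓡 n) e.symm y v : EuclideanSpace ℝ (Fin n))
      = mfderiv (𝓡 n) (𝓡 n) e'.symm (e' (e.symm y))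
        (fderiv ℝ (fun z => e' (e.symm z)) y v) := by
    intro v
    have h1 := hev.mfderiv_eq (I := 𝓡 n) (I' := 𝓡 n)
    have h2 := mfderiv_comp (I := 𝓡 n) (I' := 𝓡 n) (I'' := 𝓡 n) y
      ((mdifferentiable_of_mem_maximalAtlas he').mdifferentiableAt_symm (e'.map_source hy'))
      (differentiableAt_transition he he' hy hy').mdifferentiableAt
    rw [h2, mfderiv_eq_fderiv] at h1
    exact congrArg (fun L : EuclideanSpace ℝ (Fin n) →L[ℝ] EuclideanSpace ℝ (Fin n) => L v) h1
  ext i j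
  have hbase : e'.symm (e' (e.symm y)) = e.symm y := e'.left_inv hy'
  set L : EuclideanSpace ℝ (Fin n) →L[ℝ] EuclideanSpace ℝ (Fin n) :=
    mfderiv (𝓡 n) (𝓡 n) e'.symm (e' (e.symm y)) with hLdef
  have hLs : ∀ i, L (fderiv ℝ (fun z => e' (e.symm z)) y (EuclideanSpace.single i 1))
      = ∑ k, transitionMatrix e e' y k i • L (EuclideanSpace.single k (1 : ℝ)) := by
    intro i
    rw [fderiv_transition_single, map_sum]
    simp only [map_smul]
  have h1 : chartMetric e y i j = metricAt (e.symm y)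
      (L (fderiv ℝ (fun z => e' (e.symm z)) y (EuclideanSpace.single i 1)))
      (L (fderiv ℝ (fun z => e' (e.symm z)) y (EuclideanSpace.single j 1))) :=
    congrArg₂ (metricAt (e.symm y)) (hL _) (hL _)
  have h2 : ∀ k l, chartMetric e' (e' (e.symm y)) k l = metricAt (e.symm y)
      (L (EuclideanSpace.single k 1)) (L (EuclideanSpace.single l 1)) :=
    fun k l => congrArg (fun x => metricAt x (L (EuclideanSpace.single k 1))
      (L (EuclideanSpace.single l 1))) hbase
  rw [h1, hLs, hLs, metricAt_sum]
  simp only [Matrix.mul_apply, Matrix.transpose_apply, h2, Finset.sum_mul]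
  rw [Finset.sum_comm]
  exact Finset.sum_congr rfl fun l _ => Finset.sum_congr rfl fun k _ => by ring

variable [IsManifold (𝓡 n) ∞ M]
  [IsContMDiffRiemannianBundle (𝓡 n) ∞ (EuclideanSpace ℝ (Fin n))
    (fun x : M => TangentSpace (𝓡 n) x)]

lemma matSmoothAt_chartMetric (he : e ∈ IsManifold.maximalAtlas (𝓡 n) ∞ M)
    (hy : y ∈ e.target) : MatSmoothAt (chartMetric e) y := by
  intro i j
  rw [← contMDiffAt_iff_contDiffAt]
  exact ContMDiffAt.inner_bundle (IB := 𝓡 n) (F := EuclideanSpace ℝ (Fin n))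
    (E := fun x : M => TangentSpace (𝓡 n) x)
    (contMDiffAt_tangent_symm he hy (EuclideanSpace.single i (1 : ℝ)))
    (contMDiffAt_tangent_symm he hy (EuclideanSpace.single j (1 : ℝ)))

lemma isMetricOn_chartMetric (he : e ∈ IsManifold.maximalAtlas (𝓡 n) ∞ M) :
    IsMetricOn (chartMetric e) e.target :=
  ⟨e.open_target, fun _ hy => matSmoothAt_chartMetric he hy,
    fun _ hy => posDef_chartMetric he hy⟩

end

end

/-! ### Smooth functions, gradients and integrals in charts -/

section

variable {M : Type*} [TopologicalSpace M] [ChartedSpace (EuclideanSpace ℝ (Fin n)) M]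
  {e e' : OpenPartialHomeomorph M (EuclideanSpace ℝ (Fin n))} {y : Coord n}

variable (n) in
/-- A function that is smooth in all charts of the maximal atlas. -/
def IsChartSmooth (f : M → ℝ) : Prop :=
  ∀ e ∈ IsManifold.maximalAtlas (𝓡 n) ∞ M, ∀ y ∈ e.target,
    ContDiffAt ℝ ∞ (fun z => f (e.symm z)) y

lemma _root_.ContMDiff.isChartSmooth {f : M → ℝ} (hf : ContMDiff (𝓡 n) 𝓘(ℝ, ℝ) ∞ f) :
    IsChartSmooth n f := by
  intro e he y hy
  rw [← contMDiffAt_iff_contDiffAt]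
  exact (hf (e.symm y)).comp y (((contMDiffOn_symm_of_mem_maximalAtlas he) y hy).contMDiffAt
    (e.open_target.mem_nhds hy))

namespace IsChartSmooth

variable {f g : M → ℝ}

lemma add (hf : IsChartSmooth n f) (hg : IsChartSmooth n g) :
    IsChartSmooth n (fun x => f x + g x) := fun e he y hy => (hf e he y hy).add (hg e he y hy)

lemma sub (hf : IsChartSmooth n f) (hg : IsChartSmooth n g) :
    IsChartSmooth n (fun x => f x - g x) := fun e he y hy => (hf e he y hy).sub (hg e he y hy)

lemma mul (hf : IsChartSmooth n f) (hg : IsChartSmooth n g) :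
    IsChartSmooth n (fun x => f x * g x) := fun e he y hy => (hf e he y hy).mul (hg e he y hy)

lemma const (c : ℝ) : IsChartSmooth n (fun _ : M => c) := fun _ _ _ _ => contDiffAt_const

end IsChartSmooth

section Riemannian

variable [Bundle.RiemannianBundle (fun x : M => TangentSpace (𝓡 n) x)]

lemma det_transitionMatrix_sq (he : e ∈ IsManifold.maximalAtlas (𝓡 n) ∞ M)
    (he' : e' ∈ IsManifold.maximalAtlas (𝓡 n) ∞ M) (hy : y ∈ e.target)
    (hy' : e.symm y ∈ e'.source) :
    (chartMetric e y).det
      = (transitionMatrix e e' y).det ^ 2 * (chartMetric e' (e' (e.symm y))).det := by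
  rw [chartMetric_transition he he' hy hy', Matrix.det_mul, Matrix.det_mul, Matrix.det_transpose]
  ring

lemma volDensity_transition (he : e ∈ IsManifold.maximalAtlas (𝓡 n) ∞ M)
    (he' : e' ∈ IsManifold.maximalAtlas (𝓡 n) ∞ M) (hy : y ∈ e.target)
    (hy' : e.symm y ∈ e'.source) :
    volDensity (chartMetric e) y
      = |(transitionMatrix e e' y).det| * volDensity (chartMetric e') (e' (e.symm y)) := by
  rw [volDensity, det_transitionMatrix_sq he he' hy hy', Real.sqrt_mul (sq_nonneg _),
    Real.sqrt_sq_eq_abs]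
  rfl

/-- Differentials transform by Jᵀ and the inverse metric by J⁻¹ on one side and its transpose on the
other, so the Jacobians cancel. -/
lemma gradInner_transition (he : e ∈ IsManifold.maximalAtlas (𝓡 n) ∞ M)
    (he' : e' ∈ IsManifold.maximalAtlas (𝓡 n) ∞ M) (hy : y ∈ e.target)
    (hy' : e.symm y ∈ e'.source) {f₁ f₂ : M → ℝ} (hf₁ : IsChartSmooth n f₁)
    (hf₂ : IsChartSmooth n f₂) :
    gradInner (chartMetric e) (fun z => f₁ (e.symm z)) (fun z => f₂ (e.symm z)) y
      = gradInner (chartMetric e') (fun z => f₁ (e'.symm z)) (fun z => f₂ (e'.symm z))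
        (e' (e.symm y)) := by
  have hform : ∀ (A : Coord n → Matrix (Fin n) (Fin n) ℝ) (g₁ g₂ : Coord n → ℝ) (z : Coord n),
      gradInner A g₁ g₂ z = (fun a => partialDeriv a g₁ z) ⬝ᵥ
        ((A z)⁻¹ *ᵥ fun b => partialDeriv b g₂ z) := by
    intro A g₁ g₂ z
    simp only [gradInner, tr, dotProduct, Matrix.mulVec, Finset.mul_sum]
    exact Finset.sum_congr rfl fun a _ => Finset.sum_congr rfl fun b _ => by ring
  have hd : ∀ {f : M → ℝ}, IsChartSmooth n f → (fun a => partialDeriv a (fun z => f (e.symm z)) y)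
      = (transitionMatrix e e' y)ᵀ *ᵥ
        fun a => partialDeriv a (fun z => f (e'.symm z)) (e' (e.symm y)) := by
    intro f hf
    funext a
    rw [partialDeriv_transition he he' hy hy' (hf e' he' _ (e'.map_source hy')).diff]
    rfl
  have hdet : IsUnit (transitionMatrix e e' y).det := by
    have h := det_transitionMatrix_sq he he' hy hy'
    have hp := (posDef_chartMetric he hy).det_pos
    rw [h] at hp
    exact (pow_ne_zero_iff two_ne_zero |>.mp (left_ne_zero_of_mul hp.ne')).isUnit
  set J := transitionMatrix e e' y with hJ
  rw [hform, hform, hd hf₁, hd hf₂, chartMetric_transition he he' hy hy', ← hJ,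
    Matrix.mul_inv_rev, Matrix.mul_inv_rev, Matrix.mulVec_mulVec, Matrix.mulVec_transpose,
    ← Matrix.dotProduct_mulVec, Matrix.mulVec_mulVec]
  have hJt : IsUnit (Jᵀ).det := by rwa [Matrix.det_transpose]
  have e1 : J * (J⁻¹ * ((chartMetric e' (e' (e.symm y)))⁻¹ * Jᵀ⁻¹) * Jᵀ)
      = (chartMetric e' (e' (e.symm y)))⁻¹ := by
    rw [Matrix.mul_assoc J⁻¹, Matrix.mul_assoc _ Jᵀ⁻¹, Matrix.nonsing_inv_mul _ hJt,
      Matrix.mul_one, ← Matrix.mul_assoc, Matrix.mul_nonsing_inv _ hdet, Matrix.one_mul]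
  rw [e1]

variable (n) in
/-- The inner product of the gradients of two functions on a manifold. -/
def mGradInner (f₁ f₂ : M → ℝ) (x : M) : ℝ :=
  gradInner (chartMetric (chartAt (EuclideanSpace ℝ (Fin n)) x))
    (fun z => f₁ ((chartAt (EuclideanSpace ℝ (Fin n)) x).symm z))
    (fun z => f₂ ((chartAt (EuclideanSpace ℝ (Fin n)) x).symm z))
    (chartAt (EuclideanSpace ℝ (Fin n)) x x)

/-- The integral, with respect to the Riemannian volume, of a function over a chart domain. -/
def chartIntegral (e : OpenPartialHomeomorph M (EuclideanSpace ℝ (Fin n))) (f : M → ℝ) : ℝ :=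
  ∫ y in e.target, f (e.symm y) * volDensity (chartMetric e) y

lemma det_fderiv_transition {X : Type*} [TopologicalSpace X]
    (e e' : OpenPartialHomeomorph X (EuclideanSpace ℝ (Fin n))) (y : Coord n) :
    (fderiv ℝ (fun z => e' (e.symm z)) y).det = (transitionMatrix e e' y).det := by
  rw [ContinuousLinearMap.det, ← LinearMap.det_toMatrix (EuclideanSpace.basisFun (Fin n) ℝ).toBasis]
  congr 1

/-- Change of variables between chart domains. -/
lemma chartIntegral_eq (he : e ∈ IsManifold.maximalAtlas (𝓡 n) ∞ M)
    (he' : e' ∈ IsManifold.maximalAtlas (𝓡 n) ∞ M) {f : M → ℝ}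
    (hf : ∀ x ∈ e.source, x ∉ e'.source → f x = 0)
    (hf' : ∀ x ∈ e'.source, x ∉ e.source → f x = 0) :
    chartIntegral e f = chartIntegral e' f := by
  set τ := e.symm.trans e' with hτ
  have hsrc : τ.source = e.target ∩ e.symm ⁻¹' e'.source := by
    rw [hτ, OpenPartialHomeomorph.trans_source]; rfl
  have htgt : τ.target = e'.target ∩ e'.symm ⁻¹' e.source := by
    rw [hτ, OpenPartialHomeomorph.trans_target]; rfl
  -- `f` vanishes at the points of either chart domain that lie outside the other, so both integrals
  -- live on the overlap, where the Jacobian factors of the measure and of the density agree.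
  have h1 : chartIntegral e f = ∫ y in τ.source, f (e.symm y) * volDensity (chartMetric e) y := by
    refine setIntegral_eq_of_subset_of_forall_sdiff_eq_zero e.open_target.measurableSet
      (hsrc ▸ inter_subset_left) fun y hy => ?_
    rw [hf _ (e.map_target hy.1) (fun h => hy.2 (hsrc ▸ ⟨hy.1, h⟩)), zero_mul]
  have h2 : chartIntegral e' f
      = ∫ y in τ.target, f (e'.symm y) * volDensity (chartMetric e') y := by
    refine setIntegral_eq_of_subset_of_forall_sdiff_eq_zero e'.open_target.measurableSet
      (htgt ▸ inter_subset_left) fun y hy => ?_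
    rw [hf' _ (e'.map_target hy.1) (fun h => hy.2 (htgt ▸ ⟨hy.1, h⟩)), zero_mul]
  rw [h1, h2, integral_target_eq_integral_abs_det_fderiv_smul volume
    (f' := fun y => fderiv ℝ (fun z => e' (e.symm z)) y)
    (fun y hy => (differentiableAt_transition he he' (hsrc ▸ hy).1 (hsrc ▸ hy).2).hasFDerivAt)]
  refine setIntegral_congr_fun τ.open_source.measurableSet fun y hy => ?_
  have hy' : y ∈ e.target ∩ e.symm ⁻¹' e'.source := hsrc ▸ hy
  have hτy : τ y = e' (e.symm y) := rfl
  simp only [hτy, smul_eq_mul]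
  rw [volDensity_transition he he' hy'.1 hy'.2, e'.left_inv hy'.2, det_fderiv_transition]
  ring

variable [IsManifold (𝓡 n) ∞ M]

/-- The definition uses the preferred chart at each point; independence of the chart makes it
computable in a single chart near any point. -/
lemma mGradInner_symm_apply (he : e ∈ IsManifold.maximalAtlas (𝓡 n) ∞ M) (hy : y ∈ e.target)
    {f₁ f₂ : M → ℝ} (hf₁ : IsChartSmooth n f₁) (hf₂ : IsChartSmooth n f₂) :
    mGradInner n f₁ f₂ (e.symm y)
      = gradInner (chartMetric e) (fun z => f₁ (e.symm z)) (fun z => f₂ (e.symm z)) y :=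
  (gradInner_transition he (IsManifold.chart_mem_maximalAtlas (e.symm y)) hy
    (mem_chart_source _ _) hf₁ hf₂).symm

variable [IsContMDiffRiemannianBundle (𝓡 n) ∞ (EuclideanSpace ℝ (Fin n))
  (fun x : M => TangentSpace (𝓡 n) x)]

lemma IsChartSmooth.mGradInner {f₁ f₂ : M → ℝ} (hf₁ : IsChartSmooth n f₁)
    (hf₂ : IsChartSmooth n f₂) : IsChartSmooth n (mGradInner n f₁ f₂) := by
  intro e he y hy
  refine ((isMetricOn_chartMetric he).smooth_gradInner hy (hf₁ e he y hy)
    (hf₂ e he y hy)).congr_of_eventuallyEq ?_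
  filter_upwards [e.open_target.mem_nhds hy] with z hz
  exact mGradInner_symm_apply he hz hf₁ hf₂

/-- The integrand is continuous on the chart target and vanishes off the image of a compact set. -/
lemma integrableOn_chart [T2Space M] (he : e ∈ IsManifold.maximalAtlas (𝓡 n) ∞ M) {K : Set M}
    (hK : IsCompact K) (hKe : K ⊆ e.source) {g : Coord n → ℝ} (hg : ContinuousOn g e.target)
    (h0 : ∀ y ∈ e.target, e.symm y ∉ K → g y = 0) :
    IntegrableOn (fun y => g y * volDensity (chartMetric e) y) e.target := by
  have hG := isMetricOn_chartMetric he
  have hc : IsCompact (e '' K) := hK.image_of_continuousOn (e.continuousOn.mono hKe)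
  have hsub : e '' K ⊆ e.target := by
    rintro _ ⟨x, hx, rfl⟩
    exact e.map_source (hKe hx)
  have hcont : ContinuousOn (fun y => g y * volDensity (chartMetric e) y) e.target :=
    hg.mul fun y hy => (hG.smooth_volDensity hy).continuousAt.continuousWithinAt
  refine ((hcont.mono hsub).integrableOn_compact hc).of_forall_sdiff_eq_zero
    e.open_target.measurableSet fun y hy => ?_
  rw [h0 y hy.1 (fun h => hy.2 ⟨e.symm y, h, e.right_inv hy.1⟩), zero_mul]

end Riemannian

end

/-! ### Cutoff functions -/

/-- A cutoff function that is locally a function of `u` and is positive on a compact level set. -/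
lemma exists_cutoff {X : Type*} [TopologicalSpace X] [T2Space X] [LocallyCompactSpace X] {u : X → ℝ}
    (hu : Continuous u) {c : ℝ} (hc : IsCompact (u ⁻¹' {c})) :
    ∃ χ : X → ℝ, (∀ x, 0 ≤ χ x) ∧ (∀ x, u x = c → 0 < χ x) ∧ HasCompactSupport χ ∧
      ∀ x, ∃ ψ : ℝ → ℝ, ContDiff ℝ ∞ ψ ∧ χ =ᶠ[𝓝 x] ψ ∘ u := by
  classical
  obtain ⟨K, hK, hcK⟩ := exists_compact_superset hc
  -- The compact set K minus its interior misses the level, so |u - c| is bounded below there by a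
  -- positive constant.
  obtain ⟨ε, hε, hεF⟩ := (hK.diff isOpen_interior).exists_forall_le'
    (f := fun x => |u x - c|) (by fun_prop) (a := 0) fun x hx => by
      rw [abs_pos, sub_ne_zero]
      exact fun h => hx.2 (hcK h)
  let ψ : ContDiffBump c := ⟨ε / 4, ε / 2, by positivity, by linarith⟩
  -- The indicator is needed because values of u near c may also be attained far from the level,
  -- outside K. Hence the function is only locally a function of u. As the bump vanishes for |u - c|
  -- ≥ ε/2, truncation by K does not spoil smoothness.
  refine ⟨K.indicator (ψ ∘ u), fun x => indicator_nonneg (fun _ _ => ψ.nonneg) x, fun x hx => ?_,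
    HasCompactSupport.intro hK fun x hx => indicator_of_notMem hx _, fun x => ?_⟩
  · rw [indicator_of_mem (interior_subset (hcK hx))]
    exact ψ.pos_of_mem_ball (by simp [hx, ψ.rOut_pos])
  · by_cases hxK : x ∈ K
    · refine ⟨ψ, ψ.contDiff, ?_⟩
      by_cases hxi : x ∈ interior K
      · filter_upwards [isOpen_interior.mem_nhds hxi] with z hz
        rw [indicator_of_mem (interior_subset hz)]
      · have h1 : ε / 2 < |u x - c| := by linarith [hεF x ⟨hxK, hxi⟩]
        have h2 : ContinuousAt (fun z => |u z - c|) x := by fun_prop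
        filter_upwards [h2.eventually (lt_mem_nhds h1)] with z hz
        have h3 : ψ (u z) = 0 := ψ.zero_of_le_dist (by rw [Real.dist_eq]; exact hz.le)
        by_cases hzK : z ∈ K
        · rw [indicator_of_mem hzK]
        · rw [indicator_of_notMem hzK, Function.comp_apply, h3]
    · refine ⟨fun _ => 0, contDiff_const, ?_⟩
      filter_upwards [hK.isClosed.isOpen_compl.mem_nhds hxK] with z hz
      rw [indicator_of_notMem hz]
      rfl

section

universe v

variable {M : Type v} [TopologicalSpace M] [T2Space M]
  [ChartedSpace (EuclideanSpace ℝ (Fin n)) M] [IsManifold (𝓡 n) ∞ M]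
  {e : OpenPartialHomeomorph M (EuclideanSpace ℝ (Fin n))}

/-- A finite partition of unity on a compact set `K`, subordinate to charts, one of which is a given
chart around a given point of `K`. -/
lemma exists_partition (he : e ∈ IsManifold.maximalAtlas (𝓡 n) ∞ M) {K : Set M} (hK : IsCompact K)
    {x : M} (hx : x ∈ e.source) (hxK : x ∈ K) :
    ∃ (ι : Type v) (_ : Fintype ι) (E : ι → OpenPartialHomeomorph M (EuclideanSpace ℝ (Fin n)))
      (ρ : ι → M → ℝ) (i₀ : ι), E i₀ = e ∧ ρ i₀ x = 1 ∧
      (∀ i, E i ∈ IsManifold.maximalAtlas (𝓡 n) ∞ M) ∧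
      (∀ i, ContMDiff (𝓡 n) 𝓘(ℝ, ℝ) ∞ (ρ i)) ∧ (∀ i y, 0 ≤ ρ i y) ∧
      (∀ i, HasCompactSupport (ρ i)) ∧ (∀ i, tsupport (ρ i) ⊆ (E i).source) ∧
      ∀ y ∈ K, ∑ i, ρ i y = 1 := by
  classical
  let E : M → OpenPartialHomeomorph M (EuclideanSpace ℝ (Fin n)) :=
    fun c => if c = x then e else chartAt _ c
  have hEc : ∀ c, c ∈ (E c).source := by
    intro c
    by_cases h : c = x
    · simp [E, h, hx]
    · simp [E, h]
  -- Every neighbourhood except the one centred at `x` avoids `x`, so the partition function with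
  -- index `x` must equal 1 there.
  let N : M → Set M := fun c => (E c).source ∩ {z | c ≠ x → z ≠ x}
  have hN : ∀ c, N c ∈ 𝓝 c := by
    intro c
    refine inter_mem ((E c).open_source.mem_nhds (hEc c)) ?_
    by_cases h : c = x
    · simp [h]
    · filter_upwards [isOpen_compl_singleton.mem_nhds (show c ∈ ({x}ᶜ : Set M) from h)] with z hz _
        using hz
  choose f _ hf using fun c => (SmoothBumpFunction.nhds_basis_tsupport (I := 𝓡 n) c).mem_iff.1 (hN c)
  obtain ⟨t, htK, ht⟩ := hK.elim_nhds_subcover (fun c => {z | f c =ᶠ[𝓝 z] 1})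
    fun c _ => (f c).eventuallyEq_one.eventuallyEq_nhds
  let B : SmoothBumpCovering (↥(insert x t)) (𝓡 n) M K :=
    { c := fun i => i
      toFun := fun i => f i
      c_mem' := fun i => by
        rcases Finset.mem_insert.1 i.2 with h | h
        · rwa [h]
        · exact htK _ h
      locallyFinite' := locallyFinite_of_finite _
      eventuallyEq_one' := fun y hy => by
        obtain ⟨c, hc, hy⟩ := mem_iUnion₂.1 (ht hy)
        exact ⟨⟨c, Finset.mem_insert_of_mem hc⟩, hy⟩ }
  let P := B.toSmoothPartitionOfUnity
  have hsupp : ∀ i : ↥(insert x t), tsupport (P i) ⊆ tsupport (f i) := fun i =>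
    closure_mono (B.support_toSmoothPartitionOfUnity_subset i)
  have hsum : ∀ y ∈ K, ∑ i, P i y = 1 := fun y hy => by
    rw [← finsum_eq_sum_of_fintype]
    exact P.sum_eq_one hy
  have hxρ : P ⟨x, Finset.mem_insert_self x t⟩ x = 1 := by
    have h := hsum x hxK
    rwa [Fintype.sum_eq_single (⟨x, Finset.mem_insert_self x t⟩ : ↥(insert x t)) fun i hi => ?_] at h
    have hix : (i : M) ≠ x := fun h => hi (Subtype.ext h)
    by_contra h0
    exact (hf i (hsupp i (subset_tsupport _ h0))).2 hix rfl
  refine ⟨↥(insert x t), inferInstance, fun i => E i, fun i => P i,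
    ⟨x, Finset.mem_insert_self x t⟩, by simp [E], ?_, fun i => ?_, fun i => (P i).contMDiff,
    fun i y => P.nonneg i y, fun i => ?_, fun i => (hsupp i).trans ((hf i).trans inter_subset_left),
    hsum⟩
  · exact hxρ
  · by_cases h : (i : M) = x
    · simpa [E, h] using he
    · simpa [E, h] using IsManifold.chart_mem_maximalAtlas (i : M)
  · exact (f i).hasCompactSupport.mono' ((subset_tsupport _).trans (hsupp i))

end

/-! ### The global argument -/

section

variable {G : Coord n → Matrix (Fin n) (Fin n) ℝ} {U : Set (Coord n)} {y : Coord n}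

lemma IsMetricOn.smooth_cottonFlux (hG : IsMetricOn G U) (hy : y ∈ U) {u : Coord n → ℝ}
    (hu : ContDiffAt ℝ ∞ u y) (b : Fin n) : ContDiffAt ℝ ∞ (fun z => IsSolitonOn.cottonFlux G u z b) y :=
  ContDiffAt.sum fun i _ => (ContDiffAt.sum fun j _ =>
    (hG.smooth_cotton hy b i j).mul (hG.smooth_grad hy hu j)).mul (hG.smooth_grad hy hu i)

lemma IsMetricOn.smooth_div (hG : IsMetricOn G U) (hy : y ∈ U) {V : Coord n → Fin n → ℝ}
    (hV : ∀ b, ContDiffAt ℝ ∞ (fun z => V z b) y) :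
    ContDiffAt ℝ ∞ (fun z => tr G z (covDeriv₁ G V z)) y :=
  hG.smooth_tr hy fun a b => (contDiffAt_partialDeriv a (hV b)).sub
    (ContDiffAt.sum fun p _ => (hG.smooth_christoffel hy p a b).mul (hV p))

/-- Dividing by 2h turns k/h + h/(n-2) into k/(2h²) + 1/(2(n-2)): the sign of h disappears. -/
lemma solitonCoeff_div_pos (hn : 3 ≤ n) {h k : ℝ} (hh : h ≠ 0) (hk : 0 < k) :
    0 < solitonCoeff n h k / (2 * h) := by
  have hn' : (3 : ℝ) ≤ n := by exact_mod_cast hn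
  have hn2 : 0 < (n : ℝ) - 2 := by linarith
  have h2 : 0 < h ^ 2 := by positivity
  have : solitonCoeff n h k / (2 * h) = k / (2 * h ^ 2) + 1 / (2 * ((n : ℝ) - 2)) := by
    unfold solitonCoeff
    field_simp
  rw [this]
  positivity

end

section

variable {M : Type*} [TopologicalSpace M] [ChartedSpace (EuclideanSpace ℝ (Fin n)) M]
  [Bundle.RiemannianBundle (fun x : M => TangentSpace (𝓡 n) x)]

lemma mGradInner_sum {ι : Type*} (s : Finset ι) {F : ι → M → ℝ}
    (hF : ∀ i ∈ s, IsChartSmooth n (F i)) [IsManifold (𝓡 n) ∞ M] (g : M → ℝ) (x : M) :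
    mGradInner n (fun z => ∑ i ∈ s, F i z) g x = ∑ i ∈ s, mGradInner n (F i) g x := by
  unfold mGradInner gradInner
  rw [← tr_sum]
  congr 1
  funext a b
  rw [partialDeriv_sum, Finset.sum_mul]
  exact fun i hi => (hF i hi _ (IsManifold.chart_mem_maximalAtlas x) _ (mem_chart_target _ x)).diff

lemma mGradInner_comp {f u : M → ℝ} {x : M} {ψ : ℝ → ℝ} (hψ : ContDiff ℝ ∞ ψ)
    (hu : IsChartSmooth n u) [IsManifold (𝓡 n) ∞ M] (hf : f =ᶠ[𝓝 x] ψ ∘ u) (g : M → ℝ) :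
    mGradInner n f g x = deriv ψ (u x) * mGradInner n u g x := by
  set e := chartAt (EuclideanSpace ℝ (Fin n)) x with he
  have hx : e.symm (e x) = x := e.left_inv (mem_chart_source _ x)
  have hy : e x ∈ e.target := mem_chart_target _ x
  unfold mGradInner gradInner
  rw [← he, ← tr_const_mul]
  congr 1
  funext a b
  have hud := (hu e (IsManifold.chart_mem_maximalAtlas x) _ hy).diff
  have h1 : (fun z => f (e.symm z)) =ᶠ[𝓝 (e x)] fun z => ψ (u (e.symm z)) := by
    have ht : Tendsto e.symm (𝓝 (e x)) (𝓝 x) := by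
      have := e.continuousAt_symm hy
      rwa [ContinuousAt, hx] at this
    exact ht.eventually hf
  have h2 : HasDerivAt ψ (deriv ψ (u x)) (u (e.symm (e x))) := by
    rw [hx]
    exact (hψ.differentiable (by simp)).differentiableAt.hasDerivAt
  rw [partialDeriv_congr a h1, ← mul_assoc]
  congr 1
  have h3 := h2.comp_hasFDerivAt (e x) hud.hasFDerivAt
  rw [partialDeriv, show (fun z => ψ (u (e.symm z))) = ψ ∘ fun z => u (e.symm z) from rfl, h3.fderiv]
  rfl

variable (n) in
/-- The pairing of `df` with the one-form `C(·, ∇u, ∇u)` of a soliton. -/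
def fluxPairing (u h f : M → ℝ) (x : M) : ℝ :=
  1 / (2 * ((n : ℝ) - 1)) *
    (h x * h x * (mGradInner n u u x * mGradInner n f (mGradInner n u u) x
        - mGradInner n u (mGradInner n u u) x * mGradInner n f u x)
      + ((n : ℝ) - 2) * (mGradInner n u h x * mGradInner n f (mGradInner n u u) x
        - mGradInner n u (mGradInner n u u) x * mGradInner n f h x))

variable [IsManifold (𝓡 n) ∞ M] {u h f : M → ℝ}

lemma fluxPairing_sum {ι : Type*} (s : Finset ι) {F : ι → M → ℝ}
    (hF : ∀ i ∈ s, IsChartSmooth n (F i)) (x : M) :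
    fluxPairing n u h (fun z => ∑ i ∈ s, F i z) x = ∑ i ∈ s, fluxPairing n u h (F i) x := by
  simp only [fluxPairing, mGradInner_sum s hF, ← Finset.mul_sum, Finset.sum_add_distrib,
    Finset.sum_sub_distrib]

/-- For f = ψ(u) both brackets become antisymmetric expressions evaluated on equal arguments; this
is the identity C(∇u, ∇u, ∇u) = 0. -/
lemma fluxPairing_comp {x : M} {ψ : ℝ → ℝ} (hψ : ContDiff ℝ ∞ ψ) (hu : IsChartSmooth n u)
    (hf : f =ᶠ[𝓝 x] ψ ∘ u) : fluxPairing n u h f x = 0 := by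
  simp only [fluxPairing, mGradInner_comp hψ hu hf]
  ring

lemma fluxPairing_eq_zero (hu : IsChartSmooth n u) {x : M} (hx : x ∉ tsupport f) :
    fluxPairing n u h f x = 0 :=
  fluxPairing_comp (ψ := fun _ => 0) contDiff_const hu (notMem_tsupport_iff_eventuallyEq.1 hx)

variable [IsContMDiffRiemannianBundle (𝓡 n) ∞ (EuclideanSpace ℝ (Fin n))
    (fun x : M => TangentSpace (𝓡 n) x)]
  {e : OpenPartialHomeomorph M (EuclideanSpace ℝ (Fin n))} {Λ k : M → ℝ}

lemma IsChartSmooth.fluxPairing (hu : IsChartSmooth n u) (hh : IsChartSmooth n h)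
    (hf : IsChartSmooth n f) : IsChartSmooth n (fluxPairing n u h f) := by
  have hQ := hu.mGradInner hu
  exact (IsChartSmooth.const _).mul (((hh.mul hh).mul ((hQ.mul (hf.mGradInner hQ)).sub
    ((hu.mGradInner hQ).mul (hf.mGradInner hu)))).add ((IsChartSmooth.const _).mul
    (((hu.mGradInner hh).mul (hf.mGradInner hQ)).sub
      ((hu.mGradInner hQ).mul (hf.mGradInner hh)))))

/-- `cottonFlux_eq` is paired with df. Thus the coordinate one-forms built from C in different
charts have a common global pairing, without the transformation law of C. -/
lemma fluxPairing_symm_apply (hn : 3 ≤ n) (he : e ∈ IsManifold.maximalAtlas (𝓡 n) ∞ M)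
    (S : IsSolitonOn (chartMetric e) e.target (fun z => u (e.symm z)) (fun z => h (e.symm z))
      (fun z => Λ (e.symm z)) (fun z => k (e.symm z)))
    (hu : IsChartSmooth n u) (hh : IsChartSmooth n h) (hf : IsChartSmooth n f) {y : Coord n}
    (hy : y ∈ e.target) :
    fluxPairing n u h f (e.symm y) = tr (chartMetric e) y (fun a b =>
      partialDeriv a (fun z => f (e.symm z)) y
        * IsSolitonOn.cottonFlux (chartMetric e) (fun z => u (e.symm z)) y b) := by
  have hQ := hu.mGradInner hu
  set v : Coord n → ℝ := fun z => u (e.symm z) with hv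
  set w : Coord n → ℝ := fun z => h (e.symm z) with hw
  set F : Coord n → ℝ := fun z => f (e.symm z) with hF
  set q := gradInner (chartMetric e) v v with hq
  have hqe : (fun z => mGradInner n u u (e.symm z)) =ᶠ[𝓝 y] q := by
    filter_upwards [e.open_target.mem_nhds hy] with z hz
    exact mGradInner_symm_apply he hz hu hu
  have hqd : ∀ g : Coord n → ℝ, gradInner (chartMetric e) g
      (fun z => mGradInner n u u (e.symm z)) y = gradInner (chartMetric e) g q y := by
    intro g
    simp only [gradInner, partialDeriv_congr _ hqe]
  have hlin : ∀ c₁ c₂ c₃ : ℝ, tr (chartMetric e) y (fun a b => partialDeriv a F y *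
      (c₁ * partialDeriv b q y + c₂ * partialDeriv b v y + c₃ * partialDeriv b w y))
      = c₁ * gradInner (chartMetric e) F q y + c₂ * gradInner (chartMetric e) F v y
        + c₃ * gradInner (chartMetric e) F w y := by
    intro c₁ c₂ c₃
    simp only [gradInner, mul_add, mul_left_comm (partialDeriv _ F y), tr_add, tr_const_mul]
  simp only [fluxPairing, mGradInner_symm_apply he hy hu hu, mGradInner_symm_apply he hy hf hQ,
    mGradInner_symm_apply he hy hu hQ, mGradInner_symm_apply he hy hf hu,
    mGradInner_symm_apply he hy hu hh, mGradInner_symm_apply he hy hf hh, hqd, ← hv, ← hw, ← hF,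
    ← hq]
  simp only [S.cottonFlux_eq hn hy, ← hq]
  have := hlin (1 / (2 * ((n : ℝ) - 1)) *
      (w y ^ 2 * q y + ((n : ℝ) - 2) * gradInner (chartMetric e) v w y))
    (- (1 / (2 * ((n : ℝ) - 1)) * (w y ^ 2 * gradInner (chartMetric e) v q y)))
    (- (1 / (2 * ((n : ℝ) - 1)) * (((n : ℝ) - 2) * gradInner (chartMetric e) v q y)))
  calc _ = _ := by
        rw [show h (e.symm y) = w y from rfl]
        ring
    _ = _ := this.symm
    _ = _ := by
        congr 1
        funext a b
        ring

lemma IsAlmostGradientRicciSoliton.isSolitonOn (hsol : IsAlmostGradientRicciSoliton n u h Λ)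
    {φ φ' : ℝ → ℝ} (hφ : ∀ x, h x = φ (u x))
    (hderiv : ∀ t ∈ range u, HasDerivWithinAt φ (φ' t) (range u) t)
    (hpos : ∀ t ∈ range u, 0 < φ' t) (he : e ∈ IsManifold.maximalAtlas (𝓡 n) ∞ M) :
    IsSolitonOn (chartMetric e) e.target (fun z => u (e.symm z)) (fun z => h (e.symm z))
      (fun z => Λ (e.symm z)) (fun z => φ' (u (e.symm z))) where
  metric := isMetricOn_chartMetric he
  smooth_u := hsol.smooth_potential.isChartSmooth e he
  smooth_h := hsol.smooth_signal.isChartSmooth e he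
  smooth_soliton := hsol.smooth_soliton.isChartSmooth e he
  h_ne y _ := hsol.signal.elim (fun H => (H _).ne') fun H => (H _).ne
  equation := hsol.equation e he
  partialDeriv_h y hy i := by
    -- The chain rule needs φ to be differentiable only relative to the range of u, since u takes
    -- all its values there.
    have h1 := (hderiv (u (e.symm y)) (mem_range_self _)).comp_hasFDerivAt
      (f := fun z => u (e.symm z)) y
      (hsol.smooth_potential.isChartSmooth e he y hy).diff.hasFDerivAt
      (Eventually.of_forall fun z => mem_range_self _)
    have h2 : (fun z => h (e.symm z)) = φ ∘ fun z => u (e.symm z) := funext fun z => hφ _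
    rw [partialDeriv, h2, h1.fderiv]
    rfl
  k_pos y _ := hpos _ (mem_range_self _)

variable [T2Space M]

/-- Integration by parts in a chart. -/
lemma integral_mul_div_cottonFlux (hn : 3 ≤ n) (he : e ∈ IsManifold.maximalAtlas (𝓡 n) ∞ M)
    (S : IsSolitonOn (chartMetric e) e.target (fun z => u (e.symm z)) (fun z => h (e.symm z))
      (fun z => Λ (e.symm z)) (fun z => k (e.symm z)))
    (hu : IsChartSmooth n u) (hh : IsChartSmooth n h) (hf : IsChartSmooth n f)
    (hc : HasCompactSupport f) (hfe : tsupport f ⊆ e.source) :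
    IntegrableOn (fun y => f (e.symm y) * tr (chartMetric e) y
      (covDeriv₁ (chartMetric e) (IsSolitonOn.cottonFlux (chartMetric e) fun z => u (e.symm z)) y)
        * volDensity (chartMetric e) y) e.target ∧
    ∫ y in e.target, f (e.symm y) * tr (chartMetric e) y
      (covDeriv₁ (chartMetric e) (IsSolitonOn.cottonFlux (chartMetric e) fun z => u (e.symm z)) y)
        * volDensity (chartMetric e) y = - chartIntegral e (fluxPairing n u h f) := by
  have hG := S.metric
  have hV : ∀ y ∈ e.target, ∀ b, ContDiffAt ℝ ∞
      (fun z => IsSolitonOn.cottonFlux (chartMetric e) (fun z => u (e.symm z)) z b) y :=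
    fun y hy b => hG.smooth_cottonFlux hy (S.smooth_u y hy) b
  have hf0 : ∀ y, e.symm y ∉ tsupport f → f (e.symm y) = 0 := fun y hy => image_eq_zero_of_notMem_tsupport hy
  have i1 := integrableOn_chart he hc hfe
    (g := fun y => f (e.symm y) * tr (chartMetric e) y
      (covDeriv₁ (chartMetric e) (IsSolitonOn.cottonFlux (chartMetric e) fun z => u (e.symm z)) y))
    (fun y hy => ((hf e he y hy).mul (hG.smooth_div hy (hV y hy))).continuousAt.continuousWithinAt)
    (fun y _ hy' => by simp only [hf0 y hy', zero_mul])
  have i2 := integrableOn_chart he hc hfe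
    (g := fun y => fluxPairing n u h f (e.symm y))
    (fun y hy => ((hu.fluxPairing hh hf) e he y hy).continuousAt.continuousWithinAt)
    (fun y _ hy' => fluxPairing_eq_zero hu hy')
  refine ⟨i1, eq_neg_of_add_eq_zero_left ?_⟩
  rw [chartIntegral, ← integral_add i1 i2]
  have hsub : e '' tsupport f ⊆ e.target := by
    rintro _ ⟨x, hx, rfl⟩
    exact e.map_source (hfe hx)
  rw [← hG.integral_mul_div (hc.isCompact.image_of_continuousOn (e.continuousOn.mono hfe)) hsub
    (hf e he) (fun y hy hy' => hf0 y fun h => hy' ⟨_, h, e.right_inv hy⟩) hV]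
  refine setIntegral_congr_fun e.open_target.measurableSet fun y hy => ?_
  simp only [fluxPairing_symm_apply hn he S hu hh hf hy]
  ring

/-- Test the divergence of C(·,∇u,∇u) against a cutoff χ that is locally a function of u: the flux
side vanishes identically, so the nonnegative integrand χ|T|² must vanish at the chosen point. -/
lemma solitonTensor_eq_zero [LocallyCompactSpace M] (hn : 4 ≤ n)
    (S : ∀ e ∈ IsManifold.maximalAtlas (𝓡 n) ∞ M,
      IsSolitonOn (chartMetric e) e.target (fun z => u (e.symm z)) (fun z => h (e.symm z))
        (fun z => Λ (e.symm z)) (fun z => k (e.symm z)))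
    (hu : ContMDiff (𝓡 n) 𝓘(ℝ, ℝ) ∞ u) (hh : ContMDiff (𝓡 n) 𝓘(ℝ, ℝ) ∞ h)
    (hB : IsBachFlat n M) (hlevel : ∀ c, IsCompact (u ⁻¹' {c}))
    (he : e ∈ IsManifold.maximalAtlas (𝓡 n) ∞ M) {y : Coord n} (hy : y ∈ e.target)
    (a b c : Fin n) : solitonTensor (chartMetric e) (fun z => u (e.symm z)) y a b c = 0 := by
  have hn3 : 3 ≤ n := by omega
  have hu' := hu.isChartSmooth
  have hh' := hh.isChartSmooth
  obtain ⟨χ, hχ0, hχpos, hχc, hχu⟩ := exists_cutoff hu.continuous (hlevel (u (e.symm y)))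
  have hχs : ContMDiff (𝓡 n) 𝓘(ℝ, ℝ) ∞ χ := by
    intro x
    obtain ⟨ψ, hψ, hx⟩ := hχu x
    exact (hψ.contMDiff.comp hu).contMDiffAt.congr_of_eventuallyEq hx
  have hχP : ∀ x, fluxPairing n u h χ x = 0 := by
    intro x
    obtain ⟨ψ, hψ, hx⟩ := hχu x
    exact fluxPairing_comp hψ hu' hx
  have hχy := hχpos _ rfl
  obtain ⟨ι, _, E, ρ, i₀, hE, hρy, hEm, hρs, hρ0, hρc, hρE, hρ1⟩ :=
    exists_partition he hχc.isCompact (e.map_target hy) (subset_tsupport _ hχy.ne')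
  set F : ι → M → ℝ := fun i x => ρ i x * χ x with hF
  have hFs : ∀ i, IsChartSmooth n (F i) := fun i => (hρs i).isChartSmooth.mul hχs.isChartSmooth
  have hFρ : ∀ i, tsupport (F i) ⊆ tsupport (ρ i) := fun i => tsupport_mul_subset_left
  have hFχ : ∀ i, tsupport (F i) ⊆ tsupport χ := fun i => tsupport_mul_subset_right
  have hFc : ∀ i, HasCompactSupport (F i) := fun i => (hρc i).mul_right
  have hFsum : (fun x => ∑ i, F i x) = χ := by
    funext x
    rw [hF, ← Finset.sum_mul]
    by_cases hx : x ∈ tsupport χ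
    · rw [hρ1 x hx, one_mul]
    · rw [image_eq_zero_of_notMem_tsupport hx, mul_zero]
  have hP0 : ∀ i x, x ∉ tsupport (F i) → fluxPairing n u h (F i) x = 0 :=
    fun i x hx => fluxPairing_eq_zero hu' hx
  have hPs : ∀ i, IsChartSmooth n (fluxPairing n u h (F i)) := fun i => hu'.fluxPairing hh' (hFs i)
  -- Insert Σⱼ ρⱼ = 1, valid on the support of χ, and move each product to the chart of ρⱼ.
  have hchart : ∀ i, chartIntegral (E i) (fluxPairing n u h (F i))
      = ∑ j, chartIntegral (E j) (fun x => ρ j x * fluxPairing n u h (F i) x) := by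
    intro i
    have h1 : ∀ j, chartIntegral (E j) (fun x => ρ j x * fluxPairing n u h (F i) x)
        = chartIntegral (E i) (fun x => ρ j x * fluxPairing n u h (F i) x) := by
      intro j
      refine chartIntegral_eq (hEm j) (hEm i) (fun x _ hx => ?_) fun x _ hx => ?_
      · rw [hP0 i x fun h => hx (hρE i (hFρ i h)), mul_zero]
      · rw [image_eq_zero_of_notMem_tsupport fun h => hx (hρE j h), zero_mul]
    rw [Finset.sum_congr rfl fun j _ => h1 j]
    simp only [chartIntegral]
    rw [← integral_finsetSum]
    · refine setIntegral_congr_fun (E i).open_target.measurableSet fun z _ => ?_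
      rw [← Finset.sum_mul, ← Finset.sum_mul]
      by_cases hx : (E i).symm z ∈ tsupport χ
      · rw [hρ1 _ hx, one_mul]
      · rw [hP0 i _ fun h => hx (hFχ i h), mul_zero]
    · intro j _
      exact integrableOn_chart (hEm i) (hFc i).isCompact ((hFρ i).trans (hρE i))
        (g := fun z => ρ j ((E i).symm z) * fluxPairing n u h (F i) ((E i).symm z))
        (fun z hz => (((hρs j).isChartSmooth.mul (hPs i)) (E i) (hEm i) z hz).continuousAt.continuousWithinAt)
        fun z _ hx => by simp only [hP0 i _ hx, mul_zero]
  -- After exchanging the sums all terms for a fixed j live in one chart, and summing over i gives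
  -- the pairing with dχ, which is zero.
  have htotal : ∑ i, chartIntegral (E i) (fluxPairing n u h (F i)) = 0 := by
    simp only [hchart]
    rw [Finset.sum_comm]
    refine Finset.sum_eq_zero fun j _ => ?_
    simp only [chartIntegral]
    rw [← integral_finsetSum]
    · refine integral_eq_zero_of_ae (Eventually.of_forall fun z => ?_)
      simp only [← Finset.sum_mul, ← Finset.mul_sum, Pi.zero_apply]
      rw [← fluxPairing_sum Finset.univ (fun i _ => hFs i), hFsum, hχP, mul_zero, zero_mul]
    · intro i _
      exact integrableOn_chart (hEm j) (hρc j).isCompact (hρE j)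
        (g := fun z => ρ j ((E j).symm z) * fluxPairing n u h (F i) ((E j).symm z))
        (fun z hz => (((hρs j).isChartSmooth.mul (hPs i)) (E j) (hEm j) z hz).continuousAt.continuousWithinAt)
        fun z _ hx => by simp only [image_eq_zero_of_notMem_tsupport hx, zero_mul]
  set D : ι → Coord n → ℝ := fun i z => F i ((E i).symm z) * tr (chartMetric (E i)) z
    (covDeriv₁ (chartMetric (E i)) (IsSolitonOn.cottonFlux (chartMetric (E i)) fun z => u ((E i).symm z)) z)
      * volDensity (chartMetric (E i)) z with hD
  have hDint := fun i => integral_mul_div_cottonFlux hn3 (hEm i) (S _ (hEm i)) hu' hh' (hFs i) (hFc i)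
    ((hFρ i).trans (hρE i))
  have hDnonneg : ∀ i, ∀ z ∈ (E i).target, 0 ≤ D i z := by
    intro i z hz
    have Si := S _ (hEm i)
    simp only [hD]
    rw [Si.div_cottonFlux hn (hB _ (hEm i)) hz]
    refine mul_nonneg (mul_nonneg (mul_nonneg (hρ0 _ _) (hχ0 _)) (mul_nonneg
      (solitonCoeff_div_pos hn3 (Si.h_ne z hz) (Si.k_pos z hz)).le (Si.metric.normSq₃_nonneg hz _)))
      (Real.sqrt_nonneg _)
  -- The chart integrals of the divergence are nonnegative with sum zero, so each vanishes; only the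
  -- chart around the given point is needed.
  have hDzero : ∫ z in (E i₀).target, D i₀ z = 0 := by
    have hs : ∑ i, ∫ z in (E i).target, D i z = 0 := by
      rw [Finset.sum_congr rfl fun i _ => (hDint i).2, Finset.sum_neg_distrib, htotal, neg_zero]
    exact (Finset.sum_eq_zero_iff_of_nonneg fun i _ =>
      setIntegral_nonneg (E i).open_target.measurableSet (hDnonneg i)).1 hs i₀ (Finset.mem_univ _)
  subst hE
  have Se := S _ (hEm i₀)
  have hDcont : ContinuousOn (D i₀) (E i₀).target := fun z hz =>
    (((hFs i₀ _ he z hz).mul (Se.metric.smooth_div hz fun b =>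
      Se.metric.smooth_cottonFlux hz (Se.smooth_u z hz) b)).mul
        (Se.metric.smooth_volDensity hz)).continuousAt.continuousWithinAt
  have hae := (setIntegral_eq_zero_iff_of_nonneg_ae
    (ae_restrict_of_forall_mem (E i₀).open_target.measurableSet (hDnonneg i₀)) (hDint i₀).1).1 hDzero
  -- Continuity upgrades almost everywhere vanishing to vanishing at `y`, where ρ equals 1 and χ is
  -- positive.
  have hDy : D i₀ y = 0 := Measure.eqOn_open_of_ae_eq hae (E i₀).open_target hDcont
    continuousOn_const hy
  simp only [hD, hF, hρy, one_mul] at hDy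
  rw [Se.div_cottonFlux hn (hB _ he) hy] at hDy
  have hv := Se.metric.volDensity_pos hy
  have hco := solitonCoeff_div_pos hn3 (Se.h_ne y hy) (Se.k_pos y hy)
  refine Se.metric.eq_zero_of_normSq₃_eq_zero hy ?_ a b c
  -- `div_eq_zero_iff` is excluded so that the positive quotient stays intact and `hco` applies to
  -- it.
  simpa [hv.ne', hχy.ne', hco.ne', mul_eq_zero, -div_eq_zero_iff] using hDy

end

end RicciSoliton

end

theorem corollary1p2 (n : ℕ) (hn : 4 ≤ n)
    {M : Type*} [EMetricSpace M] [ChartedSpace (EuclideanSpace ℝ (Fin n)) M]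
    [IsManifold (𝓡 n) ∞ M]
    [Bundle.RiemannianBundle (fun x : M => TangentSpace (𝓡 n) x)]
    [IsContMDiffRiemannianBundle (𝓡 n) ∞ (EuclideanSpace ℝ (Fin n))
      (fun x : M => TangentSpace (𝓡 n) x)]
    [IsRiemannianManifold (𝓡 n) M] [CompleteSpace M]
    (u h Λ : M → ℝ)
    (hsol : RicciSoliton.IsAlmostGradientRicciSoliton n u h Λ)
    (hbach : RicciSoliton.IsBachFlat n M)
    (hlevel : ∀ c : ℝ, IsCompact (u ⁻¹' {c}))
    (φ φ' : ℝ → ℝ)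
    (hφ : ∀ x, h x = φ (u x))
    (hderiv : ∀ t ∈ Set.range u, HasDerivWithinAt φ (φ' t) (Set.range u) t)
    (hpos : ∀ t ∈ Set.range u, 0 < φ' t) :
    RicciSoliton.IsCottonFlat n M ∧ RicciSoliton.HasHarmonicWeyl n M := by
  have : LocallyCompactSpace M := ChartedSpace.locallyCompactSpace (EuclideanSpace ℝ (Fin n)) M
  have S := fun e (he : e ∈ IsManifold.maximalAtlas (𝓡 n) ∞ M) =>
    hsol.isSolitonOn hφ hderiv hpos he
  have hC : RicciSoliton.IsCottonFlat n M := fun e he _ hy i j k =>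
    (S e he).cotton_eq_zero hn (fun _ hz a b c => RicciSoliton.solitonTensor_eq_zero hn
      (k := fun x => φ' (u x)) S hsol.smooth_potential hsol.smooth_signal hbach hlevel he hz a b c)
      hy i j k
  refine ⟨hC, fun e he y hy i j k => ?_⟩
  rw [(S e he).metric.divWeyl_eq (by omega) hy, hC e he y hy, mul_zero]
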